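/- **Geometry.** Let $\ell_0\in(0,\tfrac13)$, $\ell_i\ge 1$ $(i=1,2,3)$, and let $h_i\in C^3([0,\ell_i])$ be positive and constant near both ends of $[0,\ell_i]$. For $x\in\mathbb R^3$ let $\overline x_i\in\mathbb R^2$ be $x$ without its $i$-th coordinate. Let $\Xi\subset\mathbb R^3$ be a bounded domain containing $0$ such that for each $i$ and some $\delta>0$ $$\Xi\cap\{\xi_i>\ell_0-\delta\}=\{\ell_0-\delta<\xi_i<\ell_0,\ |\overline\xi_i|<h_i(0)\};$$ put $\Upsilon_i=\{\xi_i=\ell_0,\ |\overline\xi_i|\le h_i(0)\}\subset\partial\Xi$ and let $\Gamma=\partial\Xi\setminus\bigcup_i\Upsilon_i$ be of class $C^3$. For $\varepsilon>0$ set $$\Omega^{(0)}_\varepsilon=\varepsilon\,\Xi,\qquad \Omega^{(i)}_\varepsilon=\{\varepsilon\ell_0<x_i<\ell_i,\ |\overline x_i|<\varepsilon h_i(x_i)\}\quad(i=1,2,3),$$ let $\Omega_\varepsilon$ be the interior of $\bigcup_{i=0}^3\overline{\Omega^{(i)}_\varepsilon}$, with outward unit normal $\nu_\varepsilon$, and set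 $\Gamma^{(i)}_\varepsilon=\partial\Omega^{(i)}_\varepsilon\cap\{\varepsilon\ell_0<x_i<\ell_i\}$, $\Upsilon^{(i)}_\varepsilon(s)=\{x_i=s,\ |\overline x_i|<\varepsilon h_i(s)\}$ and $\Gamma^{(0)}_\varepsilon=\partial\Omega^{(0)}_\varepsilon\setminus\bigcup_i\overline{\Upsilon^{(i)}_\varepsilon(\varepsilon\ell_0)}$. **Coefficients.** Let $\alpha\in(0,1)$. The diffusion matrix is $\mathbb D^{(0)}_\varepsilon(x)=A^{(0)}(x/\varepsilon)$ in $\Omega^{(0)}_\varepsilon$ and $\mathbb D^{(i)}_\varepsilon(x)=A^{(i)}(\overline x_i/\varepsilon)$ in $\Omega^{(i)}_\varepsilon$, where $A^{(0)}$ on $\overline\Xi$ and $A^{(i)}$ on the closed disk of radius $\max h_i$ are symmetric, have $C^{1,\alpha}$ entries, and are bounded above and below by positive multiples of the identity; $A^{(0)}=A^{(i)}$ on $\Upsilon_i$; and in $A^{(i)}$ the $i$-th diagonal entry is constant while the other entries of the $i$-th row and column vanish. The velocity in $\Omega^{(i)}_\varepsilon$ $(i=1,2,3)$, denoted $V^{(i)}_\varepsilon$,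 has $i$-th component $v_i(x_i)$ and remaining two components $\varepsilon\,\overline V_i(x_i,\overline x_i/\varepsilon)$, where $v_i$ on $[0,\ell_i]$ and $\overline V_i$ on $\{0\le s\le\ell_i,\ |\overline\xi|\le h_i(s)\}$ are of class $C^{1,\alpha}$, $v_i$ is constant $=\mathrm v_i$ near $0$, $\overline V_i$ vanishes for $x_i$ near $0$ and near $\ell_i$, and $v_1<0$, $v_3>0$, and either $v_2<0$ or $v_2>0$ everywhere. In the node $V^{(0)}_\varepsilon(x)=(\nabla p)(x/\varepsilon)$, where $\sum_i h_i(0)^2\mathrm v_i=0$, $\Delta p=0$ in $\Xi$, $\int_\Xi p=0$, $p\in C(\overline\Xi)$, $\nabla p\in C^{1,\alpha}(\overline\Xi)$, $\partial p/\partial\xi_i=\mathrm v_i$ on $\Upsilon_i$ and $\partial p/\partial\nu=0$ on $\Gamma$. **Admissible $\varepsilon$.** Call $\varepsilon\in(0,1)$ admissible if for all $i$ one has $h_i=h_i(0)$, $v_i=\mathrm v_i$ and $\overline V_i=0$ for $0\le x_i\le\varepsilon\ell_0$, and the three closed cylinders $\overline{\Omega^{(i)}_\varepsilon}$ are pairwise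 disjoint. **Problem.** Let $T>0$. Let $F_i$ be continuous and bounded on $\Omega^{(i)}_\varepsilon\times(0,T)$ $(i=0,\dots,3)$ and $\Phi_i$ continuous and bounded on $\Gamma^{(i)}_\varepsilon\times(0,T)$ $(i=1,2,3)$, the support of $\Phi_i$ with respect to $x_i$ being contained, uniformly in $t$, in a compact subset of $(\varepsilon\ell_0,\ell_i)$. Consider $$\begin{aligned} \partial_t\psi-\varepsilon\,\mathrm{div}(\mathbb D^{(i)}_\varepsilon\nabla\psi)+\mathrm{div}(V^{(i)}_\varepsilon\psi)&=F_i &&\text{in }\Omega^{(i)}_\varepsilon\times(0,T),\ i=1,2,3,\\ (-\varepsilon\,\mathbb D^{(i)}_\varepsilon\nabla\psi+\psi V^{(i)}_\varepsilon)\cdot\nu_\varepsilon&=\varepsilon\Phi_i &&\text{on }\Gamma^{(i)}_\varepsilon\times(0,T),\ i=1,2,3,\\ \partial_t\psi-\varepsilon\,\mathrm{div}(\mathbb D^{(0)}_\varepsilon\nabla\psi)+V^{(0)}_\varepsilon\cdot\nabla\psi&=F_0 &&\text{in }\Omega^{(0)}_\varepsilon\times(0,T),\\ (\mathbb D^{(0)}_\varepsilon\nabla\psi)\cdot\nu_\varepsilon&=0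 &&\text{on }\Gamma^{(0)}_\varepsilon\times(0,T),\\ \psi&=0 &&\text{on }\Upsilon^{(i)}_\varepsilon(\ell_i)\times(0,T),\ i=1,2,3,\\ \psi|_{t=0}&=0 &&\text{on }\Omega_\varepsilon. \end{aligned}$$ A classical solution is a function $\psi\in C(\overline{\Omega_\varepsilon}\times[0,T])$ satisfying these relations pointwise, which is $C^2$ in $x$ and $C^1$ in $t$ in each $\Omega^{(i)}_\varepsilon\times(0,T)$, $i=0,\dots,3$, and whose gradient $\nabla_x\psi$ exists in $\Omega_\varepsilon\times(0,T)$ and extends continuously to $\big(\overline{\Omega_\varepsilon}\setminus\bigcup_i\overline{\Upsilon^{(i)}_\varepsilon(\ell_i)}\big)\times(0,T)$. **Statement.** All sufficiently small $\varepsilon>0$ are admissible, and there is a constant $C_2=C_2(T)>0$, depending only on $T$, the geometric data and the coefficients (in particular not on $\varepsilon,\psi,F_i,\Phi_i$), such that for every admissible $\varepsilon$, all such $F_i$, $\Phi_i$, and every classical solution $\psi_\varepsilon$ of the problem, $$\|\nabla_x\psi_\varepsilon\|_{L^2(\Omega_\varepsilon\times(0,T))}\le C_2(T)\Big(\sum_{i=0}^3\sup_{\Omega^{(i)}_\varepsilon\times(0,T)}|F_i|+\sum_{i=1}^3\sup_{\Gamma^{(i)}_\varepsilon\times(0,T)}|\Phi_i|\Big).$$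 (The suprema are the maxima over the closures whenever $F_i$, $\Phi_i$ extend continuously to them.) -/

import Mathlib

open Set Filter Topology MeasureTheory
open scoped Pointwise NNReal

noncomputable section

namespace ThinJunction

/-- Euclidean space `ℝⁿ`. -/
abbrev E (n : ℕ) := EuclideanSpace ℝ (Fin n)

/-- The transversal variables `x̄ᵢ`, i.e. `x` with its `i`-th coordinate removed. -/
def xbar (i : Fin 3) (x : E 3) : E 2 := WithLp.toLp 2 (fun k => x (i.succAbove k))

/-- The vector of `ℝ³` with `i`-th coordinate `a` and remaining coordinates `b`. -/
def assemble (i : Fin 3) (a : ℝ) (b : E 2) : E 3 :=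
  WithLp.toLp 2 (Fin.insertNth (α := fun _ => ℝ) i a (fun k => b k))

/-- The matrix `A` applied to the vector `v`. -/
def matVec (A : Matrix (Fin 3) (Fin 3) ℝ) (v : E 3) : E 3 :=
  WithLp.toLp 2 (A.mulVec v.ofLp)

/-- The divergence of a vector field on `ℝ³`. -/
def divergence (X : E 3 → E 3) (x : E 3) : ℝ :=
  ∑ j : Fin 3, (fderiv ℝ X x (EuclideanSpace.single j 1)) j

/-- `f ∈ C^{1,α}(closure U)`, for a bounded open set `U`: `f` is continuous on the closure,
differentiable in `U`, and its derivative is `α`-Hölder in `U` (so that the derivative extends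
continuously to the closure). -/
def IsC1Holder {X Y : Type*} [NormedAddCommGroup X] [NormedSpace ℝ X]
    [NormedAddCommGroup Y] [NormedSpace ℝ Y] (α : ℝ≥0) (f : X → Y) (U : Set X) : Prop :=
  ContinuousOn f (closure U) ∧ DifferentiableOn ℝ f U ∧
    ∃ K : ℝ≥0, HolderOnWith K α (fderiv ℝ f) U

/-- `ρ` is a `C^k` local defining function of the open set `Ω` at the boundary point `x₀`:
near `x₀`, `Ω` is the set `{ρ < 0}`, and the gradient of `ρ` does not vanish at `x₀`. -/
structure IsDefiningFunction (k : ℕ) (Ω : Set (E 3)) (x₀ : E 3) (ρ : E 3 → ℝ) : Prop where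
  smooth : ContDiffAt ℝ k ρ x₀
  zero : ρ x₀ = 0
  grad_ne : gradient ρ x₀ ≠ 0
  local_eq : ∀ᶠ x in 𝓝 x₀, (x ∈ Ω ↔ ρ x < 0)

/-- `ν` is the outward unit normal to `∂Ω` at `x₀`. -/
def IsOutwardUnitNormal (Ω : Set (E 3)) (x₀ ν : E 3) : Prop :=
  ∃ ρ : E 3 → ℝ, IsDefiningFunction 1 Ω x₀ ρ ∧ ν = ‖gradient ρ x₀‖⁻¹ • gradient ρ x₀

/-- The disk that the closure of the rescaled node has in the plane `ξᵢ = ℓ₀`. -/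
def nodeDisk (ℓ₀ : ℝ) (r : ℝ) (i : Fin 3) : Set (E 3) := {ξ | ξ i = ℓ₀ ∧ ‖xbar i ξ‖ ≤ r}

/-- The geometric data, independent of `ε`, of a thin graph-like junction of three cylinders.
The indices `1, 2, 3` of the cylinders are here `0, 1, 2 : Fin 3`. -/
structure Geometry where
  /-- the parameter `ℓ₀` -/
  ℓ₀ : ℝ
  /-- the lengths of the cylinders -/
  ℓ : Fin 3 → ℝ
  /-- the aperture functions; only their values on `[0, ℓ i]` matter -/
  h : Fin 3 → ℝ → ℝ
  /-- the rescaled node -/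
  Ξ : Set (E 3)
  ℓ₀_pos : 0 < ℓ₀
  ℓ₀_lt : ℓ₀ < 1 / 3
  one_le_ℓ : ∀ i, 1 ≤ ℓ i
  h_smooth : ∀ i, ContDiffOn ℝ 3 (h i) (Icc 0 (ℓ i))
  h_pos : ∀ i, ∀ s ∈ Icc 0 (ℓ i), 0 < h i s
  h_const_left : ∀ i, ∃ δ > 0, ∀ s ∈ Icc 0 (ℓ i), s ≤ δ → h i s = h i 0
  h_const_right : ∀ i, ∃ δ > 0, ∀ s ∈ Icc 0 (ℓ i), ℓ i - δ ≤ s → h i s = h i (ℓ i)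
  isOpen_Ξ : IsOpen Ξ
  isConnected_Ξ : IsConnected Ξ
  isBounded_Ξ : Bornology.IsBounded Ξ
  zero_mem_Ξ : (0 : E 3) ∈ Ξ
  /-- near the plane `ξᵢ = ℓ₀` the node is a right circular cylinder of radius `h i 0` with
  base in this plane -/
  collar : ∀ i, ∃ δ > 0, ∀ ξ : E 3, ℓ₀ - δ < ξ i → (ξ ∈ Ξ ↔ ξ i < ℓ₀ ∧ ‖xbar i ξ‖ < h i 0)
  /-- the rest of the boundary of the node is of class `C³`; at the rims of the disks the
  boundary of the whole junction is then of class `C³` because of `collar` and `h_const_left` -/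
  smooth_boundary : ∀ ξ ∈ frontier Ξ \ ⋃ i, nodeDisk ℓ₀ (h i 0) i,
    ∃ ρ : E 3 → ℝ, IsDefiningFunction 3 Ξ ξ ρ

namespace Geometry

variable (G : Geometry)

/-- The thin cylinder `Ω_ε^{(i)}`, `i = 1, 2, 3`. -/
def cylinder (ε : ℝ) (i : Fin 3) : Set (E 3) :=
  {x | ε * G.ℓ₀ < x i ∧ x i < G.ℓ i ∧ ‖xbar i x‖ < ε * G.h i (x i)}

/-- The node `Ω_ε^{(0)} = ε Ξ^{(0)}`. -/
def node (ε : ℝ) : Set (E 3) := ε • G.Ξ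

/-- The thin junction `Ω_ε`. -/
def junction (ε : ℝ) : Set (E 3) :=
  interior (closure (G.node ε) ∪ ⋃ i, closure (G.cylinder ε i))

/-- The cross-section `Υ_ε^{(i)}(s)`, an open disk. -/
def crossSection (ε : ℝ) (i : Fin 3) (s : ℝ) : Set (E 3) :=
  {x | x i = s ∧ ‖xbar i x‖ < ε * G.h i s}

/-- The lateral surface `Γ_ε^{(i)}` of the cylinder, `i = 1, 2, 3`. -/
def lateral (ε : ℝ) (i : Fin 3) : Set (E 3) :=
  frontier (G.cylinder ε i) ∩ {x | ε * G.ℓ₀ < x i ∧ x i < G.ℓ i}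

/-- The surface `Γ_ε^{(0)}` of the node. -/
def nodeSurface (ε : ℝ) : Set (E 3) :=
  frontier (G.node ε) \ ⋃ i, closure (G.crossSection ε i (ε * G.ℓ₀))

/-- The values of the rescaled transversal variable `x̄ᵢ / ε` in the `i`-th cylinder: the open
disk whose radius is the maximum of the aperture function. -/
def profile (i : Fin 3) : Set (E 2) := {ξ | ∃ s ∈ Icc 0 (G.ℓ i), ‖ξ‖ < G.h i s}

/-- The values of `(xᵢ, x̄ᵢ / ε)` in the `i`-th cylinder (for all `ε`). -/
def tube (i : Fin 3) : Set (ℝ × E 2) := {z | z.1 ∈ Ioo 0 (G.ℓ i) ∧ ‖z.2‖ < G.h i z.1}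

end Geometry

/-- The diffusion matrix and the velocity field, through their `ε`-independent profiles. -/
structure Coefficients (G : Geometry) where
  /-- the Hölder exponent -/
  α : ℝ≥0
  α_pos : 0 < α
  α_lt_one : α < 1
  /-- the diffusion matrix in the node, as a function of `x / ε` -/
  A₀ : E 3 → Matrix (Fin 3) (Fin 3) ℝ
  /-- the diffusion matrix in the `i`-th cylinder, as a function of `x̄ᵢ / ε` -/
  A : Fin 3 → E 2 → Matrix (Fin 3) (Fin 3) ℝ
  A₀_regular : ∀ m n, IsC1Holder α (fun ξ => A₀ ξ m n) G.Ξ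
  A_regular : ∀ i m n, IsC1Holder α (fun ξ => A i ξ m n) (G.profile i)
  A₀_symm : ∀ ξ ∈ G.Ξ, (A₀ ξ).IsSymm
  A_symm : ∀ i, ∀ ξ ∈ G.profile i, (A i ξ).IsSymm
  /-- in the `i`-th cylinder the axial direction decouples from the transversal ones -/
  A_block : ∀ i, ∀ ξ ∈ G.profile i, ∀ j, j ≠ i → A i ξ i j = 0 ∧ A i ξ j i = 0
  /-- in the `i`-th cylinder the axial coefficient is constant -/
  A_axial : ∀ i, ∀ ξ ∈ G.profile i, ∀ ξ' ∈ G.profile i, A i ξ i i = A i ξ' i i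
  A₀_elliptic : ∃ κ₀ > 0, ∃ κ₁ > 0, ∀ ξ ∈ G.Ξ, ∀ y : Fin 3 → ℝ,
    κ₀ * ∑ m, y m ^ 2 ≤ ∑ m, ∑ n, A₀ ξ m n * y m * y n ∧
      ∑ m, ∑ n, A₀ ξ m n * y m * y n ≤ κ₁ * ∑ m, y m ^ 2
  A_elliptic : ∀ i, ∃ κ₀ > 0, ∃ κ₁ > 0, ∀ ξ ∈ G.profile i, ∀ y : Fin 3 → ℝ,
    κ₀ * ∑ m, y m ^ 2 ≤ ∑ m, ∑ n, A i ξ m n * y m * y n ∧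
      ∑ m, ∑ n, A i ξ m n * y m * y n ≤ κ₁ * ∑ m, y m ^ 2
  /-- the diffusion matrices of the node and of the cylinders match at the common disks -/
  A_match : ∀ i, ∀ ξ ∈ nodeDisk G.ℓ₀ (G.h i 0) i, A₀ ξ = A i (xbar i ξ)
  /-- the axial velocity `v_i^{(i)}` in the `i`-th cylinder -/
  w : Fin 3 → ℝ → ℝ
  /-- the two transversal velocity components in the `i`-th cylinder, divided by `ε`, as a
  function of `xᵢ` and `x̄ᵢ / ε` -/
  vbar : Fin 3 → ℝ → E 2 → E 2
  w_regular : ∀ i, IsC1Holder α (w i) (Ioo 0 (G.ℓ i))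
  vbar_regular : ∀ i, IsC1Holder α (fun z : ℝ × E 2 => vbar i z.1 z.2) (G.tube i)
  w_const : ∀ i, ∃ δ > 0, ∀ s ∈ Icc 0 (G.ℓ i), s ≤ δ → w i s = w i 0
  vbar_support : ∀ i, ∃ δ > 0, ∀ s ∈ Icc 0 (G.ℓ i), (s ≤ δ ∨ G.ℓ i - δ ≤ s) →
    ∀ ξ : E 2, ‖ξ‖ ≤ G.h i s → vbar i s ξ = 0
  /-- the flow enters the first cylinder, leaves the third one, and does either in the second -/
  w_sign_fst : ∀ s ∈ Icc 0 (G.ℓ 0), w 0 s < 0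
  w_sign_snd : (∀ s ∈ Icc 0 (G.ℓ 1), w 1 s < 0) ∨ (∀ s ∈ Icc 0 (G.ℓ 1), 0 < w 1 s)
  w_sign_trd : ∀ s ∈ Icc 0 (G.ℓ 2), 0 < w 2 s
  conservation : ∑ i, G.h i 0 ^ 2 * w i 0 = 0
  /-- the potential of the velocity in the node -/
  p : E 3 → ℝ
  /-- the velocity in the node, as a function of `x / ε` -/
  V₀ : E 3 → E 3
  p_continuous : ContinuousOn p (closure G.Ξ)
  p_harmonic : InnerProductSpace.HarmonicOnNhd p G.Ξ
  p_mean : ∫ ξ in G.Ξ, p ξ = 0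
  V₀_eq : ∀ ξ ∈ G.Ξ, V₀ ξ = gradient p ξ
  V₀_regular : IsC1Holder α V₀ G.Ξ
  V₀_disk : ∀ i, ∀ ξ ∈ nodeDisk G.ℓ₀ (G.h i 0) i, V₀ ξ i = w i 0
  V₀_wall : ∀ ξ ∈ frontier G.Ξ \ ⋃ i, nodeDisk G.ℓ₀ (G.h i 0) i,
    ∀ ν, IsOutwardUnitNormal G.Ξ ξ ν → inner ℝ (V₀ ξ) ν = 0

namespace Coefficients

variable {G : Geometry} (c : Coefficients G)

/-- `𝔻_ε` in the node. -/
def diffNode (ε : ℝ) (x : E 3) : Matrix (Fin 3) (Fin 3) ℝ := c.A₀ (ε⁻¹ • x)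

/-- `𝔻_ε` in the `i`-th cylinder. -/
def diffCyl (ε : ℝ) (i : Fin 3) (x : E 3) : Matrix (Fin 3) (Fin 3) ℝ :=
  c.A i (ε⁻¹ • xbar i x)

/-- `V_ε` in the node. -/
def velNode (ε : ℝ) (x : E 3) : E 3 := c.V₀ (ε⁻¹ • x)

/-- `V_ε` in the `i`-th cylinder. -/
def velCyl (ε : ℝ) (i : Fin 3) (x : E 3) : E 3 :=
  assemble i (c.w i (x i)) (ε • c.vbar i (x i) (ε⁻¹ • xbar i x))

/-- The values of `ε` for which the pieces of the junction and of the velocity field fit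
together: the apertures and the axial velocities are constant, and the transversal velocities
zero, up to the bases `xᵢ = ε ℓ₀`, and the closed cylinders do not meet each other. -/
structure Admissible (ε : ℝ) : Prop where
  pos : 0 < ε
  lt_one : ε < 1
  h_const : ∀ i, ∀ s ∈ Icc 0 (ε * G.ℓ₀), G.h i s = G.h i 0
  w_const : ∀ i, ∀ s ∈ Icc 0 (ε * G.ℓ₀), c.w i s = c.w i 0
  vbar_zero : ∀ i, ∀ s ∈ Icc 0 (ε * G.ℓ₀), ∀ ξ : E 2, ‖ξ‖ ≤ G.h i s → c.vbar i s ξ = 0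
  disjoint : Pairwise fun i j => Disjoint (closure (G.cylinder ε i)) (closure (G.cylinder ε j))

end Coefficients

/-- `ψ` is twice continuously differentiable in `x` and once in `t` in `P × (0, T)`, `P` open. -/
structure IsC21 (ψ : E 3 → ℝ → ℝ) (P : Set (E 3)) (T : ℝ) : Prop where
  space : ∀ t ∈ Ioo 0 T, ContDiffOn ℝ 2 (fun x => ψ x t) P
  hessian : ContinuousOn (fun z : E 3 × ℝ => fderiv ℝ (gradient fun x => ψ x z.2) z.1)
    (P ×ˢ Ioo 0 T)
  time : ∀ x ∈ P, DifferentiableOn ℝ (ψ x) (Ioo 0 T)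
  time_deriv : ContinuousOn (fun z : E 3 × ℝ => deriv (ψ z.1) z.2) (P ×ˢ Ioo 0 T)

/-- A bounded continuous function on `S × (0, T)`. -/
def IsBoundedContinuous (f : E 3 → ℝ → ℝ) (S : Set (E 3)) (T : ℝ) : Prop :=
  ContinuousOn (fun z : E 3 × ℝ => f z.1 z.2) (S ×ˢ Ioo 0 T) ∧
    ∃ M, ∀ x ∈ S, ∀ t ∈ Ioo 0 T, |f x t| ≤ M

/-- The supremum of `|f|` over `S × (0, T)`. It is the maximum over the closure if `f` extends
continuously to the closure. -/
def supAbs (f : E 3 → ℝ → ℝ) (S : Set (E 3)) (T : ℝ) : ℝ :=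
  sSup ((fun z : E 3 × ℝ => |f z.1 z.2|) '' (S ×ˢ Ioo 0 T))

/-- Assumptions on the right-hand sides: bounded and continuous, and the support of `Φ i` with
respect to `xᵢ` lies in `(ε ℓ₀, ℓᵢ)` uniformly in `t`. -/
structure IsData (G : Geometry) (ε T : ℝ) (F₀ : E 3 → ℝ → ℝ) (F Φ : Fin 3 → E 3 → ℝ → ℝ) :
    Prop where
  F₀_bc : IsBoundedContinuous F₀ (G.node ε) T
  F_bc : ∀ i, IsBoundedContinuous (F i) (G.cylinder ε i) T
  Φ_bc : ∀ i, IsBoundedContinuous (Φ i) (G.lateral ε i) T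
  Φ_support : ∀ i, ∃ a b, ε * G.ℓ₀ < a ∧ b < G.ℓ i ∧
    ∀ x ∈ G.lateral ε i, ∀ t ∈ Ioo 0 T, x i ∉ Icc a b → Φ i x t = 0

/-- `ψ` is a classical solution of the initial-boundary value problem, and `g` is the continuous
extension of its spatial gradient to the lateral boundary. -/
structure IsSolutionWithGradient {G : Geometry} (c : Coefficients G) (ε T : ℝ)
    (F₀ : E 3 → ℝ → ℝ) (F Φ : Fin 3 → E 3 → ℝ → ℝ) (ψ : E 3 → ℝ → ℝ) (g : E 3 → ℝ → E 3) :
    Prop where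
  continuous : ContinuousOn (fun z : E 3 × ℝ => ψ z.1 z.2) (closure (G.junction ε) ×ˢ Icc 0 T)
  hasGradient : ∀ x ∈ G.junction ε, ∀ t ∈ Ioo 0 T, HasGradientAt (fun y => ψ y t) (g x t) x
  gradient_continuous : ContinuousOn (fun z : E 3 × ℝ => g z.1 z.2)
    ((closure (G.junction ε) \ ⋃ i, closure (G.crossSection ε i (G.ℓ i))) ×ˢ Ioo 0 T)
  regular_node : IsC21 ψ (G.node ε) T
  regular_cyl : ∀ i, IsC21 ψ (G.cylinder ε i) T
  eq_cyl : ∀ i, ∀ x ∈ G.cylinder ε i, ∀ t ∈ Ioo 0 T,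
    deriv (ψ x) t - ε * divergence (fun y => matVec (c.diffCyl ε i y) (g y t)) x
      + divergence (fun y => ψ y t • c.velCyl ε i y) x = F i x t
  flux_cyl : ∀ i, ∀ x ∈ G.lateral ε i, ∀ t ∈ Ioo 0 T,
    ∀ ν, IsOutwardUnitNormal (G.junction ε) x ν →
      inner ℝ (-(ε • matVec (c.diffCyl ε i x) (g x t)) + ψ x t • c.velCyl ε i x) ν = ε * Φ i x t
  eq_node : ∀ x ∈ G.node ε, ∀ t ∈ Ioo 0 T,
    deriv (ψ x) t - ε * divergence (fun y => matVec (c.diffNode ε y) (g y t)) x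
      + inner ℝ (c.velNode ε x) (g x t) = F₀ x t
  flux_node : ∀ x ∈ G.nodeSurface ε, ∀ t ∈ Ioo 0 T,
    ∀ ν, IsOutwardUnitNormal (G.junction ε) x ν →
      inner ℝ (matVec (c.diffNode ε x) (g x t)) ν = 0
  dirichlet : ∀ i, ∀ x ∈ G.crossSection ε i (G.ℓ i), ∀ t ∈ Ioo 0 T, ψ x t = 0
  initial : ∀ x ∈ G.junction ε, ψ x 0 = 0

/-- Classical solutions of the initial-boundary value problem. -/
def IsClassicalSolution {G : Geometry} (c : Coefficients G) (ε T : ℝ)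
    (F₀ : E 3 → ℝ → ℝ) (F Φ : Fin 3 → E 3 → ℝ → ℝ) (ψ : E 3 → ℝ → ℝ) : Prop :=
  ∃ g : E 3 → ℝ → E 3, IsSolutionWithGradient c ε T F₀ F Φ ψ g

end ThinJunction

end

/-!
The gradient estimate is an energy estimate. The equation, tested with `ψ₊`, gives a bound
of `ε ∬ |∇ψ|²` over the set where `ψ` is positive by the data times the volume of the
junction. This volume is `O(ε)`, so that the factor `ε` cancels (`integral_dissipation_le`). Applied
to `ψ` and to `-ψ`, this gives the full estimate, because `∇ψ` vanishes almost everywhere on the zero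
set of `ψ` (`ae_gradient_eq_zero`). That small `ε` are admissible is elementary: the collars of the
node force `hᵢ(0) < ℓ₀`, which separates the cylinders (`eventually_admissible`).

Two points need care.

*Regularity.* A classical solution is `C²` only inside the node and the open cylinders. Up to the
walls, and across the common disks, just its gradient is continuous, and near the ends of the
cylinders and near `t = 0` and `t = T` there is no control of the gradient. Therefore `ψ₊² / 2` is
replaced by `trunc δ ψ`, which vanishes where `ψ ≤ δ`, hence near the ends and for small times, and
`δ` tends to zero at the end (`exists_lintegral_pos_le`). The divergence theorem is used in the weak
form `WeakDivLE` for the time average of the energy flux: the inequality holds in the pieces where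
the flux is of class `C¹` (`weakDivLE_piece`), extends across the common disks, where the normal
component of the flux is continuous (`WeakDivLE.of_interface`), and extends up to the walls, where
the flux points outwards (`WeakDivLE.of_boundary`). These extensions need a flux that is continuous
up to the boundary, but no surface integrals: those are replaced by the bound
`integral_layer_le` of integrals over thin layers. By compactness one may then test with the constant
`1` (`integral_nonpos_of_weakDivLE`).

*Sign and size at the walls.* The boundary condition of the cylinders leaves the data `ε Φ` and the
normal component of the velocity, both small but without a sign. The energy flux therefore includes
a multiple of the radial field `(0, x̄ᵢ)`. For the defining function `ρ = |x̄ᵢ|² - ε² hᵢ²` of the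
wall, its derivative in the direction of this field is `2 |x̄ᵢ|²`, which is at least a positive
multiple of `ε²` there, while `ε |∇ρ|` and `V · ∇ρ` are `O(ε²)` (`exists_wall_bound`,
`energyFlux_lateral`). The divergence of the radial field contributes only terms that are absorbed
by the dissipation and by the exponential weight in time (`energy_algebra`). At the surface of the
node the flux is tangential (`energyFlux_node`). At the rims of the common disks, where no boundary
condition is imposed, the sign follows by continuity along the wall (`energyFlux_wall`).
-/

noncomputable section

namespace ThinJunction

/-! ### Weak divergence inequalities and their extension up to the boundary -/

section Weak

set_option linter.unusedSectionVars false

variable {H : Type*} [NormedAddCommGroup H] [NormedSpace ℝ H] [FiniteDimensional ℝ H]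
  [MeasurableSpace H] [BorelSpace H] {μ : Measure H} [μ.IsAddHaarMeasure]

/-- The inequality `f + div X ≤ 0` in the sense of distributions in the open set `U`, tested with
nonnegative `C¹` functions with compact support in `U`. -/
def WeakDivLE (μ : Measure H) (X : H → H) (f : H → ℝ) (U : Set H) : Prop :=
  ∀ ζ : H → ℝ, ContDiff ℝ 1 ζ → HasCompactSupport ζ → tsupport ζ ⊆ U → (∀ x, 0 ≤ ζ x) →
    ∫ x, f x * ζ x ∂μ ≤ ∫ x, fderiv ℝ ζ x (X x) ∂μ

theorem WeakDivLE.mono {X : H → H} {f : H → ℝ} {U V : Set H} (h : WeakDivLE μ X f V)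
    (hUV : U ⊆ V) : WeakDivLE μ X f U :=
  fun ζ h1 h2 h3 => h ζ h1 h2 (h3.trans hUV)

/-- A smooth monotone step, equal to `0` on `(-∞, 1]` and to `1` on `[2, ∞)`. -/
def step (s : ℝ) : ℝ := Real.smoothTransition (s - 1)

theorem contDiff_step : ContDiff ℝ 1 step :=
  Real.smoothTransition.contDiff.comp (contDiff_id.sub contDiff_const)

theorem step_nonneg (s : ℝ) : 0 ≤ step s := Real.smoothTransition.nonneg _

theorem step_le_one (s : ℝ) : step s ≤ 1 := Real.smoothTransition.le_one _

theorem step_of_le {s : ℝ} (h : s ≤ 1) : step s = 0 :=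
  Real.smoothTransition.zero_of_nonpos (by linarith)

theorem step_of_ge {s : ℝ} (h : 2 ≤ s) : step s = 1 :=
  Real.smoothTransition.one_of_one_le (by linarith)

theorem deriv_step_nonneg (s : ℝ) : 0 ≤ deriv step s :=
  (Real.smoothTransition.monotone.comp
    (fun a b h => by simpa using h : Monotone fun s : ℝ => s - 1)).deriv_nonneg

theorem deriv_step_of_lt {s : ℝ} (h : s < 1) : deriv step s = 0 := by
  have : step =ᶠ[𝓝 s] fun _ => 0 := by
    filter_upwards [Iio_mem_nhds h] with y hy using step_of_le (le_of_lt hy)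
  rw [this.deriv_eq]; simp

theorem deriv_step_of_gt {s : ℝ} (h : 2 < s) : deriv step s = 0 := by
  have : step =ᶠ[𝓝 s] fun _ => 1 := by
    filter_upwards [Ioi_mem_nhds h] with y hy using step_of_ge (le_of_lt hy)
  rw [this.deriv_eq]; simp

theorem hasDerivAt_step (s : ℝ) : HasDerivAt step (deriv step s) s :=
  (contDiff_step.differentiable (by norm_num) s).hasDerivAt

theorem contDiff_of_contDiffAt_tsupport {F : Type*} [NormedAddCommGroup F] [NormedSpace ℝ F]
    {f : H → F} (h : ∀ x ∈ tsupport f, ContDiffAt ℝ 1 f x) : ContDiff ℝ 1 f := by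
  rw [contDiff_iff_contDiffAt]
  intro x
  by_cases hx : x ∈ tsupport f
  · exact h x hx
  · have : f =ᶠ[𝓝 x] fun _ => 0 := by
      filter_upwards [(isClosed_tsupport f).isOpen_compl.mem_nhds hx] with y hy
      exact image_eq_zero_of_notMem_tsupport hy
    exact contDiffAt_const.congr_of_eventuallyEq this

theorem integrable_of_contDiff {F : Type*} [NormedAddCommGroup F] [NormedSpace ℝ F]
    {ζ : H → F} (h : Continuous ζ) (hc : HasCompactSupport ζ) : Integrable ζ μ :=
  h.integrable_of_hasCompactSupport hc

theorem continuous_fderiv_apply_const {ζ : H → ℝ} (h : ContDiff ℝ 1 ζ) (N : H) :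
    Continuous fun x => fderiv ℝ ζ x N :=
  (h.continuous_fderiv (by norm_num)).clm_apply continuous_const

theorem hasCompactSupport_fderiv_apply {ζ : H → ℝ} (hc : HasCompactSupport ζ) (N : H) :
    HasCompactSupport fun x => fderiv ℝ ζ x N :=
  hc.fderiv_apply ℝ N

theorem integral_fderiv_apply_eq_zero {ζ : H → ℝ} (h : ContDiff ℝ 1 ζ)
    (hc : HasCompactSupport ζ) (N : H) : ∫ x, fderiv ℝ ζ x N ∂μ = 0 := by
  have := integral_mul_fderiv_eq_neg_fderiv_mul_of_integrable (μ := μ) (f := fun _ : H => (1 : ℝ))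
    (g := ζ) (v := N) (by simp) ?_ ?_ (fun x _ => by fun_prop)
    (fun x _ => h.differentiable (by norm_num) x)
  · simpa using this
  · simpa using integrable_of_contDiff (continuous_fderiv_apply_const h N)
      (hasCompactSupport_fderiv_apply hc N)
  · simpa using integrable_of_contDiff h.continuous hc

theorem integrable_fderiv_apply {ζ : H → ℝ} (h : ContDiff ℝ 1 ζ) (hc : HasCompactSupport ζ)
    {X : H → H} (hX : Integrable X μ) : Integrable (fun x => fderiv ℝ ζ x (X x)) μ := by
  have hcont := h.continuous_fderiv (n := 1) (by norm_num)
  obtain ⟨C, hC⟩ := hcont.bounded_above_of_compact_support (hc.fderiv ℝ)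
  refine (hX.norm.const_mul C).mono' ?_ (ae_of_all _ fun x => ?_)
  · exact (ContinuousLinearMap.apply ℝ ℝ : H →L[ℝ] (H →L[ℝ] ℝ) →L[ℝ] ℝ).aestronglyMeasurable_comp₂
      hX.1 hcont.aestronglyMeasurable
  · exact (ContinuousLinearMap.le_opNorm _ _).trans
      (mul_le_mul_of_nonneg_right (hC x) (norm_nonneg _))

theorem integrable_mul_cutoff {ζ : H → ℝ} (h : Continuous ζ) (hc : HasCompactSupport ζ)
    {f : H → ℝ} (hf : Integrable f μ) : Integrable (fun x => f x * ζ x) μ := by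
  obtain ⟨C, hC⟩ := h.bounded_above_of_compact_support hc
  exact hf.mul_bdd h.aestronglyMeasurable (ae_of_all _ hC)

/-- The cut-off `ζ · step (r / η)`, which removes the layer `r ≤ η`, is of class `C¹`. -/
theorem contDiff_mul_step {ζ r : H → ℝ} (h : ContDiff ℝ 1 ζ)
    (hr : ∀ x ∈ tsupport ζ, ContDiffAt ℝ 1 r x) (η : ℝ) :
    ContDiff ℝ 1 fun x => ζ x * step (r x / η) := by
  refine contDiff_of_contDiffAt_tsupport fun x hx => ?_
  have hx' : x ∈ tsupport ζ := closure_mono (Function.support_mul_subset_left _ _) hx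
  exact h.contDiffAt.mul (contDiff_step.contDiffAt.comp x ((hr x hx').div_const η))

theorem fderiv_mul_step {ζ r : H → ℝ} (h : ContDiff ℝ 1 ζ)
    (hr : ∀ x ∈ tsupport ζ, ContDiffAt ℝ 1 r x) (η : ℝ) (x v : H) :
    fderiv ℝ (fun x => ζ x * step (r x / η)) x v =
      step (r x / η) * fderiv ℝ ζ x v + ζ x * (deriv step (r x / η) / η) * fderiv ℝ r x v := by
  by_cases hx : x ∈ tsupport ζ
  · have h1 : HasFDerivAt ζ (fderiv ℝ ζ x) x := (h.differentiable (by norm_num) x).hasFDerivAt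
    have h2 : HasFDerivAt r (fderiv ℝ r x) x :=
      ((hr x hx).differentiableAt (by norm_num)).hasFDerivAt
    have h3 : HasFDerivAt (fun x => r x / η) (η⁻¹ • fderiv ℝ r x) x := by
      simpa [div_eq_inv_mul] using h2.const_mul η⁻¹
    have h4 := h1.mul ((hasDerivAt_step (r x / η)).comp_hasFDerivAt x h3)
    rw [show (fun x => ζ x * step (r x / η)) = ζ * step ∘ fun x => r x / η from rfl, h4.fderiv]
    simp
    ring
  · have h0 : ζ =ᶠ[𝓝 x] fun _ => 0 := by
      filter_upwards [(isClosed_tsupport ζ).isOpen_compl.mem_nhds hx] with y hy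
      exact image_eq_zero_of_notMem_tsupport hy
    have h1 : (fun x => ζ x * step (r x / η)) =ᶠ[𝓝 x] fun _ => 0 := by
      filter_upwards [h0] with y hy
      simp [hy]
    rw [h1.fderiv_eq, h0.fderiv_eq, h0.eq_of_nhds]
    simp

/-- The mass of the derivative of the step in a layer along `{r = 0}` is bounded uniformly in the
thickness of the layer. This replaces the surface measure of `{r = 0}`; the proof tests the
divergence theorem with the constant field `N`. -/
theorem integral_layer_le {ζ r : H → ℝ} (h : ContDiff ℝ 1 ζ) (hc : HasCompactSupport ζ)
    (hζ : ∀ x, 0 ≤ ζ x) (hr : ∀ x ∈ tsupport ζ, ContDiffAt ℝ 1 r x) {N : H} {c : ℝ} (hc0 : 0 < c)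
    (hN : ∀ x ∈ tsupport ζ, c ≤ fderiv ℝ r x N) {η : ℝ} (hη : 0 < η) :
    Integrable (fun x => ζ x * (deriv step (r x / η) / η)) μ ∧
    ∫ x, ζ x * (deriv step (r x / η) / η) ∂μ ≤ c⁻¹ * ∫ x, |fderiv ℝ ζ x N| ∂μ := by
  set φ := fun x => ζ x * step (r x / η) with hφ
  have hφ1 : ContDiff ℝ 1 φ := contDiff_mul_step h hr η
  have hφc : HasCompactSupport φ := hc.mul_right
  have hint := integral_fderiv_apply_eq_zero (μ := μ) hφ1 hφc N
  have hφi : Integrable (fun x => fderiv ℝ φ x N) μ := integrable_of_contDiff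
    (continuous_fderiv_apply_const hφ1 N) (hasCompactSupport_fderiv_apply hφc N)
  have hζi : Integrable (fun x => |fderiv ℝ ζ x N|) μ := (integrable_of_contDiff
    (continuous_fderiv_apply_const h N) (hasCompactSupport_fderiv_apply hc N)).abs
  have key : ∀ x, ζ x * (deriv step (r x / η) / η) ≤
      c⁻¹ * (fderiv ℝ φ x N + |fderiv ℝ ζ x N|) := by
    intro x
    rw [hφ, fderiv_mul_step h hr]
    rw [← div_eq_inv_mul, le_div_iff₀ hc0]
    have hd : 0 ≤ deriv step (r x / η) / η := div_nonneg (deriv_step_nonneg _) hη.le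
    have h1 : ζ x * (deriv step (r x / η) / η) * c ≤
        ζ x * (deriv step (r x / η) / η) * fderiv ℝ r x N := by
      by_cases hx : x ∈ tsupport ζ
      · exact mul_le_mul_of_nonneg_left (hN x hx) (mul_nonneg (hζ x) hd)
      · simp [image_eq_zero_of_notMem_tsupport hx]
    have h2 : -|fderiv ℝ ζ x N| ≤ step (r x / η) * fderiv ℝ ζ x N := by
      have := abs_le.1 (show |step (r x / η) * fderiv ℝ ζ x N| ≤ |fderiv ℝ ζ x N| by
        rw [abs_mul, abs_of_nonneg (step_nonneg _)]
        exact mul_le_of_le_one_left (abs_nonneg _) (step_le_one _))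
      exact this.1
    linarith
  have hcont : Continuous fun x => ζ x * (deriv step (r x / η) / η) := by
    refine continuous_iff_continuousAt.2 fun x => ?_
    by_cases hx : x ∈ tsupport ζ
    · have h1 : ContinuousAt r x := (hr x hx).continuousAt
      have h2 : Continuous (deriv step) := contDiff_step.continuous_deriv (by norm_num)
      exact h.continuous.continuousAt.mul
        ((h2.continuousAt.comp (f := fun x => r x / η) (h1.div_const η)).div_const η)
    · have h0 : (fun x => ζ x * (deriv step (r x / η) / η)) =ᶠ[𝓝 x] fun _ => 0 := by
        filter_upwards [(isClosed_tsupport ζ).isOpen_compl.mem_nhds hx] with y hy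
        simp [image_eq_zero_of_notMem_tsupport hy]
      exact continuousAt_const.congr h0.symm
  have hi : Integrable (fun x => ζ x * (deriv step (r x / η) / η)) μ :=
    integrable_of_contDiff hcont hc.mul_right
  refine ⟨hi, (integral_mono hi ((hφi.add hζi).const_mul c⁻¹) key).trans ?_⟩
  rw [integral_const_mul]
  simp only [Pi.add_apply]
  rw [integral_add hφi hζi, hint, zero_add]

/-- As the thickness of the removed layer tends to zero, the cut-off disappears from integrals of
functions living in `{r > 0}`. -/
theorem tendsto_integral_step {g r : H → ℝ} (hg : Integrable g μ)
    (hm : ∀ η, AEStronglyMeasurable (fun x => step (r x / η) * g x) μ)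
    (hz : ∀ x, r x ≤ 0 → g x = 0) :
    Tendsto (fun η => ∫ x, step (r x / η) * g x ∂μ) (𝓝[>] 0) (𝓝 (∫ x, g x ∂μ)) := by
  refine tendsto_integral_filter_of_dominated_convergence (fun x => ‖g x‖)
    (Eventually.of_forall hm) ?_ hg.norm (ae_of_all _ fun x => ?_)
  · refine Eventually.of_forall fun η => ae_of_all _ fun x => ?_
    rw [norm_mul, Real.norm_of_nonneg (step_nonneg _)]
    exact mul_le_of_le_one_left (norm_nonneg _) (step_le_one _)
  · rcases le_or_gt (r x) 0 with h | h
    · simp [hz x h]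
    · refine tendsto_const_nhds.congr' ?_
      filter_upwards [Ioo_mem_nhdsGT (half_pos h)] with η hη
      rw [step_of_ge, one_mul]
      rw [le_div_iff₀ hη.1]; linarith [hη.2]

/-- Extension of a weak divergence inequality up to a boundary `{r = 0}`, if the flux of `X`
through the boundary has a sign. The test function is cut off in the layer `r ≤ η`; the derivative
of the cut-off contributes the flux of `X` in this layer, which is controlled by
`integral_layer_le` as `η` tends to zero. -/
theorem WeakDivLE.of_boundary {X : H → H} {f : H → ℝ} {U : Set H} {r : H → ℝ} {N : H} {c : ℝ}
    (hX : Integrable X μ) (hf : Integrable f μ) (hc0 : 0 < c)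
    (hr : ∀ x ∈ U, ContDiffAt ℝ 1 r x) (hN : ∀ x ∈ U, c ≤ fderiv ℝ r x N)
    (hX0 : ∀ x ∈ U, r x ≤ 0 → X x = 0) (hf0 : ∀ x ∈ U, r x ≤ 0 → f x = 0)
    (hflux : ∀ y ∈ U, r y = 0 → ∀ e > 0, ∀ᶠ x in 𝓝 y, 0 < r x → fderiv ℝ r x (X x) ≤ e)
    (h : WeakDivLE μ X f (U ∩ {x | 0 < r x})) : WeakDivLE μ X f U := by
  intro ζ hζ hζc hζU hζ0
  have hrζ : ∀ x ∈ tsupport ζ, ContDiffAt ℝ 1 r x := fun x hx => hr x (hζU hx)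
  set C := c⁻¹ * ∫ x, |fderiv ℝ ζ x N| ∂μ with hC
  have hC0 : 0 ≤ C := mul_nonneg (inv_nonneg.2 hc0.le) (integral_nonneg fun x => abs_nonneg _)
  have hφ1 := fun η => contDiff_mul_step hζ hrζ η
  have hφc : ∀ η, HasCompactSupport fun x => ζ x * step (r x / η) := fun η => hζc.mul_right
  have hI1 := integrable_mul_cutoff (μ := μ) hζ.continuous hζc hf
  have hI2 := integrable_fderiv_apply (μ := μ) hζ hζc hX
  -- the sign of the flux persists, up to an error `e`, in a thin layer, by compactness
  have hlayer : ∀ e > 0, ∀ᶠ η in 𝓝[>] (0 : ℝ), ∀ x ∈ tsupport ζ, 0 < r x → r x ≤ 2 * η →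
      fderiv ℝ r x (X x) ≤ e := by
    intro e he
    refine Filter.Eventually.filter_mono nhdsWithin_le_nhds ?_
    have hζc' : IsCompact (tsupport ζ) := hζc
    refine hζc'.eventually_forall_of_forall_eventually
      (P := fun η x => 0 < r x → r x ≤ 2 * η → fderiv ℝ r x (X x) ≤ e) fun y hy => ?_
    rcases eq_or_ne (r y) 0 with h0 | h0
    · have := hflux y (hζU hy) h0 e he
      filter_upwards [(continuous_snd.tendsto ((0 : ℝ), y)).eventually this] with z hz h1 _
      exact hz h1
    · have hcr : ContinuousAt r y := (hrζ y hy).continuousAt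
      have hsnd : Tendsto (fun z : ℝ × H => r z.2) (𝓝 (0, y)) (𝓝 (r y)) :=
        hcr.tendsto.comp (continuous_snd.tendsto ((0 : ℝ), y))
      have hfst : Tendsto (fun z : ℝ × H => 2 * z.1) (𝓝 (0, y)) (𝓝 (2 * 0)) :=
        ((continuous_const.mul continuous_fst).tendsto ((0 : ℝ), y))
      rw [mul_zero] at hfst
      rcases lt_or_gt_of_ne h0 with h1 | h1
      · filter_upwards [hsnd.eventually_lt_const h1] with z hz h2 _
        linarith
      · filter_upwards [hfst.eventually_lt hsnd h1] with z hz _ h2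
        linarith
  have hm1 : ∀ η, Integrable (fun x => step (r x / η) * (f x * ζ x)) μ := fun η => by
    refine (integrable_mul_cutoff (hφ1 η).continuous (hφc η) hf).congr (ae_of_all _ fun x => ?_)
    ring
  have hm2 : ∀ η > 0, ∀ x, fderiv ℝ (fun x => ζ x * step (r x / η)) x (X x)
      = step (r x / η) * fderiv ℝ ζ x (X x)
        + ζ x * (deriv step (r x / η) / η) * fderiv ℝ r x (X x) :=
    fun η _ x => fderiv_mul_step hζ hrζ η x _
  have hm3 : ∀ η, AEStronglyMeasurable (fun x => step (r x / η) * fderiv ℝ ζ x (X x)) μ := by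
    intro η
    -- a cut-off equal to one on the support of `ζ` makes `step (r / η)` globally continuous
    have hs : IsClosed (tsupport ζ) := isClosed_tsupport ζ
    have h1 : AEStronglyMeasurable (fun x => step (r x / η)) (μ.restrict (tsupport ζ)) := by
      refine ContinuousOn.aestronglyMeasurable (fun x hx => ?_) hs.measurableSet
      exact (contDiff_step.continuous.continuousAt.comp (f := fun x => r x / η)
        ((hrζ x hx).continuousAt.div_const η)).continuousWithinAt
    have h2 := h1.mul hI2.1.restrict
    have h3 : (fun x => step (r x / η) * fderiv ℝ ζ x (X x)) =
        (tsupport ζ).indicator (fun x => step (r x / η) * fderiv ℝ ζ x (X x)) := by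
      ext x
      by_cases hx : x ∈ tsupport ζ
      · rw [indicator_of_mem hx]
      · rw [indicator_of_notMem hx, image_eq_zero_of_notMem_tsupport
          (fun h' => hx (tsupport_fderiv_subset ℝ h'))]
        simp
    rw [h3]
    exact (aestronglyMeasurable_indicator_iff hs.measurableSet).2 h2
  have hm4 : ∀ η, Integrable (fun x => step (r x / η) * fderiv ℝ ζ x (X x)) μ := fun η => by
    refine hI2.norm.mono' (hm3 η) (ae_of_all _ fun x => ?_)
    rw [norm_mul, Real.norm_of_nonneg (step_nonneg _)]
    exact mul_le_of_le_one_left (norm_nonneg _) (step_le_one _)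
  have hmain : ∀ e > 0, ∀ᶠ η in 𝓝[>] (0 : ℝ), ∫ x, step (r x / η) * (f x * ζ x) ∂μ ≤
      ∫ x, step (r x / η) * fderiv ℝ ζ x (X x) ∂μ + e * C := by
    intro e he
    filter_upwards [hlayer e he, self_mem_nhdsWithin] with η hη hη0
    have hη0 : 0 < η := hη0
    obtain ⟨hl1, hl2⟩ := integral_layer_le (μ := μ) hζ hζc hζ0 hrζ hc0
      (fun x hx => hN x (hζU hx)) hη0
    have hsupp : tsupport (fun x => ζ x * step (r x / η)) ⊆ U ∩ {x | 0 < r x} := by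
      intro x hx
      have hxζ : x ∈ tsupport ζ := closure_mono (Function.support_mul_subset_left _ _) hx
      refine ⟨hζU hxζ, ?_⟩
      by_contra hneg
      have hlt : r x < η := lt_of_le_of_lt (not_lt.1 hneg) hη0
      have hev := (hrζ x hxζ).continuousAt.eventually_lt_const hlt
      have : (fun x => ζ x * step (r x / η)) =ᶠ[𝓝 x] 0 := by
        filter_upwards [hev] with y hy
        rw [step_of_le ((div_le_one hη0).2 hy.le)]; simp
      exact (notMem_tsupport_iff_eventuallyEq.2 this) hx
    have h1 := h _ (hφ1 η) (hφc η) hsupp fun x => mul_nonneg (hζ0 x) (step_nonneg _)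
    have h2 : ∫ x, fderiv ℝ (fun x => ζ x * step (r x / η)) x (X x) ∂μ ≤
        ∫ x, (step (r x / η) * fderiv ℝ ζ x (X x) + e * (ζ x * (deriv step (r x / η) / η))) ∂μ := by
      refine integral_mono (integrable_fderiv_apply (hφ1 η) (hφc η) hX)
        ((hm4 η).add (hl1.const_mul e)) fun x => ?_
      simp only [hm2 η hη0 x]
      refine add_le_add le_rfl ?_
      have hd : 0 ≤ ζ x * (deriv step (r x / η) / η) :=
        mul_nonneg (hζ0 x) (div_nonneg (deriv_step_nonneg _) hη0.le)
      by_cases hx : x ∈ tsupport ζ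
      · rcases lt_or_ge (r x) η with h3 | h3
        · rw [deriv_step_of_lt ((div_lt_one hη0).2 h3)]; simp
        rcases lt_or_ge (2 * η) (r x) with h4 | h4
        · rw [deriv_step_of_gt ((lt_div_iff₀ hη0).2 h4)]; simp
        rw [mul_comm e]
        exact mul_le_mul_of_nonneg_left (hη x hx (hη0.trans_le h3) h4) hd
      · simp [image_eq_zero_of_notMem_tsupport hx]
    rw [integral_add (hm4 η) (hl1.const_mul e), integral_const_mul] at h2
    have h3 : ∫ x, step (r x / η) * (f x * ζ x) ∂μ =
        ∫ x, f x * (ζ x * step (r x / η)) ∂μ := by congr 1; ext x; ring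
    rw [h3]
    exact h1.trans (h2.trans (by gcongr))
  have hlim1 := tendsto_integral_step (μ := μ) (r := r) hI1 (fun η => (hm1 η).1) (fun x hx => by
    by_cases hxU : x ∈ U
    · simp [hf0 x hxU hx]
    · simp [image_eq_zero_of_notMem_tsupport fun h' => hxU (hζU h')])
  have hlim2 := tendsto_integral_step (μ := μ) (r := r) hI2 hm3 (fun x hx => by
    by_cases hxU : x ∈ U
    · simp [hX0 x hxU hx]
    · rw [image_eq_zero_of_notMem_tsupport (fun h' => hxU (hζU (tsupport_fderiv_subset ℝ h')))]
      simp)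
  have hfin : ∀ e > 0, ∫ x, f x * ζ x ∂μ ≤ ∫ x, fderiv ℝ ζ x (X x) ∂μ + e * C := fun e he =>
    le_of_tendsto_of_tendsto hlim1 (hlim2.add_const _) (hmain e he)
  refine le_of_forall_pos_le_add fun e he => ?_
  have := hfin (e / (C + 1)) (by positivity)
  refine this.trans (by gcongr; rw [div_mul_eq_mul_div, div_le_iff₀ (by positivity)]; nlinarith)

/-- Weak divergence inequalities are local; if one holds near every point of a compact set `K`
outside of which `X` vanishes, one may test with the constant `1`. -/
theorem integral_nonpos_of_weakDivLE {X : H → H} {f : H → ℝ} {K : Set H} (hK : IsCompact K)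
    (hX : Integrable X μ) (hf : Integrable f μ) (hX0 : ∀ x ∉ K, X x = 0) (hf0 : ∀ x ∉ K, f x ≤ 0)
    (h : ∀ x ∈ K, ∃ U, IsOpen U ∧ Bornology.IsBounded U ∧ x ∈ U ∧ WeakDivLE μ X f U) :
    ∫ x, f x ∂μ ≤ 0 := by
  choose! U hUo hUb hxU hU using h
  obtain ⟨t, htK, ht⟩ := hK.elim_nhds_subcover U fun x hx => (hUo x hx).mem_nhds (hxU x hx)
  obtain ⟨p, hp⟩ := SmoothPartitionOfUnity.exists_isSubordinate (modelWithCornersSelf ℝ H)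
    hK.isClosed (fun i : t => U i) (fun i => hUo i (htK i i.2))
    (fun x hx => by
      obtain ⟨i, hi, hxi⟩ := mem_iUnion₂.1 (ht hx)
      exact mem_iUnion.2 ⟨⟨i, hi⟩, hxi⟩)
  have hp1 : ∀ i, ContDiff ℝ 1 (p i) := fun i =>
    ((p i).contMDiff.contDiff).of_le (by exact_mod_cast le_top)
  have hpc : ∀ i, HasCompactSupport (p i) := fun i =>
    Metric.isCompact_of_isClosed_isBounded (isClosed_tsupport _) ((hUb i (htK i i.2)).subset (hp i))
  have hi := fun i : t => hU i (htK i i.2) (p i) (hp1 i) (hpc i) (hp i) (fun x => p.nonneg i x)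
  have hfi : ∀ i, Integrable (fun x => f x * p i x) μ := fun i =>
    integrable_mul_cutoff (hp1 i).continuous (hpc i) hf
  have hXi : ∀ i, Integrable (fun x => fderiv ℝ (p i) x (X x)) μ := fun i =>
    integrable_fderiv_apply (hp1 i) (hpc i) hX
  have hsum := Finset.sum_le_sum fun i (_ : i ∈ Finset.univ) => hi i
  rw [← integral_finsetSum _ fun i _ => hfi i, ← integral_finsetSum _ fun i _ => hXi i] at hsum
  have hone : ∀ x ∈ K, ∑ i, p i x = 1 := fun x hx => by
    rw [← finsum_eq_sum_of_fintype]; exact p.sum_eq_one hx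
  have hle : ∀ x, ∑ i, p i x ≤ 1 := fun x => by
    rw [← finsum_eq_sum_of_fintype]; exact p.sum_le_one x
  -- on `K` the sum of the cut-offs attains its maximum, so that its derivative vanishes there
  have hder : ∀ x, ∑ i, fderiv ℝ (p i) x (X x) = 0 := by
    intro x
    by_cases hx : x ∈ K
    · have hmax : IsLocalMax (fun y => ∑ i, p i y) x :=
        Eventually.of_forall fun y => by simpa only [hone x hx] using hle y
      have h0 := hmax.fderiv_eq_zero
      rw [fderiv_fun_sum fun i _ => (hp1 i).differentiable (by norm_num) x] at h0
      rw [← sum_apply, h0]; simp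
    · simp [hX0 x hx]
  simp only [hder, integral_zero] at hsum
  refine le_trans (integral_mono hf (integrable_finsetSum _ fun i _ => hfi i) fun x => ?_) hsum
  show f x ≤ ∑ i, f x * p i x
  rw [← Finset.mul_sum]
  by_cases hx : x ∈ K
  · rw [hone x hx, mul_one]
  · nlinarith [hf0 x hx, hle x]

/-- Extension of a weak divergence inequality across a hyperplane `{L = c}`, through which the
normal component of `X` is continuous. The test function is cut off near the hyperplane on either
side, and the two contributions of the layers nearly cancel because one layer is a translate of the
other. -/
theorem WeakDivLE.of_interface {X : H → H} {f : H → ℝ} {U : Set H} {L : H →L[ℝ] ℝ} {N : H}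
    (hLN : L N = 1) {c : ℝ} {Z : H → ℝ} (hX : Integrable X μ) (hf : Integrable f μ)
    (hUo : IsOpen U) (hZ : ContinuousOn Z U) (hXZ : ∀ x ∈ U, L x ≠ c → L (X x) = Z x)
    (hX0 : ∀ x ∈ U, L x = c → X x = 0) (hf0 : ∀ x ∈ U, L x = c → f x = 0)
    (h₁ : WeakDivLE μ X f (U ∩ {x | L x < c})) (h₂ : WeakDivLE μ X f (U ∩ {x | c < L x})) :
    WeakDivLE μ X f U := by
  intro ζ hζ hζc hζU hζ0
  set k : H → ℝ := fun x => ζ x * Z x with hk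
  have hkc : Continuous k := by
    refine continuous_iff_continuousAt.2 fun x => ?_
    by_cases hx : x ∈ tsupport ζ
    · exact hζ.continuous.continuousAt.mul (hZ.continuousAt (hUo.mem_nhds (hζU hx)))
    · have : k =ᶠ[𝓝 x] fun _ => 0 := by
        filter_upwards [(isClosed_tsupport ζ).isOpen_compl.mem_nhds hx] with y hy
        simp [hk, image_eq_zero_of_notMem_tsupport hy]
      exact continuousAt_const.congr this.symm
  have hkcs : HasCompactSupport k := hζc.mul_right
  have hku : UniformContinuous k := hkcs.uniformContinuous_of_continuous hkc
  obtain ⟨R, hR⟩ := hζc.isCompact.isBounded.subset_closedBall (0 : H)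
  set R' := max R 0 + 3 * ‖N‖ + 1 with hR'
  have hR'0 : 0 < R' := by positivity
  let χ : ContDiffBump (0 : H) := ⟨R', R' + 1, hR'0, by linarith⟩
  have hχ1 : ContDiff ℝ 1 χ := χ.contDiff
  have hχc : HasCompactSupport χ := χ.hasCompactSupport
  have hLd : ∀ a : ℝ, ContDiff ℝ 1 fun x => L x - a := fun a => L.contDiff.sub contDiff_const
  have hLf : ∀ a : ℝ, ∀ x, fderiv ℝ (fun x => L x - a) x = L := fun a x => by
    rw [fderiv_sub_const]; exact L.fderiv
  set C := (1 : ℝ)⁻¹ * ∫ x, |fderiv ℝ χ x N| ∂μ with hC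
  have hC0 : 0 ≤ C := mul_nonneg (by norm_num) (integral_nonneg fun x => abs_nonneg _)
  have hI1 := integrable_mul_cutoff (μ := μ) hζ.continuous hζc hf
  have hI2 := integrable_fderiv_apply (μ := μ) hζ hζc hX
  -- the weight left by the two cut-offs; the second step is a translate of the first one
  set w : ℝ → H → ℝ := fun η x =>
    step ((L x - c) / η) + (1 - step ((L x - (c - 3 * η)) / η)) with hw
  have hwc : ∀ η, Continuous (w η) := fun η =>
    (contDiff_step.continuous.comp (((hLd c).continuous).div_const η)).add
      (continuous_const.sub (contDiff_step.continuous.comp ((hLd _).continuous.div_const η)))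
  have hw_abs : ∀ η x, |w η x| ≤ 2 := fun η x => by
    have := step_nonneg ((L x - c) / η)
    have := step_le_one ((L x - c) / η)
    have := step_nonneg ((L x - (c - 3 * η)) / η)
    have := step_le_one ((L x - (c - 3 * η)) / η)
    rw [abs_le]; constructor <;> simp only [hw] <;> linarith
  have hw_lim : ∀ x, L x ≠ c → ∀ᶠ η in 𝓝[>] (0 : ℝ), w η x = 1 := by
    intro x hx
    rcases lt_or_gt_of_ne hx with hx | hx
    · filter_upwards [Ioo_mem_nhdsGT (show 0 < (c - L x) / 2 by linarith)] with η hη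
      simp only [hw]
      rw [step_of_le, step_of_le]
      · simp
      · rw [div_le_one hη.1]; linarith [hη.2]
      · rw [div_le_one hη.1]; linarith [hη.1]
    · filter_upwards [Ioo_mem_nhdsGT (show 0 < (L x - c) / 2 by linarith)] with η hη
      simp only [hw]
      rw [step_of_ge, step_of_ge]
      · simp
      · rw [le_div_iff₀ hη.1]; linarith [hη.1]
      · rw [le_div_iff₀ hη.1]; linarith [hη.2]
  have hlim : ∀ G : H → ℝ, Integrable G μ → (∀ x, L x = c → G x = 0) →
      Tendsto (fun η => ∫ x, G x * w η x ∂μ) (𝓝[>] 0) (𝓝 (∫ x, G x ∂μ)) := by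
    intro G hG hG0
    refine tendsto_integral_filter_of_dominated_convergence (fun x => ‖G x‖ * 2)
      (Eventually.of_forall fun η => hG.1.mul (hwc η).aestronglyMeasurable) ?_
      (hG.norm.mul_const 2) (ae_of_all _ fun x => ?_)
    · refine Eventually.of_forall fun η => ae_of_all _ fun x => ?_
      rw [norm_mul]
      exact mul_le_mul_of_nonneg_left (hw_abs η x) (norm_nonneg _)
    · by_cases hx : L x = c
      · simp [hG0 x hx]
      · refine tendsto_const_nhds.congr' ?_
        filter_upwards [hw_lim x hx] with η hη
        rw [hη, mul_one]
  have hmain : ∀ e > 0, ∀ᶠ η in 𝓝[>] (0 : ℝ), ∫ x, f x * ζ x * w η x ∂μ ≤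
      ∫ x, fderiv ℝ ζ x (X x) * w η x ∂μ + e * C := by
    intro e he
    obtain ⟨d, hd0, hd⟩ := Metric.uniformContinuous_iff.1 hku e he
    filter_upwards [Ioo_mem_nhdsGT (show 0 < min 1 (d / (3 * ‖N‖ + 1)) by positivity)] with η hη
    have hη0 : 0 < η := hη.1
    have hη1 : η < 1 := hη.2.trans_le (min_le_left _ _)
    have hηd : 3 * η * ‖N‖ < d := by
      have := (lt_div_iff₀ (by positivity)).1 (hη.2.trans_le (min_le_right _ _))
      nlinarith
    set s : ℝ → H → ℝ := fun a x => step ((L x - a) / η) with hs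
    set s' : ℝ → H → ℝ := fun a x => deriv step ((L x - a) / η) / η with hs'
    have hsc : ∀ a, Continuous (s' a) := fun a =>
      ((contDiff_step.continuous_deriv (by norm_num)).comp
        ((hLd a).continuous.div_const η)).div_const η
    have hφ : ∀ a, ContDiff ℝ 1 fun x => ζ x * s a x := fun a =>
      contDiff_mul_step hζ (fun x _ => (hLd a).contDiffAt) η
    have hφc : ∀ a, HasCompactSupport fun x => ζ x * s a x := fun a => hζc.mul_right
    have hφf : ∀ a x v, fderiv ℝ (fun x => ζ x * s a x) x v =
        s a x * fderiv ℝ ζ x v + ζ x * s' a x * L v := fun a x v => by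
      have := fderiv_mul_step hζ (fun x _ => (hLd a).contDiffAt) η x v
      rw [hLf] at this
      exact this
    have hs'0 : ∀ x, L x = c → s' c x = 0 ∧ s' (c - 3 * η) x = 0 := fun x hx => by
      simp only [hs', hx, sub_self, zero_div, sub_sub_cancel]
      rw [deriv_step_of_lt (by norm_num), deriv_step_of_gt]
      · simp
      · rw [lt_div_iff₀ hη0]; linarith
    -- the test function on the side `c < L x`
    have hA := h₂ (fun x => ζ x * s c x) (hφ c) (hφc c) (by
      intro x hx
      have hxζ : x ∈ tsupport ζ := closure_mono (Function.support_mul_subset_left _ _) hx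
      refine ⟨hζU hxζ, ?_⟩
      by_contra hneg
      have hlt : L x < c + η := by
        have : L x ≤ c := not_lt.1 hneg
        linarith
      have : (fun x => ζ x * s c x) =ᶠ[𝓝 x] 0 := by
        filter_upwards [L.continuous.continuousAt.eventually_lt_const hlt] with y hy
        simp only [hs]
        rw [step_of_le ((div_le_one hη0).2 (by linarith))]; simp
      exact (notMem_tsupport_iff_eventuallyEq.2 this) hx)
      fun x => mul_nonneg (hζ0 x) (step_nonneg _)
    -- the test function on the side `L x < c`
    have hB := h₁ (fun x => ζ x - ζ x * s (c - 3 * η) x) (hζ.sub (hφ _)) (hζc.sub (hφc _)) (by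
      intro x hx
      have hxζ : x ∈ tsupport ζ := by
        refine closure_mono (fun y hy => ?_) hx
        contrapose! hy
        simp [Function.notMem_support.1 hy]
      refine ⟨hζU hxζ, ?_⟩
      by_contra hneg
      have hlt : c - η < L x := by
        have : c ≤ L x := not_lt.1 hneg
        linarith
      have : (fun x => ζ x - ζ x * s (c - 3 * η) x) =ᶠ[𝓝 x] 0 := by
        filter_upwards [L.continuous.continuousAt.eventually_const_lt hlt] with y hy
        simp only [hs]
        rw [step_of_ge ((le_div_iff₀ hη0).2 (by linarith))]; simp
      exact (notMem_tsupport_iff_eventuallyEq.2 this) hx)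
      fun x => by nlinarith [hζ0 x, step_le_one ((L x - (c - 3 * η)) / η)]
    have hfB : ∀ x v, fderiv ℝ (fun x => ζ x - ζ x * s (c - 3 * η) x) x v = fderiv ℝ ζ x v -
        (s (c - 3 * η) x * fderiv ℝ ζ x v + ζ x * s' (c - 3 * η) x * L v) := fun x v => by
      rw [fderiv_fun_sub (hζ.differentiable (by norm_num) x)
        ((hφ _).differentiable (by norm_num) x), sub_apply, hφf]
    have hIA := integrable_mul_cutoff (μ := μ) (hφ c).continuous (hφc c) hf
    have hIB := integrable_mul_cutoff (μ := μ) (hζ.sub (hφ (c - 3 * η))).continuous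
      (hζc.sub (hφc (c - 3 * η))) hf
    have hJA := integrable_fderiv_apply (μ := μ) (hφ c) (hφc c) hX
    have hJB := integrable_fderiv_apply (μ := μ) (hζ.sub (hφ (c - 3 * η)))
      (hζc.sub (hφc (c - 3 * η))) hX
    have hAB := add_le_add hA hB
    rw [← integral_add hIA hIB, ← integral_add hJA hJB] at hAB
    have hkL : ∀ x, L x ≠ c → ζ x * L (X x) = k x := fun x hx => by
      by_cases hxU : x ∈ U
      · simp only [hk]; rw [hXZ x hxU hx]
      · simp [hk, image_eq_zero_of_notMem_tsupport fun h' => hxU (hζU h')]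
    have hi1 : Integrable (fun x => k x * s' c x) μ :=
      integrable_of_contDiff (hkc.mul (hsc c)) hkcs.mul_right
    have hi2 : Integrable (fun x => k x * s' (c - 3 * η) x) μ :=
      integrable_of_contDiff (hkc.mul (hsc _)) hkcs.mul_right
    have hi3 : Integrable (fun x => fderiv ℝ ζ x (X x) * w η x) μ :=
      hI2.mul_bdd (c := 2) (hwc η).aestronglyMeasurable (ae_of_all _ (hw_abs η))
    have e1 : ∫ x, f x * ζ x * w η x ∂μ =
        ∫ x, (f x * (ζ x * s c x) + f x * (ζ x - ζ x * s (c - 3 * η) x)) ∂μ := by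
      congr 1; ext x; simp only [hw, hs]; ring
    have e2 : (fun x => fderiv ℝ (fun x => ζ x * s c x) x (X x) +
        fderiv ℝ (fun x => ζ x - ζ x * s (c - 3 * η) x) x (X x)) =
        fun x => fderiv ℝ ζ x (X x) * w η x + (k x * s' c x - k x * s' (c - 3 * η) x) := by
      ext x
      rw [hφf, hfB]
      by_cases hx : L x = c
      · rw [(hs'0 x hx).1, (hs'0 x hx).2]
        simp only [hw, hs]; ring
      · simp only [← hkL x hx, hw, hs]; ring
    have e3 : ∫ x, k x * s' (c - 3 * η) x ∂μ = ∫ x, k (x - (3 * η) • N) * s' c x ∂μ := by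
      rw [← integral_sub_right_eq_self (fun x => k x * s' (c - 3 * η) x) ((3 * η) • N)]
      congr 1; ext x
      have : L (x - (3 * η) • N) = L x - 3 * η := by simp [hLN]
      simp only [hs', this]
      congr 4; ring
    obtain ⟨hl1, hl2⟩ := integral_layer_le (μ := μ) hχ1 hχc (fun x => χ.nonneg)
      (fun x _ => (hLd c).contDiffAt) (c := 1) one_pos (N := N)
      (fun x _ => by rw [hLf, hLN]) hη0
    have hi4 : Integrable (fun x => k (x - (3 * η) • N) * s' c x) μ := by
      refine integrable_of_contDiff ((hkc.comp (continuous_id.sub continuous_const)).mul (hsc c)) ?_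
      have : HasCompactSupport fun x => k (x - (3 * η) • N) :=
        hkcs.comp_homeomorph (Homeomorph.subRight ((3 * η) • N))
      exact this.mul_right
    have e4 : ∫ x, k x * s' c x ∂μ - ∫ x, k x * s' (c - 3 * η) x ∂μ ≤ e * C := by
      rw [e3, ← integral_sub hi1 hi4]
      refine le_trans (integral_mono (hi1.sub hi4) (hl1.const_mul e) fun x => ?_)
        (by rw [integral_const_mul]; exact mul_le_mul_of_nonneg_left hl2 he.le)
      have hs0 : 0 ≤ s' c x := div_nonneg (deriv_step_nonneg _) hη0.le
      have hnorm : ‖(3 * η) • N‖ = 3 * η * ‖N‖ := by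
        rw [norm_smul, Real.norm_of_nonneg (by positivity)]
      show k x * s' c x - k (x - (3 * η) • N) * s' c x ≤ e * (χ x * s' c x)
      have hkz : ∀ y, max R 0 < ‖y‖ → k y = 0 := fun y hy => by
        refine image_eq_zero_of_notMem_tsupport fun h' => ?_
        have := hR (closure_mono (Function.support_mul_subset_left _ _) h')
        rw [mem_closedBall_zero_iff] at this
        linarith [le_max_left R 0]
      rcases le_or_gt ‖x‖ R' with hx | hx
      · rw [χ.one_of_mem_closedBall (by simpa using hx), one_mul, ← sub_mul]
        refine mul_le_mul_of_nonneg_right ?_ hs0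
        have := hd (a := x) (b := x - (3 * η) • N)
          (by rw [dist_eq_norm, sub_sub_cancel, hnorm]; exact hηd)
        rw [Real.dist_eq] at this
        exact (le_abs_self _).trans this.le
      · have h1 : max R 0 < ‖x‖ := by
          have := norm_nonneg N
          linarith
        have h2 : max R 0 < ‖x - (3 * η) • N‖ := by
          have := norm_sub_norm_le x ((3 * η) • N)
          have := norm_nonneg N
          rw [hnorm] at *
          nlinarith
        rw [hkz _ h1, hkz _ h2]
        have := mul_nonneg he.le (mul_nonneg (χ.nonneg (x := x)) hs0)
        linarith
    rw [e1]
    refine hAB.trans ?_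
    rw [e2, integral_add hi3 (f := fun x => fderiv ℝ ζ x (X x) * w η x)
      (g := fun x => k x * s' c x - k x * s' (c - 3 * η) x) (hi1.sub hi2), integral_sub hi1 hi2]
    linarith
  have hl1 := hlim _ hI1 fun x hx => by
    by_cases hxU : x ∈ U
    · simp [hf0 x hxU hx]
    · simp [image_eq_zero_of_notMem_tsupport fun h' => hxU (hζU h')]
  have hl2 := hlim _ hI2 fun x hx => by
    by_cases hxU : x ∈ U
    · simp [hX0 x hxU hx]
    · rw [image_eq_zero_of_notMem_tsupport (fun h' => hxU (hζU (tsupport_fderiv_subset ℝ h')))]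
      simp
  have hfin : ∀ e > 0, ∫ x, f x * ζ x ∂μ ≤ ∫ x, fderiv ℝ ζ x (X x) ∂μ + e * C := fun e he =>
    le_of_tendsto_of_tendsto hl1 (hl2.add_const _) (hmain e he)
  refine le_of_forall_pos_le_add fun e he => ?_
  have := hfin (e / (C + 1)) (by positivity)
  refine this.trans (by gcongr; rw [div_mul_eq_mul_div, div_le_iff₀ (by positivity)]; nlinarith)

end Weak

end ThinJunction
end

noncomputable section

namespace ThinJunction

/-! ### The truncated energy density -/

/-- A convex `C²` substitute for `s₊² / 2` that vanishes for `s ≤ δ`. -/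
def trunc (δ s : ℝ) : ℝ := (max s δ - δ) ^ 3 / (2 * max s δ)

/-- The derivative of `trunc δ`. -/
def truncD (δ s : ℝ) : ℝ := max s δ - 3 / 2 * δ + δ ^ 3 / (2 * max s δ ^ 2)

/-- The second derivative of `trunc δ`. -/
def truncDD (δ s : ℝ) : ℝ := 1 - δ ^ 3 / max s δ ^ 3

/-- Freezing the argument of `F` below `δ` keeps `F` differentiable if its derivative vanishes at
`δ`. -/
theorem hasDerivAt_comp_max {F F' : ℝ → ℝ} {δ : ℝ} (hF : ∀ m, δ ≤ m → HasDerivAt F (F' m) m)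
    (h0 : F' δ = 0) (s : ℝ) : HasDerivAt (fun s => F (max s δ)) (F' (max s δ)) s := by
  rcases lt_trichotomy s δ with h | h | h
  · rw [max_eq_right h.le, h0]
    refine (hasDerivAt_const s (F δ)).congr_of_eventuallyEq ?_
    filter_upwards [Iio_mem_nhds h] with y hy
    rw [max_eq_right (le_of_lt hy)]
  · subst h
    rw [max_self, h0]
    have h1 : HasDerivWithinAt (fun y => F (max y s)) 0 (Iic s) s :=
      (hasDerivWithinAt_const s (Iic s) (F s)).congr
        (fun y hy => by rw [max_eq_right hy]) (by rw [max_self])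
    have h2 : HasDerivWithinAt (fun y => F (max y s)) 0 (Ici s) s :=
      ((h0 ▸ hF s le_rfl : HasDerivAt F 0 s).hasDerivWithinAt).congr
        (fun y hy => by rw [max_eq_left hy]) (by rw [max_self])
    have h3 := h1.union h2
    rw [Iic_union_Ici] at h3
    exact hasDerivWithinAt_univ.1 h3
  · rw [max_eq_left h.le]
    refine (hF s h.le).congr_of_eventuallyEq ?_
    filter_upwards [Ioi_mem_nhds h] with y hy
    rw [max_eq_left (le_of_lt hy)]

variable {δ : ℝ}

theorem hasDerivAt_trunc (hδ : 0 < δ) (s : ℝ) : HasDerivAt (trunc δ) (truncD δ s) s := by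
  refine hasDerivAt_comp_max (F := fun m => (m - δ) ^ 3 / (2 * m))
    (F' := fun m => m - 3 / 2 * δ + δ ^ 3 / (2 * m ^ 2)) (fun m hm => ?_) (by field_simp; ring) s
  have hm0 : m ≠ 0 := (hδ.trans_le hm).ne'
  have h1 : HasDerivAt (fun m : ℝ => (m - δ) ^ 3) (3 * (m - δ) ^ 2) m := by
    simpa using ((hasDerivAt_id m).sub_const δ).fun_pow 3
  have h2 : HasDerivAt (fun m : ℝ => 2 * m) 2 m := by
    simpa using (hasDerivAt_id m).const_mul (2 : ℝ)
  refine (h1.div h2 (by positivity)).congr_deriv ?_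
  field_simp
  ring

theorem hasDerivAt_truncD (hδ : 0 < δ) (s : ℝ) : HasDerivAt (truncD δ) (truncDD δ s) s := by
  refine hasDerivAt_comp_max (F := fun m => m - 3 / 2 * δ + δ ^ 3 / (2 * m ^ 2))
    (F' := fun m => 1 - δ ^ 3 / m ^ 3) (fun m hm => ?_) (by field_simp; ring) s
  have hm0 : m ≠ 0 := (hδ.trans_le hm).ne'
  have h2 : HasDerivAt (fun m : ℝ => 2 * m ^ 2) (2 * (2 * m)) m := by
    simpa using ((hasDerivAt_id m).fun_pow 2).const_mul (2 : ℝ)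
  have h3 := ((hasDerivAt_id m).sub_const (3 / 2 * δ)).add
    ((hasDerivAt_const m (δ ^ 3)).div h2 (by positivity))
  refine h3.congr_deriv ?_
  field_simp
  ring

theorem continuous_truncDD (hδ : 0 < δ) : Continuous (truncDD δ) := by
  have : ∀ s : ℝ, max s δ ^ 3 ≠ 0 := fun s => (pow_pos (hδ.trans_le (le_max_right s δ)) 3).ne'
  unfold truncDD
  fun_prop (disch := exact this _)

theorem contDiff_truncD (hδ : 0 < δ) : ContDiff ℝ 1 (truncD δ) := by
  rw [contDiff_one_iff_deriv]
  refine ⟨fun s => (hasDerivAt_truncD hδ s).differentiableAt, ?_⟩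
  rw [funext fun s => (hasDerivAt_truncD hδ s).deriv]
  exact continuous_truncDD hδ

theorem contDiff_trunc (hδ : 0 < δ) : ContDiff ℝ 1 (trunc δ) := by
  rw [contDiff_one_iff_deriv]
  refine ⟨fun s => (hasDerivAt_trunc hδ s).differentiableAt, ?_⟩
  rw [funext fun s => (hasDerivAt_trunc hδ s).deriv]
  exact (contDiff_truncD hδ).continuous

theorem trunc_of_le {s : ℝ} (h : s ≤ δ) : trunc δ s = 0 := by
  simp [trunc, max_eq_right h]

theorem truncD_of_le (hδ : 0 < δ) {s : ℝ} (h : s ≤ δ) : truncD δ s = 0 := by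
  have := hδ.ne'
  simp only [truncD, max_eq_right h]; field_simp; ring

theorem truncDD_of_le (hδ : 0 < δ) {s : ℝ} (h : s ≤ δ) : truncDD δ s = 0 := by
  rw [truncDD, max_eq_right h, div_self (pow_pos hδ 3).ne', sub_self]

theorem trunc_nonneg (hδ : 0 < δ) (s : ℝ) : 0 ≤ trunc δ s := by
  have := le_max_right s δ
  exact div_nonneg (pow_nonneg (by linarith) 3) (by linarith)

theorem truncD_eq (hδ : 0 < δ) {s : ℝ} (h : δ ≤ s) :
    truncD δ s = (s - δ) ^ 2 * (2 * s + δ) / (2 * s ^ 2) := by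
  have : s ≠ 0 := (hδ.trans_le h).ne'
  simp only [truncD, max_eq_left h]; field_simp; ring

theorem truncD_nonneg (hδ : 0 < δ) (s : ℝ) : 0 ≤ truncD δ s := by
  rcases le_total s δ with h | h
  · rw [truncD_of_le hδ h]
  · have : 0 < s := hδ.trans_le h
    rw [truncD_eq hδ h]; positivity

theorem truncDD_nonneg (hδ : 0 < δ) (s : ℝ) : 0 ≤ truncDD δ s := by
  have := le_max_right s δ
  have h : δ ^ 3 / max s δ ^ 3 ≤ 1 := by
    rw [div_le_one (by positivity)]; gcongr
  simp only [truncDD]; linarith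

theorem truncDD_le_one (hδ : 0 < δ) (s : ℝ) : truncDD δ s ≤ 1 := by
  have := le_max_right s δ
  have h : 0 ≤ δ ^ 3 / max s δ ^ 3 := by positivity
  simp only [truncDD]; linarith

/-- The defect `s β(s) - B(s)`, where `B = trunc δ` and `β` is its derivative. It is what remains of
the transport term after testing the equation with `β(ψ)`. -/
def truncK (δ s : ℝ) : ℝ := s * truncD δ s - trunc δ s

theorem hasDerivAt_truncK (hδ : 0 < δ) (s : ℝ) :
    HasDerivAt (truncK δ) (s * truncDD δ s) s := by
  have := ((hasDerivAt_id s).mul (hasDerivAt_truncD hδ s)).sub (hasDerivAt_trunc hδ s)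
  refine this.congr_deriv ?_
  simp

theorem truncK_of_le (hδ : 0 < δ) {s : ℝ} (h : s ≤ δ) : truncK δ s = 0 := by
  simp [truncK, truncD_of_le hδ h, trunc_of_le h]

theorem truncK_eq (hδ : 0 < δ) {s : ℝ} (h : δ ≤ s) :
    truncK δ s = (s - δ) ^ 2 * (s + 2 * δ) / (2 * s) := by
  have : s ≠ 0 := (hδ.trans_le h).ne'
  simp only [truncK, truncD_eq hδ h, trunc, max_eq_left h]; field_simp; ring

theorem truncK_nonneg (hδ : 0 < δ) (s : ℝ) : 0 ≤ truncK δ s := by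
  rcases le_total s δ with h | h
  · rw [truncK_of_le hδ h]
  · have : 0 < s := hδ.trans_le h
    rw [truncK_eq hδ h]; positivity

theorem truncD_sq_le (hδ : 0 < δ) (s : ℝ) : truncD δ s ^ 2 ≤ 5 * trunc δ s := by
  rcases le_total s δ with h | h
  · simp [truncD_of_le hδ h, trunc_of_le h]
  · have hs : 0 < s := hδ.trans_le h
    have hv : 0 ≤ s - δ := by linarith
    rw [truncD_eq hδ h, trunc, max_eq_left h, div_pow, ← mul_div_assoc,
      div_le_div_iff₀ (by positivity) (by positivity)]
    have h1 : (2 * s + δ) ^ 2 ≤ (3 * s) ^ 2 := by gcongr; linarith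
    have h2 : (s - δ) ^ 4 ≤ (s - δ) ^ 3 * s := by
      rw [pow_succ]; gcongr; linarith
    calc ((s - δ) ^ 2 * (2 * s + δ)) ^ 2 * (2 * s) = (s - δ) ^ 4 * (2 * s + δ) ^ 2 * (2 * s) := by
          ring
      _ ≤ ((s - δ) ^ 3 * s) * (3 * s) ^ 2 * (2 * s) := by gcongr
      _ ≤ 5 * (s - δ) ^ 3 * (2 * s ^ 2) ^ 2 := by
        have : 0 ≤ (s - δ) ^ 3 * s ^ 4 := by positivity
        nlinarith

theorem truncK_le (hδ : 0 < δ) (s : ℝ) : truncK δ s ≤ 4 * trunc δ s + 2 * δ ^ 2 := by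
  rcases le_total s δ with h | h
  · rw [truncK_of_le hδ h, trunc_of_le h]; positivity
  · have hs : 0 < s := hδ.trans_le h
    have hv : 0 ≤ s - δ := by linarith
    rw [truncK_eq hδ h, trunc, max_eq_left h, ← mul_div_assoc, div_add' _ _ _ (by positivity),
      div_le_div_iff_of_pos_right (by positivity)]
    rcases le_total (s - δ) δ with h1 | h1
    · have : (s - δ) ^ 2 ≤ δ ^ 2 := by gcongr
      have h3 : (s - δ) ^ 2 * (3 * δ) ≤ δ ^ 2 * (3 * s) := by gcongr
      have h4 : 0 ≤ (s - δ) ^ 3 := by positivity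
      have h5 : 0 ≤ δ ^ 2 * s := by positivity
      nlinarith
    · have h3 : (s - δ) ^ 2 * (3 * δ) ≤ (s - δ) ^ 2 * (3 * (s - δ)) := by gcongr
      have h5 : 0 ≤ δ ^ 2 * s := by positivity
      nlinarith

theorem truncDD_mul_sq_le (hδ : 0 < δ) (s : ℝ) :
    truncDD δ s * s ^ 2 ≤ 16 * trunc δ s + 4 * δ ^ 2 := by
  rcases le_total s δ with h | h
  · rw [truncDD_of_le hδ h, trunc_of_le h]; simp; positivity
  · have hs : 0 < s := hδ.trans_le h
    have hB := trunc_nonneg hδ s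
    have h1 : truncDD δ s * s ^ 2 ≤ s ^ 2 := by
      have := truncDD_le_one hδ s
      have := sq_nonneg s
      nlinarith
    refine h1.trans ?_
    rcases le_total s (2 * δ) with h2 | h2
    · nlinarith
    · have h3 : s ^ 2 ≤ 16 * trunc δ s := by
        rw [trunc, max_eq_left h, ← mul_div_assoc, le_div_iff₀ (by positivity)]
        have : (s / 2) ^ 3 ≤ (s - δ) ^ 3 := by gcongr; linarith
        nlinarith
      nlinarith [sq_nonneg δ]

theorem tendsto_truncDD {s : ℝ} (hs : 0 < s) :
    Tendsto (fun δ => truncDD δ s) (𝓝[>] 0) (𝓝 1) := by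
  have h1 : Tendsto (fun δ : ℝ => 1 - δ ^ 3 / s ^ 3) (𝓝 0) (𝓝 (1 - 0 ^ 3 / s ^ 3)) :=
    Continuous.tendsto (by fun_prop) 0
  have h2 : Tendsto (fun δ : ℝ => 1 - δ ^ 3 / s ^ 3) (𝓝[>] 0) (𝓝 1) := by
    refine (by simpa using h1 : Tendsto (fun δ : ℝ => 1 - δ ^ 3 / s ^ 3) (𝓝 0) (𝓝 1)).mono_left
      nhdsWithin_le_nhds
  refine h2.congr' ?_
  filter_upwards [Ioo_mem_nhdsGT hs] with δ hδ
  rw [truncDD, max_eq_left hδ.2.le]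

end ThinJunction
end

noncomputable section

namespace ThinJunction

/-! ### Geometry of the junction -/

/-- `xbar i` as a continuous linear map. -/
def xbarL (i : Fin 3) : E 3 →L[ℝ] E 2 :=
  LinearMap.toContinuousLinearMap
    { toFun := xbar i
      map_add' := fun x y => by ext k; simp [xbar]
      map_smul' := fun a x => by ext k; simp [xbar] }

@[simp] theorem xbarL_apply (i : Fin 3) (x : E 3) : xbarL i x = xbar i x := rfl

@[simp] theorem xbar_apply (i : Fin 3) (x : E 3) (k : Fin 2) : xbar i x k = x (i.succAbove k) := rfl

theorem continuous_xbar (i : Fin 3) : Continuous (xbar i) := (xbarL i).continuous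

theorem continuous_coord (i : Fin 3) : Continuous fun x : E 3 => x i :=
  (EuclideanSpace.proj i : E 3 →L[ℝ] ℝ).continuous

theorem xbar_smul (i : Fin 3) (a : ℝ) (x : E 3) : xbar i (a • x) = a • xbar i x :=
  (xbarL i).map_smul a x

@[simp] theorem assemble_self (i : Fin 3) (a : ℝ) (b : E 2) : assemble i a b i = a := by
  simp [assemble]

@[simp] theorem assemble_succAbove (i : Fin 3) (a : ℝ) (b : E 2) (k : Fin 2) :
    assemble i a b (i.succAbove k) = b k := by
  simp [assemble]

@[simp] theorem xbar_assemble (i : Fin 3) (a : ℝ) (b : E 2) : xbar i (assemble i a b) = b := by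
  ext k; simp

theorem eq_assemble (i : Fin 3) (x : E 3) : x = assemble i (x i) (xbar i x) := by
  ext j
  rcases Fin.eq_self_or_eq_succAbove i j with rfl | ⟨k, rfl⟩ <;> simp

theorem inner_eq (i : Fin 3) (x y : E 3) :
    inner ℝ x y = x i * y i + inner ℝ (xbar i x) (xbar i y) := by
  rw [PiLp.inner_apply, PiLp.inner_apply, Fin.sum_univ_succAbove _ i]
  simp [mul_comm]

theorem norm_sq_eq (i : Fin 3) (x : E 3) : ‖x‖ ^ 2 = x i ^ 2 + ‖xbar i x‖ ^ 2 := by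
  rw [← real_inner_self_eq_norm_sq, inner_eq i, real_inner_self_eq_norm_sq]; ring

theorem norm_xbar_le (i : Fin 3) (x : E 3) : ‖xbar i x‖ ≤ ‖x‖ := by
  have := norm_sq_eq i x
  exact le_of_sq_le_sq (by nlinarith [sq_nonneg (x i)]) (norm_nonneg _)

theorem abs_coord_le (i : Fin 3) (x : E 3) : |x i| ≤ ‖x‖ := by
  have := norm_sq_eq i x
  exact abs_le_of_sq_le_sq (by nlinarith [sq_nonneg (‖xbar i x‖)]) (norm_nonneg _)

theorem abs_coord_le_xbar {i j : Fin 3} (h : j ≠ i) (x : E 3) : |x j| ≤ ‖xbar i x‖ := by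
  obtain ⟨k, rfl⟩ := Fin.exists_succAbove_eq h
  simpa using PiLp.norm_apply_le (xbar i x) k

/-- `assemble i` as a continuous linear map. -/
def assembleL (i : Fin 3) : ℝ × E 2 →L[ℝ] E 3 :=
  LinearMap.toContinuousLinearMap
    { toFun := fun z => assemble i z.1 z.2
      map_add' := fun x y => by
        ext j
        rcases Fin.eq_self_or_eq_succAbove i j with rfl | ⟨k, rfl⟩ <;> simp
      map_smul' := fun a x => by
        ext j
        rcases Fin.eq_self_or_eq_succAbove i j with rfl | ⟨k, rfl⟩ <;> simp }

@[simp] theorem assembleL_apply (i : Fin 3) (z : ℝ × E 2) :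
    assembleL i z = assemble i z.1 z.2 := rfl

theorem continuous_assemble (i : Fin 3) : Continuous fun z : ℝ × E 2 => assemble i z.1 z.2 :=
  (assembleL i).continuous

theorem norm_assemble_le (i : Fin 3) (a : ℝ) (b : E 2) : ‖assemble i a b‖ ≤ |a| + ‖b‖ := by
  have := norm_sq_eq i (assemble i a b)
  rw [assemble_self, xbar_assemble, ← sq_abs a] at this
  refine le_of_sq_le_sq ?_ (by positivity)
  nlinarith [mul_nonneg (abs_nonneg a) (norm_nonneg b)]

namespace Geometry

variable (G : Geometry)

theorem ℓ_pos (i : Fin 3) : 0 < G.ℓ i := by linarith [G.one_le_ℓ i]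

theorem h0_pos (i : Fin 3) : 0 < G.h i 0 := G.h_pos i 0 ⟨le_rfl, (G.ℓ_pos i).le⟩

theorem continuousOn_h (i : Fin 3) : ContinuousOn (G.h i) (Icc 0 (G.ℓ i)) :=
  (G.h_smooth i).continuousOn

theorem contDiffAt_h (i : Fin 3) {s : ℝ} (hs : s ∈ Ioo 0 (G.ℓ i)) : ContDiffAt ℝ 1 (G.h i) s :=
  ((G.h_smooth i).contDiffAt (Icc_mem_nhds hs.1 hs.2)).of_le (by norm_num)

/-- A common width of the three collars. -/
theorem exists_collar : ∃ δ, 0 < δ ∧ δ < G.ℓ₀ ∧ ∀ i, ∀ ξ : E 3, G.ℓ₀ - δ < ξ i →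
    (ξ ∈ G.Ξ ↔ ξ i < G.ℓ₀ ∧ ‖xbar i ξ‖ < G.h i 0) := by
  choose d hd hc using G.collar
  have h0 := G.ℓ₀_pos
  refine ⟨min (G.ℓ₀ / 2) (min (d 0) (min (d 1) (d 2))), ?_, ?_, fun i ξ hξ => hc i ξ ?_⟩
  · simp [hd, h0]
  · exact (min_le_left _ _).trans_lt (by linarith)
  · have : min (G.ℓ₀ / 2) (min (d 0) (min (d 1) (d 2))) ≤ d i := by
      fin_cases i <;> simp
    linarith

theorem coord_lt_of_mem_Ξ {ξ : E 3} (h : ξ ∈ G.Ξ) (i : Fin 3) : ξ i < G.ℓ₀ := by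
  obtain ⟨δ, h0, -, hc⟩ := G.exists_collar
  by_contra hneg
  exact hneg (((hc i ξ (by linarith [not_lt.1 hneg])).1 h).1)

/-- The radius of each of the three outlets of the node is less than `ℓ₀`: otherwise the collars of
two different outlets would overlap in a contradictory way. -/
theorem h0_lt (i : Fin 3) : G.h i 0 < G.ℓ₀ := by
  obtain ⟨δ, hδ0, hδl, hc⟩ := G.exists_collar
  have hl := G.ℓ₀_pos
  have hle : ∀ i, G.h i 0 ≤ G.ℓ₀ := by
    intro i
    by_contra! hlt
    -- the point of the disk `ξᵢ = ℓ₀ - δ/2` whose distance from the axis, in direction `j`, is `ℓ₀`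
    have hm : assemble i (G.ℓ₀ - δ / 2) (EuclideanSpace.single 0 G.ℓ₀) ∈ G.Ξ := by
      rw [hc i _ (by rw [assemble_self]; linarith)]
      refine ⟨by rw [assemble_self]; linarith, ?_⟩
      rw [xbar_assemble]
      simpa [abs_of_pos hl] using hlt
    have := G.coord_lt_of_mem_Ξ hm (i.succAbove 0)
    rw [assemble_succAbove] at this
    simp at this
  refine lt_of_le_of_ne (hle i) fun heq => ?_
  set j := i.succAbove 0 with hj
  -- membership of the points of the intersection of the two collars
  have key : ∀ a d b : ℝ, G.ℓ₀ - δ < a → a < G.ℓ₀ → G.ℓ₀ - δ < d → d < G.ℓ₀ →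
      (d ^ 2 + b ^ 2 < G.ℓ₀ ^ 2 ↔ a ^ 2 + b ^ 2 < G.h j 0 ^ 2) := by
    intro a d b ha1 ha2 hd1 hd2
    set ξ : E 3 := assemble i a (WithLp.toLp 2 ![d, b]) with hξ
    have hξi : ξ i = a := assemble_self _ _ _
    have hξj : ξ j = d := by rw [hξ, hj, assemble_succAbove]; simp
    have hn : ‖xbar i ξ‖ ^ 2 = d ^ 2 + b ^ 2 := by
      rw [hξ, xbar_assemble, EuclideanSpace.norm_sq_eq]
      simp
    have hn2 : ‖xbar j ξ‖ ^ 2 = a ^ 2 + b ^ 2 := by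
      have h1 := norm_sq_eq i ξ
      rw [norm_sq_eq j ξ, hn, hξi, hξj] at h1
      linarith
    have h1 := hc i ξ (by rwa [hξi])
    rw [hc j ξ (by rwa [hξj]), hξi, hξj, heq] at h1
    rw [← hn, ← hn2, sq_lt_sq₀ (norm_nonneg _) hl.le, sq_lt_sq₀ (norm_nonneg _) (G.h0_pos j).le]
    exact ⟨fun h => (h1.2 ⟨ha2, h⟩).2, fun h => (h1.1 ⟨hd2, h⟩).2⟩
  have hj0 := G.h0_pos j
  have hjl : G.h j 0 = G.ℓ₀ := by
    refine le_antisymm (hle j) (not_lt.1 fun hlt => ?_)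
    have h1 : G.ℓ₀ - δ / 2 ≤ max (G.h j 0) (G.ℓ₀ - δ / 2) := le_max_right _ _
    have h2 : G.h j 0 ≤ max (G.h j 0) (G.ℓ₀ - δ / 2) := le_max_left _ _
    have := (key (max (G.h j 0) (G.ℓ₀ - δ / 2)) (G.ℓ₀ - δ / 2) 0 (by linarith)
      (max_lt hlt (by linarith)) (by linarith) (by linarith)).1 (by nlinarith)
    nlinarith
  have hb2 : Real.sqrt (G.ℓ₀ ^ 2 - (G.ℓ₀ - δ / 3) ^ 2) ^ 2 = G.ℓ₀ ^ 2 - (G.ℓ₀ - δ / 3) ^ 2 :=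
    Real.sq_sqrt (by nlinarith)
  have := (key (G.ℓ₀ - 2 * (δ / 3)) (G.ℓ₀ - δ / 3) (Real.sqrt (G.ℓ₀ ^ 2 - (G.ℓ₀ - δ / 3) ^ 2))
    (by linarith) (by linarith) (by linarith) (by linarith)).2 (by rw [hb2, hjl]; nlinarith)
  rw [hb2] at this
  linarith

/-- The closed cylinder, with base at `xᵢ = ε ℓ₀`. -/
def closedCylinder (ε : ℝ) (i : Fin 3) : Set (E 3) :=
  {x | ε * G.ℓ₀ ≤ x i ∧ x i ≤ G.ℓ i ∧ ‖xbar i x‖ ≤ ε * G.h i (x i)}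

variable {G} {ε : ℝ}

theorem isClosed_closedCylinder (hε : 0 < ε) (i : Fin 3) : IsClosed (G.closedCylinder ε i) := by
  have h1 : IsClosed {x : E 3 | x i ∈ Icc (ε * G.ℓ₀) (G.ℓ i)} :=
    isClosed_Icc.preimage (continuous_coord i)
  have hl := mul_pos hε G.ℓ₀_pos
  have h2 : ContinuousOn (fun x : E 3 => ε * G.h i (x i)) {x : E 3 | x i ∈ Icc (ε * G.ℓ₀) (G.ℓ i)} :=
    continuousOn_const.mul ((G.continuousOn_h i).comp (continuous_coord i).continuousOn
      fun x hx => ⟨hl.le.trans hx.1, hx.2⟩)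
  have := h1.isClosed_le (continuous_xbar i).norm.continuousOn h2
  convert this using 1
  ext x
  simp [closedCylinder, and_assoc]

theorem isOpen_cylinder (hε : 0 < ε) (i : Fin 3) : IsOpen (G.cylinder ε i) := by
  have h1 : IsOpen {x : E 3 | x i ∈ Ioo (ε * G.ℓ₀) (G.ℓ i)} :=
    isOpen_Ioo.preimage (continuous_coord i)
  have hl := mul_pos hε G.ℓ₀_pos
  have h2 : ContinuousOn (fun x : E 3 => ε * G.h i (x i) - ‖xbar i x‖)
      {x : E 3 | x i ∈ Ioo (ε * G.ℓ₀) (G.ℓ i)} :=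
    (continuousOn_const.mul ((G.continuousOn_h i).comp (continuous_coord i).continuousOn
      fun x hx => ⟨hl.le.trans hx.1.le, hx.2.le⟩)).sub (continuous_xbar i).norm.continuousOn
  have := h2.isOpen_inter_preimage h1 (isOpen_Ioi (a := (0 : ℝ)))
  convert this using 1
  ext x
  simp [cylinder, and_assoc]

theorem closure_cylinder_subset (hε : 0 < ε) (i : Fin 3) :
    closure (G.cylinder ε i) ⊆ G.closedCylinder ε i :=
  closure_minimal (fun _ hx => ⟨hx.1.le, hx.2.1.le, hx.2.2.le⟩) (isClosed_closedCylinder hε i)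

/-- The curve `s ↦ (a + s, h(a + s) / h(a) · x̄)`, `a = xᵢ`, which stays on the lateral surface
if it starts there. -/
def slide (G : Geometry) (i : Fin 3) (x : E 3) (s : ℝ) : E 3 :=
  assemble i (x i + s) ((G.h i (x i + s) / G.h i (x i)) • xbar i x)

theorem tendsto_slide {i : Fin 3} {x : E 3} (hx : x i ∈ Ioo 0 (G.ℓ i)) :
    Tendsto (G.slide i x) (𝓝 0) (𝓝 x) := by
  have hh : ContinuousAt (G.h i) (x i) := (G.contDiffAt_h i hx).continuousAt
  have h1 : Tendsto (fun s : ℝ => x i + s) (𝓝 0) (𝓝 (x i)) := by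
    simpa using (tendsto_const_nhds (x := x i)).add (tendsto_id (x := 𝓝 (0 : ℝ)))
  have h0 : G.h i (x i) ≠ 0 := (G.h_pos i _ ⟨hx.1.le, hx.2.le⟩).ne'
  have h2 : Tendsto (fun s : ℝ => (G.h i (x i + s) / G.h i (x i)) • xbar i x) (𝓝 0)
      (𝓝 (xbar i x)) := by
    have := ((hh.tendsto.comp h1).div_const (G.h i (x i))).smul_const (xbar i x)
    rw [div_self h0, one_smul] at this
    exact this
  have := ((continuous_assemble i).tendsto (x i, xbar i x)).comp (h1.prodMk_nhds h2)
  rw [← eq_assemble] at this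
  exact this

theorem norm_xbar_slide {i : Fin 3} {x : E 3} {s : ℝ} (hx : x i ∈ Icc 0 (G.ℓ i))
    (hs : x i + s ∈ Icc 0 (G.ℓ i)) :
    ‖xbar i (G.slide i x s)‖ = G.h i (x i + s) * (‖xbar i x‖ / G.h i (x i)) := by
  rw [slide, xbar_assemble, norm_smul, Real.norm_of_nonneg
    (div_nonneg (G.h_pos i _ hs).le (G.h_pos i _ hx).le)]
  ring

/-- Scaling of the transversal variables. -/
def squeeze (i : Fin 3) (x : E 3) (a : ℝ) : E 3 := assemble i (x i) (a • xbar i x)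

theorem continuous_squeeze (i : Fin 3) (x : E 3) : Continuous (squeeze i x) :=
  (continuous_assemble i).comp (continuous_const.prodMk (continuous_id.smul continuous_const))

@[simp] theorem squeeze_one (i : Fin 3) (x : E 3) : squeeze i x 1 = x := by
  rw [squeeze, one_smul, ← eq_assemble]

/-- Away from the end `xᵢ = ℓᵢ` the closure of a cylinder is the closed cylinder: interior points are
reached by shrinking the transversal variables after moving off the base along the wall. -/
theorem mem_closure_cylinder (hε : 0 < ε) {i : Fin 3} {x : E 3}
    (hx : x ∈ G.closedCylinder ε i) (hxl : x i < G.ℓ i) : x ∈ closure (G.cylinder ε i) := by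
  have hl := mul_pos hε G.ℓ₀_pos
  obtain ⟨h1, h2, h3⟩ := hx
  have hI : x i ∈ Ioo 0 (G.ℓ i) := ⟨hl.trans_le h1, hxl⟩
  have hh := G.h_pos i _ ⟨hI.1.le, hI.2.le⟩
  -- points strictly above the base
  have hup : ∀ y : E 3, ε * G.ℓ₀ < y i → y i < G.ℓ i → ‖xbar i y‖ ≤ ε * G.h i (y i) →
      y ∈ closure (G.cylinder ε i) := by
    intro y hy1 hy2 hy3
    have hhy := G.h_pos i (y i) ⟨(hl.trans hy1).le, hy2.le⟩
    have hev : ∀ᶠ a in 𝓝[<] (1 : ℝ), squeeze i y a ∈ G.cylinder ε i := by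
      filter_upwards [Ioo_mem_nhdsLT (show (0 : ℝ) < 1 by norm_num)] with a ha
      refine ⟨by rwa [squeeze, assemble_self], by rwa [squeeze, assemble_self], ?_⟩
      rw [squeeze, assemble_self, xbar_assemble, norm_smul, Real.norm_of_nonneg ha.1.le]
      have : 0 < ε * G.h i (y i) := mul_pos hε hhy
      nlinarith [ha.1, ha.2, norm_nonneg (xbar i y)]
    have ht : Tendsto (squeeze i y) (𝓝[<] 1) (𝓝 y) := by
      have := ((continuous_squeeze i y).tendsto 1).mono_left (nhdsWithin_le_nhds (s := Iio 1))
      rwa [squeeze_one] at this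
    exact mem_closure_of_tendsto ht hev
  have hev : ∀ᶠ s in 𝓝[>] (0 : ℝ), G.slide i x s ∈ closure (G.cylinder ε i) := by
    filter_upwards [Ioo_mem_nhdsGT (show 0 < G.ℓ i - x i by linarith)] with s hs
    have hs1 : x i + s ∈ Icc 0 (G.ℓ i) := ⟨by linarith [hI.1, hs.1], by linarith [hs.2]⟩
    have hc : (G.slide i x s) i = x i + s := assemble_self _ _ _
    refine hup _ (by rw [hc]; linarith [hs.1]) (by rw [hc]; linarith [hs.2]) ?_
    rw [norm_xbar_slide ⟨hI.1.le, hI.2.le⟩ hs1, hc, mul_comm ε]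
    have := G.h_pos i _ hs1
    gcongr
    rwa [div_le_iff₀ hh]
  exact isClosed_closure.mem_of_tendsto ((tendsto_slide hI).mono_left nhdsWithin_le_nhds) hev

theorem node_eq_preimage (hε : 0 < ε) : G.node ε = {x | ε⁻¹ • x ∈ G.Ξ} :=
  (preimage_smul_inv₀ hε.ne' G.Ξ).symm

theorem mem_node (hε : 0 < ε) {x : E 3} : x ∈ G.node ε ↔ ε⁻¹ • x ∈ G.Ξ := by
  rw [node_eq_preimage hε]; rfl

theorem isOpen_node (hε : 0 < ε) : IsOpen (G.node ε) := G.isOpen_Ξ.smul₀ hε.ne'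

theorem closure_node (hε : 0 < ε) : closure (G.node ε) = {x | ε⁻¹ • x ∈ closure G.Ξ} := by
  rw [node_eq_preimage hε]
  exact ((Homeomorph.smulOfNeZero (α := E 3) ε⁻¹ (inv_ne_zero hε.ne')).preimage_closure G.Ξ).symm

theorem mem_frontier_node (hε : 0 < ε) {x : E 3} :
    x ∈ frontier (G.node ε) ↔ ε⁻¹ • x ∈ frontier G.Ξ := by
  rw [(isOpen_node hε).frontier_eq, G.isOpen_Ξ.frontier_eq, closure_node hε, Set.mem_sdiff, Set.mem_sdiff,
    mem_node hε]
  rfl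

theorem coord_inv_smul (x : E 3) (i : Fin 3) : (ε⁻¹ • x) i = ε⁻¹ * x i := by simp

/-- The collars of the node, scaled. -/
theorem mem_node_iff_of_collar (hε : 0 < ε) {δ : ℝ} {i : Fin 3}
    (hδ : ∀ ξ : E 3, G.ℓ₀ - δ < ξ i → (ξ ∈ G.Ξ ↔ ξ i < G.ℓ₀ ∧ ‖xbar i ξ‖ < G.h i 0)) {x : E 3}
    (hx : ε * (G.ℓ₀ - δ) < x i) :
    x ∈ G.node ε ↔ x i < ε * G.ℓ₀ ∧ ‖xbar i x‖ < ε * G.h i 0 := by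
  rw [mem_node hε, hδ _ (by rw [coord_inv_smul, lt_inv_mul_iff₀ hε]; exact hx), coord_inv_smul,
    xbar_smul, norm_smul, Real.norm_of_nonneg (inv_nonneg.2 hε.le), inv_mul_lt_iff₀ hε,
    inv_mul_lt_iff₀ hε]

theorem coord_lt_of_mem_node (hε : 0 < ε) {x : E 3} (hx : x ∈ G.node ε) (i : Fin 3) :
    x i < ε * G.ℓ₀ := by
  have := G.coord_lt_of_mem_Ξ ((mem_node hε).1 hx) i
  rwa [coord_inv_smul, inv_mul_lt_iff₀ hε] at this

theorem coord_le_of_mem_closure_node (hε : 0 < ε) {x : E 3} (hx : x ∈ closure (G.node ε))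
    (i : Fin 3) : x i ≤ ε * G.ℓ₀ :=
  closure_minimal (fun _ hy => (coord_lt_of_mem_node hε hy i).le)
    (isClosed_Iic.preimage (continuous_coord i)) hx

theorem isBounded_node : Bornology.IsBounded (G.node ε) := G.isBounded_Ξ.smul₀ ε

theorem mem_closure_node_of_collar (hε : 0 < ε) {δ : ℝ} {i : Fin 3}
    (hδ : ∀ ξ : E 3, G.ℓ₀ - δ < ξ i → (ξ ∈ G.Ξ ↔ ξ i < G.ℓ₀ ∧ ‖xbar i ξ‖ < G.h i 0)) {x : E 3}
    (hx : ε * (G.ℓ₀ - δ) < x i) (hx2 : x i ≤ ε * G.ℓ₀) (hx3 : ‖xbar i x‖ ≤ ε * G.h i 0) :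
    x ∈ closure (G.node ε) := by
  have hh := mul_pos hε (G.h0_pos i)
  have hdown : ∀ y : E 3, ε * (G.ℓ₀ - δ) < y i → y i < ε * G.ℓ₀ → ‖xbar i y‖ ≤ ε * G.h i 0 →
      y ∈ closure (G.node ε) := by
    intro y hy1 hy2 hy3
    have hev : ∀ᶠ a in 𝓝[<] (1 : ℝ), squeeze i y a ∈ G.node ε := by
      filter_upwards [Ioo_mem_nhdsLT (show (0 : ℝ) < 1 by norm_num)] with a ha
      rw [mem_node_iff_of_collar hε hδ (by rwa [squeeze, assemble_self])]
      refine ⟨by rwa [squeeze, assemble_self], ?_⟩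
      rw [squeeze, xbar_assemble, norm_smul, Real.norm_of_nonneg ha.1.le]
      nlinarith [ha.1, ha.2, norm_nonneg (xbar i y)]
    have ht : Tendsto (squeeze i y) (𝓝[<] 1) (𝓝 y) := by
      have := ((continuous_squeeze i y).tendsto 1).mono_left (nhdsWithin_le_nhds (s := Iio 1))
      rwa [squeeze_one] at this
    exact mem_closure_of_tendsto ht hev
  have hc : Continuous fun s : ℝ => assemble i (x i - s) (xbar i x) :=
    (continuous_assemble i).comp ((continuous_const.sub continuous_id).prodMk continuous_const)
  have ht : Tendsto (fun s : ℝ => assemble i (x i - s) (xbar i x)) (𝓝[>] 0) (𝓝 x) := by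
    have := (hc.tendsto 0).mono_left (nhdsWithin_le_nhds (s := Ioi 0))
    rwa [sub_zero, ← eq_assemble] at this
  refine isClosed_closure.mem_of_tendsto ht ?_
  filter_upwards [Ioo_mem_nhdsGT (sub_pos.2 hx)] with s hs
  exact hdown _ (by rw [assemble_self]; linarith [hs.2]) (by rw [assemble_self]; linarith [hs.1])
    (by rwa [xbar_assemble])

end Geometry

end ThinJunction
end

noncomputable section

namespace ThinJunction

/-! ### Defining functions of the boundary -/

theorem IsDefiningFunction.eventually_contDiffAt {k : ℕ} (hk : 1 ≤ k) {Ω : Set (E 3)} {x₀ : E 3}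
    {ρ : E 3 → ℝ} (h : IsDefiningFunction k Ω x₀ ρ) : ∀ᶠ x in 𝓝 x₀, ContDiffAt ℝ 1 ρ x :=
  (h.smooth.of_le (by exact_mod_cast hk)).eventually (by simp)

theorem fderiv_eq_inner_gradient {ρ : E 3 → ℝ} (x v : E 3) :
    fderiv ℝ ρ x v = inner ℝ (gradient ρ x) v := by
  rw [gradient, InnerProductSpace.toDual_symm_apply]

/-- Near `x₀`, the derivative of a defining function in the direction of its gradient at `x₀` is
bounded away from zero. -/
theorem IsDefiningFunction.eventually_fderiv_ge {k : ℕ} (hk : 1 ≤ k) {Ω : Set (E 3)} {x₀ : E 3}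
    {ρ : E 3 → ℝ} (h : IsDefiningFunction k Ω x₀ ρ) :
    ∀ᶠ x in 𝓝 x₀, ‖gradient ρ x₀‖ ^ 2 / 2 ≤ fderiv ℝ ρ x (gradient ρ x₀) := by
  have h1 : ContDiffAt ℝ 1 ρ x₀ := h.smooth.of_le (by exact_mod_cast hk)
  have hc : ContinuousAt (fun x => fderiv ℝ ρ x (gradient ρ x₀)) x₀ :=
    (h1.continuousAt_fderiv (by norm_num)).clm_apply continuousAt_const
  have h0 : fderiv ℝ ρ x₀ (gradient ρ x₀) = ‖gradient ρ x₀‖ ^ 2 := by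
    rw [fderiv_eq_inner_gradient, real_inner_self_eq_norm_sq]
  have hpos : 0 < ‖gradient ρ x₀‖ ^ 2 := pow_pos (norm_pos_iff.2 h.grad_ne) 2
  exact (hc.eventually_const_lt (by simp only [h0]; linarith)).mono fun x hx => hx.le

/-- Scaling of a defining function. -/
theorem IsDefiningFunction.comp_smul {k : ℕ} {Ω : Set (E 3)} {a : ℝ} (ha : a ≠ 0) {x : E 3}
    {ρ : E 3 → ℝ} (h : IsDefiningFunction k Ω (a • x) ρ) (hk : 1 ≤ k) :
    IsDefiningFunction k {y | a • y ∈ Ω} x (fun y => ρ (a • y)) ∧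
      gradient (fun y => ρ (a • y)) x = a • gradient ρ (a • x) := by
  have hd : HasFDerivAt ρ (fderiv ℝ ρ (a • x)) (a • x) :=
    (h.smooth.differentiableAt (by exact_mod_cast (by omega : k ≠ 0))).hasFDerivAt
  have hs : HasFDerivAt (fun y : E 3 => a • y) (a • ContinuousLinearMap.id ℝ (E 3)) x :=
    (hasFDerivAt_id x).const_smul a
  have hg : gradient (fun y => ρ (a • y)) x = a • gradient ρ (a • x) := by
    refine ext_inner_right ℝ fun v => ?_
    have hc : HasFDerivAt (fun y => ρ (a • y)) _ x := hd.comp x hs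
    rw [← fderiv_eq_inner_gradient, hc.fderiv, real_inner_smul_left,
      ← fderiv_eq_inner_gradient]
    simp
  refine ⟨⟨?_, h.zero, ?_, ?_⟩, hg⟩
  · exact ContDiffAt.comp x h.smooth (contDiff_const_smul a).contDiffAt
  · rw [hg]; exact smul_ne_zero ha h.grad_ne
  · have : Tendsto (fun y : E 3 => a • y) (𝓝 x) (𝓝 (a • x)) :=
      (continuous_const_smul a).tendsto x
    filter_upwards [this.eventually h.local_eq] with y hy using hy

/-- A point at which a function vanishes but its derivative does not is a limit of points where it
is positive. -/
theorem exists_pos_of_fderiv_pos {ρ : E 3 → ℝ} {x v : E 3} (hd : DifferentiableAt ℝ ρ x)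
    (h0 : ρ x = 0) (hv : 0 < fderiv ℝ ρ x v) {S : Set (E 3)} (hS : S ∈ 𝓝 x) :
    ∃ y ∈ S, 0 < ρ y := by
  have hl : HasDerivAt (fun s : ℝ => x + s • v) v 0 := by
    simpa using ((hasDerivAt_id (0 : ℝ)).smul_const v).const_add x
  have hd' : HasFDerivAt ρ (fderiv ℝ ρ x) (x + (0 : ℝ) • v) := by simpa using hd.hasFDerivAt
  have h1 : HasDerivAt (ρ ∘ fun s : ℝ => x + s • v) (fderiv ℝ ρ x v) 0 :=
    hd'.comp_hasDerivAt 0 hl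
  have h2 := h1.hasDerivWithinAt (s := Ioi 0)
  have h3 := (hasDerivWithinAt_iff_tendsto_slope' (by simp)).1 h2
  have h4 : ∀ᶠ s in 𝓝[>] (0 : ℝ), 0 < slope (ρ ∘ fun s : ℝ => x + s • v) 0 s :=
    h3.eventually_const_lt hv
  have h5 : ∀ᶠ s in 𝓝[>] (0 : ℝ), x + s • v ∈ S := by
    refine (hl.continuousAt.tendsto.mono_left nhdsWithin_le_nhds).eventually ?_
    simpa using hS
  obtain ⟨s, hs1, hs2, hs3⟩ := (h4.and (h5.and self_mem_nhdsWithin)).exists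
  refine ⟨_, hs2, ?_⟩
  rw [slope_def_field] at hs1
  simp only [Function.comp, zero_smul, add_zero, h0, sub_zero] at hs1
  exact (div_pos_iff_of_pos_right hs3).1 hs1

namespace Geometry

variable (G : Geometry)

/-- The union of the closed pieces; the junction is its interior. -/
def pieces (ε : ℝ) : Set (E 3) := closure (G.node ε) ∪ ⋃ i, closure (G.cylinder ε i)

variable {G} {ε : ℝ}

theorem node_subset_junction (hε : 0 < ε) : G.node ε ⊆ G.junction ε :=
  interior_maximal (subset_union_of_subset_left subset_closure _) (isOpen_node hε)

theorem cylinder_subset_junction (hε : 0 < ε) (i : Fin 3) : G.cylinder ε i ⊆ G.junction ε :=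
  interior_maximal (subset_union_of_subset_right
    (subset_closure.trans (subset_iUnion (fun i => closure (G.cylinder ε i)) i)) _)
    (isOpen_cylinder hε i)

theorem isClosed_pieces : IsClosed (G.pieces ε) :=
  isClosed_closure.union (isClosed_iUnion_of_finite fun _ => isClosed_closure)

theorem closure_junction (hε : 0 < ε) : closure (G.junction ε) = G.pieces ε := by
  refine subset_antisymm (closure_minimal interior_subset isClosed_pieces) ?_
  exact union_subset (closure_mono (node_subset_junction hε))
    (iUnion_subset fun i => closure_mono (cylinder_subset_junction hε i))

/-- If, near `x₀`, the junction consists of a single piece `P`, then a defining function of `P` is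
one of the junction: passing to the interior of the closure adds no points there, because `ρ ≤ 0` on
the closure and every zero of `ρ` is a limit of points with `ρ > 0`. -/
theorem isDefiningFunction_junction {k : ℕ} (hk : 1 ≤ k) {P : Set (E 3)} {x₀ : E 3} {ρ : E 3 → ℝ}
    (h : IsDefiningFunction k P x₀ ρ) (hP : P ⊆ G.junction ε)
    (hloc : ∀ᶠ x in 𝓝 x₀, x ∈ G.pieces ε → x ∈ closure P) :
    IsDefiningFunction 1 (G.junction ε) x₀ ρ := by
  refine ⟨h.smooth.of_le (by exact_mod_cast hk), h.zero, h.grad_ne, ?_⟩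
  have hle : ∀ᶠ x in 𝓝 x₀, x ∈ G.pieces ε → ρ x ≤ 0 := by
    filter_upwards [hloc, h.local_eq.eventually_nhds, h.eventually_contDiffAt hk] with x h1 h2 h3 hx
    have hfr : ∃ᶠ y in 𝓝 x, y ∈ P := mem_closure_iff_frequently.1 (h1 hx)
    refine le_of_not_gt fun hpos => ?_
    obtain ⟨y, hy1, hy2, hy3⟩ :=
      (hfr.and_eventually (h2.and (h3.continuousAt.eventually_const_lt hpos))).exists
    exact absurd (hy2.1 hy1) (by linarith)
  have hpos : 0 < ‖gradient ρ x₀‖ ^ 2 := pow_pos (norm_pos_iff.2 h.grad_ne) 2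
  filter_upwards [hle.eventually_nhds, h.local_eq, h.eventually_contDiffAt hk,
    h.eventually_fderiv_ge hk] with x h1 h2 h3 h4
  refine ⟨fun hx => ?_, fun hx => hP (h2.2 hx)⟩
  refine lt_of_le_of_ne (h1.self_of_nhds (interior_subset hx)) fun h0 => ?_
  obtain ⟨y, hy1, hy2⟩ := exists_pos_of_fderiv_pos (h3.differentiableAt (by norm_num)) h0
    (lt_of_lt_of_le (by positivity) h4) (inter_mem h1 (mem_interior_iff_mem_nhds.1 hx))
  exact absurd (hy1.1 hy1.2) (by linarith)

/-- The defining function of the `i`-th cylinder. -/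
def wallFn (G : Geometry) (ε : ℝ) (i : Fin 3) (x : E 3) : ℝ :=
  ‖xbar i x‖ ^ 2 - (ε * G.h i (x i)) ^ 2

theorem hasFDerivAt_wallFn (i : Fin 3) {x : E 3} (hx : x i ∈ Ioo 0 (G.ℓ i)) :
    HasFDerivAt (G.wallFn ε i) ((2 : ℝ) • (innerSL ℝ (xbar i x)).comp (xbarL i) -
      (2 * ε ^ 2 * G.h i (x i) * deriv (G.h i) (x i)) • (EuclideanSpace.proj i : E 3 →L[ℝ] ℝ)) x := by
  have h1 : HasFDerivAt (fun x => ‖xbar i x‖ ^ 2) _ x := ((xbarL i).hasFDerivAt (x := x)).norm_sq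
  have h2 : HasDerivAt (G.h i) (deriv (G.h i) (x i)) (x i) :=
    ((G.contDiffAt_h i hx).differentiableAt (by norm_num)).hasDerivAt
  have h3 : HasFDerivAt (fun x : E 3 => G.h i (x i)) _ x :=
    h2.comp_hasFDerivAt x (EuclideanSpace.proj i : E 3 →L[ℝ] ℝ).hasFDerivAt
  have h4 := h1.sub ((h3.const_mul ε).pow 2)
  refine h4.congr_fderiv ?_
  ext v
  simp
  ring

theorem fderiv_wallFn (i : Fin 3) {x : E 3} (hx : x i ∈ Ioo 0 (G.ℓ i)) (v : E 3) :
    fderiv ℝ (G.wallFn ε i) x v = 2 * inner ℝ (xbar i x) (xbar i v) -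
      2 * ε ^ 2 * G.h i (x i) * deriv (G.h i) (x i) * v i := by
  rw [(hasFDerivAt_wallFn i hx).fderiv]; simp

theorem contDiffAt_wallFn (i : Fin 3) {x : E 3} (hx : x i ∈ Ioo 0 (G.ℓ i)) :
    ContDiffAt ℝ 1 (G.wallFn ε i) x := by
  have h1 : ContDiffAt ℝ 1 (fun x : E 3 => xbar i x) x := (xbarL i).contDiff.contDiffAt
  have h2 : ContDiffAt ℝ 1 (fun x : E 3 => G.h i (x i)) x :=
    (G.contDiffAt_h i hx).comp x (EuclideanSpace.proj i : E 3 →L[ℝ] ℝ).contDiff.contDiffAt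
  exact (h1.norm_sq ℝ).sub ((contDiffAt_const.mul h2).pow 2)

theorem wallFn_neg_iff (hε : 0 < ε) (i : Fin 3) {x : E 3} (hx : x i ∈ Icc 0 (G.ℓ i)) :
    G.wallFn ε i x < 0 ↔ ‖xbar i x‖ < ε * G.h i (x i) := by
  rw [wallFn, sub_neg, sq_lt_sq₀ (norm_nonneg _) (mul_pos hε (G.h_pos i _ hx)).le]

theorem wallFn_eq_zero_iff (hε : 0 < ε) (i : Fin 3) {x : E 3} (hx : x i ∈ Icc 0 (G.ℓ i)) :
    G.wallFn ε i x = 0 ↔ ‖xbar i x‖ = ε * G.h i (x i) := by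
  rw [wallFn, sub_eq_zero, sq_eq_sq₀ (norm_nonneg _) (mul_pos hε (G.h_pos i _ hx)).le]

/-- The radial direction at a point. -/
def radial (i : Fin 3) (x : E 3) : E 3 := assemble i 0 (xbar i x)

theorem fderiv_wallFn_radial (i : Fin 3) {x y : E 3} (hx : x i ∈ Ioo 0 (G.ℓ i)) :
    fderiv ℝ (G.wallFn ε i) x (radial i y) = 2 * inner ℝ (xbar i x) (xbar i y) := by
  rw [fderiv_wallFn i hx]; simp [radial]

theorem gradient_wallFn_ne_zero (hε : 0 < ε) (i : Fin 3) {x : E 3} (hx : x i ∈ Ioo 0 (G.ℓ i))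
    (h0 : G.wallFn ε i x = 0) : gradient (G.wallFn ε i) x ≠ 0 := by
  intro hg
  have h1 := fderiv_wallFn_radial (ε := ε) i (y := x) hx
  rw [fderiv_eq_inner_gradient, hg, inner_zero_left, real_inner_self_eq_norm_sq,
    (wallFn_eq_zero_iff hε i ⟨hx.1.le, hx.2.le⟩).1 h0] at h1
  have := mul_pos hε (G.h_pos i _ ⟨hx.1.le, hx.2.le⟩)
  nlinarith

theorem mem_cylinder_iff (hε : 0 < ε) {i : Fin 3} {x : E 3} (h1 : ε * G.ℓ₀ < x i)
    (h2 : x i < G.ℓ i) : x ∈ G.cylinder ε i ↔ G.wallFn ε i x < 0 := by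
  rw [wallFn_neg_iff hε i ⟨((mul_pos hε G.ℓ₀_pos).trans h1).le, h2.le⟩]
  simp [cylinder, h1, h2]

theorem isDefiningFunction_cylinder (hε : 0 < ε) {i : Fin 3} {x : E 3} (h1 : ε * G.ℓ₀ < x i)
    (h2 : x i < G.ℓ i) (h0 : G.wallFn ε i x = 0) :
    IsDefiningFunction 1 (G.cylinder ε i) x (G.wallFn ε i) := by
  have hI : x i ∈ Ioo 0 (G.ℓ i) := ⟨(mul_pos hε G.ℓ₀_pos).trans h1, h2⟩
  refine ⟨contDiffAt_wallFn i hI, h0, gradient_wallFn_ne_zero hε i hI h0, ?_⟩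
  filter_upwards [(continuous_coord i).continuousAt.eventually_const_lt h1,
    (continuous_coord i).continuousAt.eventually_lt_const h2] with y hy1 hy2
  exact mem_cylinder_iff hε hy1 hy2

/-- A defining function of the rescaled node gives one of the node. -/
theorem isDefiningFunction_node (hε : 0 < ε) {k : ℕ} {x : E 3} {ρ : E 3 → ℝ} (hk : 1 ≤ k)
    (h : IsDefiningFunction k G.Ξ (ε⁻¹ • x) ρ) :
    IsDefiningFunction k (G.node ε) x (fun y => ρ (ε⁻¹ • y)) := by
  have := (h.comp_smul (inv_ne_zero hε.ne') hk).1
  rwa [← node_eq_preimage hε] at this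

/-- The closed disk in which the node meets the `i`-th cylinder. -/
def disk (G : Geometry) (ε : ℝ) (i : Fin 3) : Set (E 3) :=
  {x | x i = ε * G.ℓ₀ ∧ ‖xbar i x‖ ≤ ε * G.h i 0}

theorem closure_crossSection_subset (i : Fin 3) (s : ℝ) :
    closure (G.crossSection ε i s) ⊆ {x | x i = s ∧ ‖xbar i x‖ ≤ ε * G.h i s} := by
  refine closure_minimal (fun x hx => ⟨hx.1, hx.2.le⟩) ?_
  exact (isClosed_singleton.preimage (continuous_coord i)).inter
    (isClosed_Iic.preimage (continuous_xbar i).norm)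

theorem inv_smul_mem_nodeDisk (hε : 0 < ε) {i : Fin 3} {x : E 3} :
    ε⁻¹ • x ∈ nodeDisk G.ℓ₀ (G.h i 0) i ↔ x ∈ G.disk ε i := by
  simp only [nodeDisk, disk, mem_ofPred_eq, coord_inv_smul, xbar_smul, norm_smul,
    Real.norm_of_nonneg (inv_nonneg.2 hε.le), inv_mul_eq_iff_eq_mul₀ hε.ne', inv_mul_le_iff₀ hε]

end Geometry

end ThinJunction
end

noncomputable section

namespace ThinJunction

variable {G : Geometry} {c : Coefficients G} {ε : ℝ}

/-! ### Size of the junction and admissible parameters -/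

namespace Geometry

theorem exists_h_le (G : Geometry) : ∃ H > 0, ∀ i, ∀ s ∈ Icc 0 (G.ℓ i), G.h i s ≤ H := by
  have h : ∀ i, ∃ H, ∀ s ∈ Icc 0 (G.ℓ i), G.h i s ≤ H := fun i => by
    obtain ⟨H, hH⟩ := isCompact_Icc.exists_bound_of_continuousOn (G.continuousOn_h i)
    exact ⟨H, fun s hs => (le_abs_self _).trans (hH s hs)⟩
  choose H hH using h
  refine ⟨∑ i, |H i| + 1, by positivity, fun i s hs => (hH i s hs).trans ?_⟩
  have := Finset.single_le_sum (f := fun i => |H i|) (fun i _ => abs_nonneg _) (Finset.mem_univ i)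
  linarith [le_abs_self (H i)]

theorem volume_cylinder_le {H : ℝ} (hH0 : 0 < H)
    (hH : ∀ i, ∀ s ∈ Icc 0 (G.ℓ i), G.h i s ≤ H) (hε : 0 < ε) (i : Fin 3) :
    volume (G.cylinder ε i) ≤ ENNReal.ofReal (G.ℓ i * (2 * ε * H) ^ 2) := by
  set a : Fin 3 → ℝ := Fin.insertNth (α := fun _ => ℝ) i 0 (fun _ => -(ε * H)) with ha
  set b : Fin 3 → ℝ := Fin.insertNth (α := fun _ => ℝ) i (G.ℓ i) (fun _ => ε * H) with hb
  have hsub : G.cylinder ε i ⊆ (WithLp.ofLp : E 3 → Fin 3 → ℝ) ⁻¹' (Icc a b) := by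
    intro x hx
    have hl := mul_pos hε G.ℓ₀_pos
    have hI : x i ∈ Icc 0 (G.ℓ i) := ⟨(hl.trans hx.1).le, hx.2.1.le⟩
    have hb' : ‖xbar i x‖ ≤ ε * H :=
      hx.2.2.le.trans (mul_le_mul_of_nonneg_left (hH i _ hI) hε.le)
    have hk : ∀ k, |x (i.succAbove k)| ≤ ε * H := fun k =>
      (abs_coord_le_xbar (Fin.succAbove_ne i k) x).trans hb'
    constructor <;> intro j <;> rcases Fin.eq_self_or_eq_succAbove i j with rfl | ⟨k, rfl⟩
    · simpa [ha] using hI.1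
    · simpa [ha] using (abs_le.1 (hk k)).1
    · simpa [hb] using hI.2
    · simpa [hb] using (abs_le.1 (hk k)).2
  refine (measure_mono hsub).trans ?_
  rw [(PiLp.volume_preserving_ofLp (Fin 3)).measure_preimage measurableSet_Icc.nullMeasurableSet,
    Real.volume_Icc_pi, Fin.prod_univ_succAbove _ i]
  simp only [ha, hb, Fin.insertNth_apply_same, Fin.insertNth_apply_succAbove, Finset.prod_const,
    Finset.card_univ, Fintype.card_fin]
  rw [← ENNReal.ofReal_pow (by nlinarith), ← ENNReal.ofReal_mul (by linarith [G.ℓ_pos i])]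
  apply le_of_eq
  congr 1
  ring

theorem isBounded_cylinder (hε : 0 < ε) (i : Fin 3) : Bornology.IsBounded (G.cylinder ε i) := by
  obtain ⟨H, hH0, hH⟩ := G.exists_h_le
  refine (Metric.isBounded_iff_subset_closedBall (0 : E 3)).2 ⟨G.ℓ i + ε * H, fun x hx => ?_⟩
  have hl := mul_pos hε G.ℓ₀_pos
  have hI : x i ∈ Icc 0 (G.ℓ i) := ⟨(hl.trans hx.1).le, hx.2.1.le⟩
  rw [mem_closedBall_zero_iff, eq_assemble i x]
  refine (norm_assemble_le i _ _).trans (add_le_add (by rw [abs_of_nonneg hI.1]; exact hI.2) ?_)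
  exact hx.2.2.le.trans (mul_le_mul_of_nonneg_left (hH i _ hI) hε.le)

theorem isCompact_pieces (hε : 0 < ε) : IsCompact (G.pieces ε) := by
  have h1 : IsCompact (closure (G.node ε)) := isBounded_node.isCompact_closure
  have h2 : ∀ i, IsCompact (closure (G.cylinder ε i)) := fun i =>
    (isBounded_cylinder hε i).isCompact_closure
  exact h1.union (isCompact_iUnion h2)

/-- The volume of the pieces of the junction is at most of the order of `ε`. -/
theorem exists_volume_le (G : Geometry) : ∃ C > 0, ∀ ε, 0 < ε → ε < 1 →
    volume (G.node ε ∪ ⋃ i, G.cylinder ε i) ≤ ENNReal.ofReal (C * ε) := by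
  obtain ⟨H, hH0, hH⟩ := G.exists_h_le
  have hΞ : volume G.Ξ < ⊤ := G.isBounded_Ξ.measure_lt_top
  refine ⟨(volume G.Ξ).toReal + ∑ i, G.ℓ i * (2 * H) ^ 2 + 1, ?_, fun ε hε hε1 => ?_⟩
  · have : 0 ≤ ∑ i, G.ℓ i * (2 * H) ^ 2 := Finset.sum_nonneg fun i _ =>
      mul_nonneg (G.ℓ_pos i).le (sq_nonneg _)
    positivity
  have h1 : volume (G.node ε) ≤ ENNReal.ofReal ((volume G.Ξ).toReal * ε) := by
    rw [node, Measure.addHaar_smul, ← ENNReal.ofReal_toReal hΞ.ne,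
      ← ENNReal.ofReal_mul (abs_nonneg _)]
    refine ENNReal.ofReal_le_ofReal ?_
    rw [ENNReal.toReal_ofReal ENNReal.toReal_nonneg]
    simp only [finrank_euclideanSpace, Fintype.card_fin]
    rw [mul_comm, abs_of_pos (by positivity)]
    refine mul_le_mul_of_nonneg_left ?_ ENNReal.toReal_nonneg
    exact pow_le_of_le_one hε.le hε1.le (by norm_num)
  have h2 : ∀ i, volume (G.cylinder ε i) ≤ ENNReal.ofReal (G.ℓ i * (2 * H) ^ 2 * ε) := fun i => by
    refine (volume_cylinder_le hH0 hH hε i).trans (ENNReal.ofReal_le_ofReal ?_)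
    have : ε ^ 2 ≤ ε := pow_le_of_le_one hε.le hε1.le (by norm_num)
    have h0 : 0 ≤ G.ℓ i * (2 * H) ^ 2 := mul_nonneg (G.ℓ_pos i).le (sq_nonneg _)
    nlinarith
  have h3 : ∀ i, 0 ≤ G.ℓ i * (2 * H) ^ 2 * ε := fun i =>
    mul_nonneg (mul_nonneg (G.ℓ_pos i).le (sq_nonneg _)) hε.le
  calc volume (G.node ε ∪ ⋃ i, G.cylinder ε i)
      ≤ volume (G.node ε) + volume (⋃ i, G.cylinder ε i) := measure_union_le _ _
    _ ≤ volume (G.node ε) + ∑ i, volume (G.cylinder ε i) := by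
        gcongr; exact measure_iUnion_fintype_le _ _
    _ ≤ ENNReal.ofReal ((volume G.Ξ).toReal * ε) + ∑ i, ENNReal.ofReal (G.ℓ i * (2 * H) ^ 2 * ε) :=
        add_le_add h1 (Finset.sum_le_sum fun i _ => h2 i)
    _ = ENNReal.ofReal ((volume G.Ξ).toReal * ε + ∑ i, G.ℓ i * (2 * H) ^ 2 * ε) := by
        rw [ENNReal.ofReal_add (by positivity) (Finset.sum_nonneg fun i _ => h3 i),
          ENNReal.ofReal_sum_of_nonneg fun i _ => h3 i]
    _ ≤ _ := by
        refine ENNReal.ofReal_le_ofReal ?_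
        rw [← Finset.sum_mul]; nlinarith

end Geometry

namespace Coefficients

/-- All small `ε` are admissible: two cylinders can only meet near the node, where the transversal
distance from the axis is at most `ε hᵢ(0) < ε ℓ₀`. -/
theorem eventually_admissible (c : Coefficients G) : ∀ᶠ ε in 𝓝[>] (0 : ℝ), c.Admissible ε := by
  obtain ⟨H, hH0, hH⟩ := G.exists_h_le
  choose d₁ hd₁ h₁ using G.h_const_left
  choose d₂ hd₂ h₂ using c.w_const
  choose d₃ hd₃ h₃ using c.vbar_support
  have hl := G.ℓ₀_pos
  have hsmall : ∀ a > 0, ∀ b > 0, ∀ᶠ ε in 𝓝[>] (0 : ℝ), ε * b < a := fun a ha b hb => by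
    filter_upwards [Ioo_mem_nhdsGT (div_pos ha hb)] with ε hε
    exact (lt_div_iff₀ hb).1 hε.2
  have e₁ : ∀ᶠ ε in 𝓝[>] (0 : ℝ), ∀ i, ε * G.ℓ₀ < d₁ i :=
    eventually_all.2 fun i => hsmall _ (hd₁ i) _ hl
  have e₂ : ∀ᶠ ε in 𝓝[>] (0 : ℝ), ∀ i, ε * G.ℓ₀ < d₂ i :=
    eventually_all.2 fun i => hsmall _ (hd₂ i) _ hl
  have e₃ : ∀ᶠ ε in 𝓝[>] (0 : ℝ), ∀ i, ε * G.ℓ₀ < d₃ i :=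
    eventually_all.2 fun i => hsmall _ (hd₃ i) _ hl
  have e₄ : ∀ᶠ ε in 𝓝[>] (0 : ℝ), ∀ i, ε * H < d₁ i :=
    eventually_all.2 fun i => hsmall _ (hd₁ i) _ hH0
  filter_upwards [e₁, e₂, e₃, e₄, Ioo_mem_nhdsGT (show (0 : ℝ) < 1 by norm_num)]
    with ε e₁ e₂ e₃ e₄ hε
  have hεl : ∀ i, ε * G.ℓ₀ ≤ G.ℓ i := fun i => by
    have := G.one_le_ℓ i
    have := G.ℓ₀_lt
    nlinarith [hε.1, hε.2]
  refine ⟨hε.1, hε.2, fun i s hs => h₁ i s ⟨hs.1, hs.2.trans (hεl i)⟩ (hs.2.trans (e₁ i).le),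
    fun i s hs => h₂ i s ⟨hs.1, hs.2.trans (hεl i)⟩ (hs.2.trans (e₂ i).le),
    fun i s hs => h₃ i s ⟨hs.1, hs.2.trans (hεl i)⟩ (Or.inl (hs.2.trans (e₃ i).le)),
    fun i j hij => ?_⟩
  refine Set.disjoint_left.2 ?_
  intro x hxi hxj
  obtain ⟨hi1, hi2, hi3⟩ := Geometry.closure_cylinder_subset hε.1 i hxi
  obtain ⟨hj1, hj2, hj3⟩ := Geometry.closure_cylinder_subset hε.1 j hxj
  have hp : 0 < ε * G.ℓ₀ := mul_pos hε.1 hl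
  have hIi : x i ∈ Icc 0 (G.ℓ i) := ⟨hp.le.trans hi1, hi2⟩
  have hIj : x j ∈ Icc 0 (G.ℓ j) := ⟨hp.le.trans hj1, hj2⟩
  have h4 : x i ≤ d₁ i := by
    have := (le_abs_self _).trans (abs_coord_le_xbar hij x)
    have := mul_le_mul_of_nonneg_left (hH j _ hIj) hε.1.le
    linarith [e₄ i]
  rw [h₁ i _ hIi h4] at hi3
  have h5 := (le_abs_self _).trans (abs_coord_le_xbar hij.symm x)
  have := mul_lt_mul_of_pos_left (G.h0_lt i) hε.1
  linarith

namespace Admissible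

theorem h_base (ha : c.Admissible ε) (i : Fin 3) : G.h i (ε * G.ℓ₀) = G.h i 0 :=
  ha.h_const i _ ⟨(mul_pos ha.pos G.ℓ₀_pos).le, le_rfl⟩

theorem base_pos (ha : c.Admissible ε) : 0 < ε * G.ℓ₀ := mul_pos ha.pos G.ℓ₀_pos

theorem base_lt (ha : c.Admissible ε) (i : Fin 3) : ε * G.ℓ₀ < G.ℓ i := by
  have := G.one_le_ℓ i
  have := G.ℓ₀_lt
  nlinarith [ha.pos, ha.lt_one, G.ℓ₀_pos]

theorem mem_closure_cylinder_iff (ha : c.Admissible ε) {i : Fin 3} {x : E 3} (hx : x i < G.ℓ i) :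
    x ∈ closure (G.cylinder ε i) ↔ x ∈ G.closedCylinder ε i :=
  ⟨fun h => Geometry.closure_cylinder_subset ha.pos i h,
    fun h => Geometry.mem_closure_cylinder ha.pos h hx⟩

theorem mem_lateral (ha : c.Admissible ε) {i : Fin 3} {x : E 3} (h1 : ε * G.ℓ₀ < x i)
    (h2 : x i < G.ℓ i) (h0 : G.wallFn ε i x = 0) : x ∈ G.lateral ε i := by
  have hI : x i ∈ Icc 0 (G.ℓ i) := ⟨(ha.base_pos.trans h1).le, h2.le⟩
  refine ⟨?_, h1, h2⟩
  rw [(Geometry.isOpen_cylinder ha.pos i).frontier_eq]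
  refine ⟨(ha.mem_closure_cylinder_iff h2).2 ⟨h1.le, h2.le, ?_⟩, ?_⟩
  · exact ((Geometry.wallFn_eq_zero_iff ha.pos i hI).1 h0).le
  · rw [Geometry.mem_cylinder_iff ha.pos h1 h2, h0]; exact lt_irrefl 0

/-- Near the lateral surface of a cylinder, the junction coincides with this cylinder. -/
theorem isDefiningFunction_lateral (ha : c.Admissible ε) {i : Fin 3} {x : E 3}
    (h1 : ε * G.ℓ₀ < x i) (h2 : x i < G.ℓ i) (h0 : G.wallFn ε i x = 0) :
    IsDefiningFunction 1 (G.junction ε) x (G.wallFn ε i) := by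
  refine Geometry.isDefiningFunction_junction le_rfl
    (Geometry.isDefiningFunction_cylinder ha.pos h1 h2 h0)
    (Geometry.cylinder_subset_junction ha.pos i) ?_
  have hxc : x ∈ closure (G.cylinder ε i) := frontier_subset_closure (ha.mem_lateral h1 h2 h0).1
  have hn : ∀ᶠ y in 𝓝 x, y ∉ closure (G.node ε) := by
    filter_upwards [(continuous_coord i).continuousAt.eventually_const_lt h1] with y hy hy'
    linarith [Geometry.coord_le_of_mem_closure_node ha.pos hy' i]
  have hj : ∀ j, ∀ᶠ y in 𝓝 x, j ≠ i → y ∉ closure (G.cylinder ε j) := fun j => by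
    by_cases hji : j = i
    · simp [hji]
    · have : x ∉ closure (G.cylinder ε j) := Set.disjoint_left.1 (ha.disjoint (Ne.symm hji)) hxc
      filter_upwards [isClosed_closure.isOpen_compl.mem_nhds this] with y hy _ using hy
  filter_upwards [hn, eventually_all.2 hj] with y hy1 hy2 hy
  rcases hy with hy | hy
  · exact absurd hy hy1
  · obtain ⟨j, hj⟩ := mem_iUnion.1 hy
    by_cases hji : j = i
    · exact hji ▸ hj
    · exact absurd hj (hy2 j hji)

theorem mem_nodeSurface (ha : c.Admissible ε) {x : E 3} (hx : x ∈ frontier (G.node ε))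
    (hd : ∀ i, x ∉ G.disk ε i) : x ∈ G.nodeSurface ε := by
  refine ⟨hx, fun h => ?_⟩
  obtain ⟨i, hi⟩ := mem_iUnion.1 h
  have := Geometry.closure_crossSection_subset (G := G) i _ hi
  rw [mem_ofPred_eq, ha.h_base] at this
  exact hd i this

/-- A point that belongs to the closures of the node and of a cylinder lies in their common disk. -/
theorem mem_disk (ha : c.Admissible ε) {i : Fin 3} {x : E 3} (h1 : x ∈ closure (G.node ε))
    (h2 : x ∈ closure (G.cylinder ε i)) : x ∈ G.disk ε i := by
  obtain ⟨h3, -, h4⟩ := Geometry.closure_cylinder_subset ha.pos i h2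
  have h5 : x i = ε * G.ℓ₀ := le_antisymm (Geometry.coord_le_of_mem_closure_node ha.pos h1 i) h3
  rw [h5, ha.h_base] at h4
  exact ⟨h5, h4⟩

/-- Near the surface of the node, the junction coincides with the node. -/
theorem isDefiningFunction_nodeSurface (ha : c.Admissible ε) {k : ℕ} (hk : 1 ≤ k) {x : E 3}
    {ρ : E 3 → ℝ} (hx : x ∈ frontier (G.node ε)) (hd : ∀ i, x ∉ G.disk ε i)
    (h : IsDefiningFunction k (G.node ε) x ρ) : IsDefiningFunction 1 (G.junction ε) x ρ := by
  refine Geometry.isDefiningFunction_junction hk h (Geometry.node_subset_junction ha.pos) ?_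
  have hj : ∀ j, ∀ᶠ y in 𝓝 x, y ∉ closure (G.cylinder ε j) := fun j =>
    isClosed_closure.isOpen_compl.mem_nhds
      fun hxj => hd j (ha.mem_disk (frontier_subset_closure hx) hxj)
  filter_upwards [eventually_all.2 hj] with y hy1 hy
  rcases hy with hy | hy
  · exact hy
  · obtain ⟨j, hj⟩ := mem_iUnion.1 hy
    exact absurd hj (hy1 j)

/-- Up to the planes of the common disks, the junction is the union of its open pieces. -/
theorem junction_subset (ha : c.Admissible ε) {x : E 3} (hx : x ∈ G.junction ε) :
    x ∈ G.node ε ∪ ⋃ i, G.cylinder ε i ∨ ∃ i, x i = ε * G.ℓ₀ := by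
  by_contra! hcon
  obtain ⟨hU, hp⟩ := hcon
  have hxn : x ∉ G.node ε := fun h => hU (Or.inl h)
  have hxc : ∀ i, x ∉ G.cylinder ε i := fun i h => hU (Or.inr (mem_iUnion.2 ⟨i, h⟩))
  rcases interior_subset hx with h | h
  · have hf : x ∈ frontier (G.node ε) := by
      rw [(Geometry.isOpen_node ha.pos).frontier_eq]; exact ⟨h, hxn⟩
    have hd : ∀ i, x ∉ G.disk ε i := fun i hi => hp i hi.1
    obtain ⟨ρ, hρ⟩ := G.smooth_boundary (ε⁻¹ • x) ⟨(Geometry.mem_frontier_node ha.pos).1 hf, by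
      rw [mem_iUnion]; rintro ⟨i, hi⟩
      exact hd i ((Geometry.inv_smul_mem_nodeDisk ha.pos).1 hi)⟩
    have hρ' := Geometry.isDefiningFunction_node ha.pos (by norm_num) hρ
    have hJ := ha.isDefiningFunction_nodeSurface (by norm_num) hf hd hρ'
    have := hJ.local_eq.self_of_nhds.1 hx
    rw [hJ.zero] at this
    exact lt_irrefl _ this
  · obtain ⟨i, hi⟩ := mem_iUnion.1 h
    obtain ⟨h1, h2, h3⟩ := Geometry.closure_cylinder_subset ha.pos i hi
    have h1' : ε * G.ℓ₀ < x i := lt_of_le_of_ne h1 (Ne.symm (hp i))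
    rcases h2.eq_or_lt with h4 | h4
    · -- beyond the end of the cylinder there are no points of the pieces
      have hloc : ∀ᶠ y in 𝓝 x, y ∈ G.pieces ε → y i ≤ G.ℓ i := by
        have hj : ∀ j, ∀ᶠ y in 𝓝 x, j ≠ i → y ∉ closure (G.cylinder ε j) := fun j => by
          by_cases hji : j = i
          · simp [hji]
          · have : x ∉ closure (G.cylinder ε j) :=
              Set.disjoint_left.1 (ha.disjoint (Ne.symm hji)) hi
            filter_upwards [isClosed_closure.isOpen_compl.mem_nhds this] with y hy _ using hy
        filter_upwards [eventually_all.2 hj] with y hy1 hy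
        rcases hy with hy | hy
        · exact (Geometry.coord_le_of_mem_closure_node ha.pos hy i).trans (ha.base_lt i).le
        · obtain ⟨j, hyj⟩ := mem_iUnion.1 hy
          by_cases hji : j = i
          · exact (Geometry.closure_cylinder_subset ha.pos i (hji ▸ hyj)).2.1
          · exact absurd hyj (hy1 j hji)
      have hc : Continuous fun s : ℝ => assemble i (x i + s) (xbar i x) :=
        (continuous_assemble i).comp ((continuous_const.add continuous_id).prodMk continuous_const)
      have ht : Tendsto (fun s : ℝ => assemble i (x i + s) (xbar i x)) (𝓝[>] 0) (𝓝 x) := by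
        have := (hc.tendsto 0).mono_left (nhdsWithin_le_nhds (s := Ioi 0))
        rwa [add_zero, ← eq_assemble] at this
      obtain ⟨s, ⟨hs1, hs2⟩, hs3⟩ := (((ht.eventually hloc).and (ht.eventually
        (mem_interior_iff_mem_nhds.1 hx))).and self_mem_nhdsWithin).exists
      have := hs1 hs2
      rw [assemble_self] at this
      have hs3 : 0 < s := hs3
      linarith
    · have hI : x i ∈ Icc 0 (G.ℓ i) := ⟨(ha.base_pos.trans h1').le, h2⟩
      have h0 : G.wallFn ε i x = 0 := by
        rw [Geometry.wallFn_eq_zero_iff ha.pos i hI]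
        refine le_antisymm h3 (not_lt.1 fun hlt => hxc i ⟨h1', h4, hlt⟩)
      have hJ := ha.isDefiningFunction_lateral h1' h4 h0
      have := hJ.local_eq.self_of_nhds.1 hx
      rw [h0] at this
      exact lt_irrefl _ this

/-- The points of the closed pieces that are not on the ends of the cylinders. -/
theorem pieces_cases (ha : c.Admissible ε) {x : E 3} (hx : x ∈ G.pieces ε)
    (hend : ∀ i, ¬ (x i = G.ℓ i ∧ x ∈ closure (G.cylinder ε i))) :
    x ∈ G.node ε ∨ (x ∈ frontier (G.node ε) ∧ ∀ i, x ∉ G.disk ε i) ∨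
      ∃ i, ε * G.ℓ₀ ≤ x i ∧ x i < G.ℓ i ∧ G.wallFn ε i x ≤ 0 := by
  have hwall : ∀ i, ε * G.ℓ₀ ≤ x i → x i < G.ℓ i → ‖xbar i x‖ ≤ ε * G.h i (x i) →
      G.wallFn ε i x ≤ 0 := fun i h1 h2 h3 => by
    rw [Geometry.wallFn, sub_nonpos]
    exact pow_le_pow_left₀ (norm_nonneg _) h3 2
  have hdisk : ∀ i, x ∈ G.disk ε i →
      ∃ i, ε * G.ℓ₀ ≤ x i ∧ x i < G.ℓ i ∧ G.wallFn ε i x ≤ 0 := fun i hi => by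
    have h1 : ε * G.ℓ₀ ≤ x i := hi.1.ge
    have h2 : x i < G.ℓ i := hi.1.trans_lt (ha.base_lt i)
    exact ⟨i, h1, h2, hwall i h1 h2 (by rw [hi.1, ha.h_base]; exact hi.2)⟩
  rcases hx with hx | hx
  · by_cases hn : x ∈ G.node ε
    · exact Or.inl hn
    by_cases hd : ∀ i, x ∉ G.disk ε i
    · exact Or.inr (Or.inl ⟨by
        rw [(Geometry.isOpen_node ha.pos).frontier_eq]; exact ⟨hx, hn⟩, hd⟩)
    · push Not at hd
      obtain ⟨i, hi⟩ := hd
      exact Or.inr (Or.inr (hdisk i hi))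
  · obtain ⟨i, hi⟩ := mem_iUnion.1 hx
    obtain ⟨h1, h2, h3⟩ := Geometry.closure_cylinder_subset ha.pos i hi
    have h2' : x i < G.ℓ i := lt_of_le_of_ne h2 fun h => hend i ⟨h, hi⟩
    exact Or.inr (Or.inr ⟨i, h1, h2', hwall i h1 h2' h3⟩)

/-- In a slab that contains the collar of the node and the `i`-th cylinder, these are separated
by the plane `xᵢ = ε ℓ₀` and bounded by the same defining function. -/
theorem mem_node_iff_wallFn (ha : c.Admissible ε) {δ : ℝ} {i : Fin 3} (hδ0 : δ < G.ℓ₀)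
    (hδ : ∀ ξ : E 3, G.ℓ₀ - δ < ξ i → (ξ ∈ G.Ξ ↔ ξ i < G.ℓ₀ ∧ ‖xbar i ξ‖ < G.h i 0)) {x : E 3}
    (h1 : ε * (G.ℓ₀ - δ) < x i) :
    x ∈ G.node ε ↔ x i < ε * G.ℓ₀ ∧ G.wallFn ε i x < 0 := by
  rw [Geometry.mem_node_iff_of_collar ha.pos hδ h1]
  refine and_congr_right fun h2 => ?_
  have h0 : 0 < x i := lt_trans (mul_pos ha.pos (by linarith)) h1
  rw [Geometry.wallFn_neg_iff ha.pos i ⟨h0.le, (h2.trans (ha.base_lt i)).le⟩,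
    ha.h_const i _ ⟨h0.le, h2.le⟩]

end Admissible
end Coefficients
end ThinJunction
end

noncomputable section

namespace ThinJunction

/-! ### Coefficients: regularity and bounds -/

theorem IsC1Holder.continuousOn_fderiv {X Y : Type*} [NormedAddCommGroup X] [NormedSpace ℝ X]
    [NormedAddCommGroup Y] [NormedSpace ℝ Y] {α : ℝ≥0} (hα : 0 < α) {f : X → Y} {U : Set X}
    (h : IsC1Holder α f U) : ContinuousOn (fderiv ℝ f) U := by
  obtain ⟨-, -, K, hK⟩ := h
  exact hK.continuousOn hα

theorem IsC1Holder.contDiffOn {X Y : Type*} [NormedAddCommGroup X] [NormedSpace ℝ X]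
    [NormedAddCommGroup Y] [NormedSpace ℝ Y] {α : ℝ≥0} (hα : 0 < α) {f : X → Y} {U : Set X}
    (hU : IsOpen U) (h : IsC1Holder α f U) : ContDiffOn ℝ 1 f U := by
  have := (contDiffOn_succ_iff_fderiv_of_isOpen (𝕜 := ℝ) (n := 0) (f := f) hU).2
    ⟨h.2.1, by simp, contDiffOn_zero.2 (h.continuousOn_fderiv hα)⟩
  simpa using this

theorem IsC1Holder.exists_fderiv_le {X Y : Type*} [NormedAddCommGroup X] [NormedSpace ℝ X]
    [NormedAddCommGroup Y] [NormedSpace ℝ Y] {α : ℝ≥0} {f : X → Y} {U : Set X}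
    (hU : Bornology.IsBounded U) (h : IsC1Holder α f U) : ∃ C, ∀ x ∈ U, ‖fderiv ℝ f x‖ ≤ C := by
  obtain ⟨-, -, K, hK⟩ := h
  rcases U.eq_empty_or_nonempty with rfl | ⟨y, hy⟩
  · exact ⟨0, by simp⟩
  refine ⟨‖fderiv ℝ f y‖ + K * Metric.diam U ^ (α : ℝ), fun x hx => ?_⟩
  have h1 : dist (fderiv ℝ f x) (fderiv ℝ f y) ≤ K * Metric.diam U ^ (α : ℝ) :=
    hK.dist_le_of_le hx hy (Metric.dist_le_diam_of_mem hU hx hy)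
  have h2 := norm_le_norm_add_norm_sub' (fderiv ℝ f x) (fderiv ℝ f y)
  rw [← dist_eq_norm] at h2
  linarith

theorem matVec_apply (A : Matrix (Fin 3) (Fin 3) ℝ) (v : E 3) (m : Fin 3) :
    matVec A v m = ∑ n, A m n * v n := rfl

theorem inner_matVec (A : Matrix (Fin 3) (Fin 3) ℝ) (v : E 3) :
    inner ℝ (matVec A v) v = ∑ m, ∑ n, A m n * v m * v n := by
  rw [PiLp.inner_apply]
  refine Finset.sum_congr rfl fun m _ => ?_
  simp only [matVec_apply, RCLike.inner_apply, conj_trivial, Finset.mul_sum]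
  refine Finset.sum_congr rfl fun n _ => ?_
  ring

theorem abs_divergence_le {X : E 3 → E 3} {x : E 3} {C : ℝ}
    (h : ∀ v, ‖fderiv ℝ X x v‖ ≤ C * ‖v‖) : |divergence X x| ≤ 3 * C := by
  refine (Finset.abs_sum_le_sum_abs _ _).trans ?_
  have : ∀ j : Fin 3, |(fderiv ℝ X x (EuclideanSpace.single j 1)) j| ≤ C := fun j => by
    refine (abs_coord_le j _).trans ((h _).trans ?_)
    simp
  calc ∑ j : Fin 3, |(fderiv ℝ X x (EuclideanSpace.single j 1)) j| ≤ ∑ _j : Fin 3, C :=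
        Finset.sum_le_sum fun j _ => this j
    _ = 3 * C := by simp

variable {G : Geometry} (c : Coefficients G) {ε : ℝ}

namespace Geometry

theorem isOpen_tube (G : Geometry) (i : Fin 3) : IsOpen (G.tube i) := by
  have h1 : IsOpen {z : ℝ × E 2 | z.1 ∈ Ioo 0 (G.ℓ i)} := isOpen_Ioo.preimage continuous_fst
  have h2 : ContinuousOn (fun z : ℝ × E 2 => G.h i z.1 - ‖z.2‖) {z | z.1 ∈ Ioo 0 (G.ℓ i)} :=
    ((G.continuousOn_h i).comp continuous_fst.continuousOn fun z hz => ⟨hz.1.le, hz.2.le⟩).sub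
      continuous_snd.norm.continuousOn
  have := h2.isOpen_inter_preimage h1 (isOpen_Ioi (a := (0 : ℝ)))
  convert this using 1
  ext z
  simp [tube]

theorem isBounded_tube (G : Geometry) (i : Fin 3) : Bornology.IsBounded (G.tube i) := by
  obtain ⟨H, hH0, hH⟩ := G.exists_h_le
  refine ((Metric.isBounded_Ioo 0 (G.ℓ i)).prod
    (Metric.isBounded_closedBall (x := (0 : E 2)) (r := H))).subset fun z hz => ⟨hz.1, ?_⟩
  rw [mem_closedBall_zero_iff]
  exact hz.2.le.trans (hH i _ ⟨hz.1.1.le, hz.1.2.le⟩)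

/-- The variables of the profile functions of the `i`-th cylinder. -/
def tubeMap (ε : ℝ) (i : Fin 3) : E 3 →L[ℝ] ℝ × E 2 :=
  (EuclideanSpace.proj i : E 3 →L[ℝ] ℝ).prod (ε⁻¹ • xbarL i)

@[simp] theorem tubeMap_apply (i : Fin 3) (x : E 3) :
    tubeMap ε i x = (x i, ε⁻¹ • xbar i x) := rfl

theorem mapsTo_tube (hε : 0 < ε) (i : Fin 3) :
    MapsTo (tubeMap ε i) (G.cylinder ε i) (G.tube i) := by
  intro x hx
  refine ⟨⟨(mul_pos hε G.ℓ₀_pos).trans hx.1, hx.2.1⟩, ?_⟩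
  rw [tubeMap_apply, norm_smul, Real.norm_of_nonneg (inv_nonneg.2 hε.le), inv_mul_lt_iff₀ hε]
  exact hx.2.2

theorem mapsTo_profile (hε : 0 < ε) (i : Fin 3) :
    MapsTo (fun x => ε⁻¹ • xbar i x) (G.cylinder ε i) (G.profile i) := by
  intro x hx
  have := mapsTo_tube hε i hx
  exact ⟨x i, ⟨this.1.1.le, this.1.2.le⟩, this.2⟩

theorem isOpen_profile (G : Geometry) (i : Fin 3) : IsOpen (G.profile i) := by
  have : G.profile i = ⋃ s ∈ Icc 0 (G.ℓ i), Metric.ball (0 : E 2) (G.h i s) := by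
    ext ξ; simp [profile]
  rw [this]
  exact isOpen_biUnion fun s _ => Metric.isOpen_ball

/-- The open pieces of the junction: the node (`none`) and the three cylinders. -/
def piece (G : Geometry) (ε : ℝ) : Option (Fin 3) → Set (E 3)
  | none => G.node ε
  | some i => G.cylinder ε i

theorem isOpen_piece (hε : 0 < ε) (m : Option (Fin 3)) : IsOpen (G.piece ε m) := by
  cases m with
  | none => exact isOpen_node hε
  | some i => exact isOpen_cylinder hε i

theorem closure_piece_subset (m : Option (Fin 3)) : closure (G.piece ε m) ⊆ G.pieces ε := by
  cases m with
  | none => exact subset_union_left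
  | some i =>
    exact subset_union_of_subset_right (subset_iUnion (fun i => closure (G.cylinder ε i)) i) _

theorem piece_subset_junction (hε : 0 < ε) (m : Option (Fin 3)) :
    G.piece ε m ⊆ G.junction ε := by
  cases m with
  | none => exact node_subset_junction hε
  | some i => exact cylinder_subset_junction hε i

theorem isBounded_piece (hε : 0 < ε) (m : Option (Fin 3)) :
    Bornology.IsBounded (G.piece ε m) := by
  cases m with
  | none => exact isBounded_node
  | some i => exact isBounded_cylinder hε i

end Geometry

namespace Coefficients

/-- The diffusion matrix in a piece of the junction. -/
def diff (ε : ℝ) : Option (Fin 3) → E 3 → Matrix (Fin 3) (Fin 3) ℝ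
  | none => c.diffNode ε
  | some i => c.diffCyl ε i

/-- The velocity in a piece of the junction. -/
def vel (ε : ℝ) : Option (Fin 3) → E 3 → E 3
  | none => c.velNode ε
  | some i => c.velCyl ε i

theorem continuousOn_diff (hε : 0 < ε) (m : Option (Fin 3)) (a b : Fin 3) :
    ContinuousOn (fun x => c.diff ε m x a b) (closure (G.piece ε m)) := by
  cases m with
  | none =>
    refine (c.A₀_regular a b).1.comp (continuous_const_smul ε⁻¹).continuousOn ?_
    exact MapsTo.closure (fun x hx => (Geometry.mem_node hε).1 hx) (continuous_const_smul ε⁻¹)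
  | some i =>
    have hc : Continuous fun x : E 3 => ε⁻¹ • xbar i x := (continuous_xbar i).const_smul ε⁻¹
    exact (c.A_regular i a b).1.comp hc.continuousOn ((Geometry.mapsTo_profile hε i).closure hc)

theorem contDiffOn_diff (hε : 0 < ε) (m : Option (Fin 3)) (a b : Fin 3) :
    ContDiffOn ℝ 1 (fun x => c.diff ε m x a b) (G.piece ε m) := by
  cases m with
  | none =>
    refine ((c.A₀_regular a b).contDiffOn c.α_pos G.isOpen_Ξ).comp
      (contDiff_const_smul ε⁻¹).contDiffOn fun x hx => (Geometry.mem_node hε).1 hx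
  | some i =>
    have hc : ContDiff ℝ 1 fun x : E 3 => ε⁻¹ • xbar i x := (xbarL i).contDiff.const_smul ε⁻¹
    exact ((c.A_regular i a b).contDiffOn c.α_pos (G.isOpen_profile i)).comp hc.contDiffOn
      (Geometry.mapsTo_profile hε i)

theorem velCyl_eq (i : Fin 3) (x : E 3) : c.velCyl ε i x =
    assembleL i (c.w i (x i), ε • c.vbar i (Geometry.tubeMap ε i x).1
      (Geometry.tubeMap ε i x).2) := rfl

theorem contDiffOn_w (i : Fin 3) : ContDiffOn ℝ 1 (c.w i) (Ioo 0 (G.ℓ i)) :=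
  (c.w_regular i).contDiffOn c.α_pos isOpen_Ioo

theorem continuousOn_w (i : Fin 3) : ContinuousOn (c.w i) (Icc 0 (G.ℓ i)) := by
  have := (c.w_regular i).1
  rwa [closure_Ioo (G.ℓ_pos i).ne] at this

theorem contDiffOn_vbar (i : Fin 3) :
    ContDiffOn ℝ 1 (fun z : ℝ × E 2 => c.vbar i z.1 z.2) (G.tube i) :=
  (c.vbar_regular i).contDiffOn c.α_pos (G.isOpen_tube i)

theorem continuousOn_vel (hε : 0 < ε) (m : Option (Fin 3)) :
    ContinuousOn (c.vel ε m) (closure (G.piece ε m)) := by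
  cases m with
  | none =>
    refine (c.V₀_regular).1.comp (continuous_const_smul ε⁻¹).continuousOn ?_
    exact MapsTo.closure (fun x hx => (Geometry.mem_node hε).1 hx) (continuous_const_smul ε⁻¹)
  | some i =>
    show ContinuousOn (c.velCyl ε i) _
    simp only [funext (c.velCyl_eq i)]
    have h1 : ContinuousOn (fun x : E 3 => c.w i (x i)) (closure (G.cylinder ε i)) :=
      (c.continuousOn_w i).comp (continuous_coord i).continuousOn fun x hx => by
        obtain ⟨h1, h2, -⟩ := Geometry.closure_cylinder_subset hε i hx
        exact ⟨(mul_pos hε G.ℓ₀_pos).le.trans h1, h2⟩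
    have h2 : ContinuousOn (fun x : E 3 => c.vbar i (Geometry.tubeMap ε i x).1
        (Geometry.tubeMap ε i x).2) (closure (G.cylinder ε i)) :=
      (c.vbar_regular i).1.comp (Geometry.tubeMap ε i).continuous.continuousOn
        ((Geometry.mapsTo_tube hε i).closure (Geometry.tubeMap ε i).continuous)
    exact (assembleL i).continuous.comp_continuousOn (h1.prodMk (h2.const_smul ε))

theorem contDiffOn_vel (hε : 0 < ε) (m : Option (Fin 3)) :
    ContDiffOn ℝ 1 (c.vel ε m) (G.piece ε m) := by
  cases m with
  | none =>
    exact (c.V₀_regular.contDiffOn c.α_pos G.isOpen_Ξ).comp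
      (contDiff_const_smul ε⁻¹).contDiffOn fun x hx => (Geometry.mem_node hε).1 hx
  | some i =>
    show ContDiffOn ℝ 1 (c.velCyl ε i) _
    simp only [funext (c.velCyl_eq i)]
    have h1 : ContDiffOn ℝ 1 (fun x : E 3 => c.w i (x i)) (G.cylinder ε i) :=
      (c.contDiffOn_w i).comp (EuclideanSpace.proj i : E 3 →L[ℝ] ℝ).contDiff.contDiffOn
        fun x hx => (Geometry.mapsTo_tube hε i hx).1
    have h2 : ContDiffOn ℝ 1 (fun x : E 3 => c.vbar i (Geometry.tubeMap ε i x).1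
        (Geometry.tubeMap ε i x).2) (G.cylinder ε i) :=
      (c.contDiffOn_vbar i).comp (Geometry.tubeMap ε i).contDiff.contDiffOn
        (Geometry.mapsTo_tube hε i)
    exact (assembleL i).contDiff.comp_contDiffOn (h1.prodMk (h2.const_smul ε))

/-- The velocity in the node is divergence free. -/
theorem divergence_velNode (hε : 0 < ε) {x : E 3} (hx : x ∈ G.node ε) :
    divergence (c.velNode ε) x = 0 := by
  have hξ := (Geometry.mem_node hε).1 hx
  set ξ := ε⁻¹ • x with hξd
  obtain ⟨hp2, hp0⟩ := c.p_harmonic ξ hξ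
  have hev : c.V₀ =ᶠ[𝓝 ξ] gradient c.p := by
    filter_upwards [G.isOpen_Ξ.mem_nhds hξ] with y hy using c.V₀_eq y hy
  have hd : HasFDerivAt c.V₀ (fderiv ℝ c.V₀ ξ) ξ :=
    (c.V₀_regular.2.1.differentiableAt (G.isOpen_Ξ.mem_nhds hξ)).hasFDerivAt
  have hs : HasFDerivAt (fun y : E 3 => ε⁻¹ • y) (ε⁻¹ • ContinuousLinearMap.id ℝ (E 3)) x :=
    (hasFDerivAt_id x).const_smul ε⁻¹
  have hc : HasFDerivAt (c.velNode ε) _ x := hd.comp x hs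
  have hpd : DifferentiableAt ℝ (fderiv ℝ c.p) ξ :=
    (hp2.fderiv_right (m := 1) (by norm_num)).differentiableAt (by norm_num)
  have hgr : ∀ v, ∀ j : Fin 3, (fderiv ℝ c.V₀ ξ v) j =
      fderiv ℝ (fderiv ℝ c.p) ξ v (EuclideanSpace.single j 1) := by
    intro v j
    have h1 : (fun y => c.V₀ y j) =ᶠ[𝓝 ξ] fun y => fderiv ℝ c.p y (EuclideanSpace.single j 1) := by
      filter_upwards [hev] with y hy
      rw [hy, fderiv_eq_inner_gradient, real_inner_comm, EuclideanSpace.inner_single_left]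
      simp
    have h2 : HasFDerivAt (fun y => c.V₀ y j) _ ξ :=
      (EuclideanSpace.proj j : E 3 →L[ℝ] ℝ).hasFDerivAt.comp ξ hd
    have h3 : HasFDerivAt (fun y => fderiv ℝ c.p y (EuclideanSpace.single j 1)) _ ξ :=
      hpd.hasFDerivAt.clm_apply (hasFDerivAt_const (EuclideanSpace.single j (1 : ℝ)) ξ)
    have h4 := (h3.congr_of_eventuallyEq h1).unique h2
    have h5 := congrArg (fun L => L v) h4
    simpa using h5.symm
  have hlap := hp0.self_of_nhds
  rw [InnerProductSpace.laplacian_eq_iteratedFDeriv_orthonormalBasis c.p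
    (EuclideanSpace.basisFun (Fin 3) ℝ)] at hlap
  rw [divergence, hc.fderiv]
  have : ∀ j : Fin 3, ((fderiv ℝ c.V₀ ξ).comp (ε⁻¹ • ContinuousLinearMap.id ℝ (E 3))
      (EuclideanSpace.single j 1)) j = ε⁻¹ * iteratedFDeriv ℝ 2 c.p ξ
        ![EuclideanSpace.basisFun (Fin 3) ℝ j, EuclideanSpace.basisFun (Fin 3) ℝ j] := by
    intro j
    rw [iteratedFDeriv_two_apply]
    simp [hgr]
  rw [Finset.sum_congr rfl fun j _ => this j, ← Finset.mul_sum]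
  simp only [Pi.zero_apply] at hlap
  rw [hlap, mul_zero]

theorem exists_abs_w_le : ∃ C, ∀ i, ∀ s ∈ Icc 0 (G.ℓ i), |c.w i s| ≤ C := by
  choose C hC using fun i => isCompact_Icc.exists_bound_of_continuousOn (c.continuousOn_w i)
  refine ⟨∑ i, |C i|, fun i s hs => (hC i s hs).trans ((le_abs_self _).trans ?_)⟩
  exact Finset.single_le_sum (f := fun i => |C i|) (fun i _ => abs_nonneg _) (Finset.mem_univ i)

theorem exists_norm_vbar_le :
    ∃ C, ∀ i, ∀ z ∈ closure (G.tube i), ‖c.vbar i z.1 z.2‖ ≤ C := by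
  choose C hC using fun i =>
    (G.isBounded_tube i).isCompact_closure.exists_bound_of_continuousOn (c.vbar_regular i).1
  refine ⟨∑ i, |C i|, fun i z hz => (hC i z hz).trans ((le_abs_self _).trans ?_)⟩
  exact Finset.single_le_sum (f := fun i => |C i|) (fun i _ => abs_nonneg _) (Finset.mem_univ i)

/-- The divergence of the velocity is bounded uniformly in `ε`, because the small transversal
velocity compensates the fast transversal variable. -/
theorem exists_divergence_vel_le : ∃ C, 0 ≤ C ∧ ∀ ε, 0 < ε → ε < 1 → ∀ m, ∀ x ∈ G.piece ε m,
    |divergence (c.vel ε m) x| ≤ C := by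
  choose C₁ hC₁ using fun i =>
    (c.w_regular i).exists_fderiv_le (Metric.isBounded_Ioo 0 (G.ℓ i))
  choose C₂ hC₂ using fun i => (c.vbar_regular i).exists_fderiv_le (G.isBounded_tube i)
  have hsum : ∀ f : Fin 3 → ℝ, ∀ i, f i ≤ ∑ i, |f i| := fun f i => (le_abs_self _).trans
    (Finset.single_le_sum (f := fun i => |f i|) (fun i _ => abs_nonneg _) (Finset.mem_univ i))
  set D₁ := ∑ i, |C₁ i|
  set D₂ := ∑ i, |C₂ i|
  have hD₁ : 0 ≤ D₁ := Finset.sum_nonneg fun i _ => abs_nonneg _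
  have hD₂ : 0 ≤ D₂ := Finset.sum_nonneg fun i _ => abs_nonneg _
  refine ⟨3 * (D₁ + 2 * D₂), by positivity, fun ε hε hε1 m x hx => ?_⟩
  cases m with
  | none => 
    show |divergence (c.velNode ε) x| ≤ _
    rw [c.divergence_velNode hε hx, abs_zero]; positivity
  | some i =>
    refine abs_divergence_le fun v => ?_
    have ht := Geometry.mapsTo_tube hε i hx
    have h1 : HasFDerivAt (fun x : E 3 => c.w i (x i)) _ x :=
      (((c.w_regular i).2.1.differentiableAt (isOpen_Ioo.mem_nhds ht.1)).hasFDerivAt).comp x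
        (EuclideanSpace.proj i : E 3 →L[ℝ] ℝ).hasFDerivAt
    have h2 : HasFDerivAt (fun x : E 3 => c.vbar i (Geometry.tubeMap ε i x).1
        (Geometry.tubeMap ε i x).2) _ x :=
      (((c.vbar_regular i).2.1.differentiableAt
        ((G.isOpen_tube i).mem_nhds ht)).hasFDerivAt).comp x (Geometry.tubeMap ε i).hasFDerivAt
    have h3 : HasFDerivAt (c.velCyl ε i) _ x :=
      (assembleL i).hasFDerivAt.comp x (h1.prodMk (h2.const_smul ε))
    show ‖fderiv ℝ (c.velCyl ε i) x v‖ ≤ _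
    rw [h3.fderiv]
    simp only [ContinuousLinearMap.comp_apply, ContinuousLinearMap.prod_apply, assembleL_apply]
    refine (norm_assemble_le i _ _).trans ?_
    have hv := norm_nonneg v
    have b1 : |fderiv ℝ (c.w i) (x i) (v i)| ≤ D₁ * ‖v‖ := by
      have e1 := ContinuousLinearMap.le_opNorm (fderiv ℝ (c.w i) (x i)) (v i)
      have e2 := (hC₁ i (x i) ht.1).trans (hsum C₁ i)
      have e3 := abs_coord_le i v
      rw [Real.norm_eq_abs, Real.norm_eq_abs] at e1
      exact e1.trans (by gcongr)
    have b2 : ‖Geometry.tubeMap ε i v‖ ≤ (1 + ε⁻¹) * ‖v‖ := by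
      have e1 := abs_coord_le i v
      have e2 := norm_xbar_le i v
      have e0 : 0 < ε⁻¹ := inv_pos.2 hε
      rw [Geometry.tubeMap_apply, Prod.norm_def]
      simp only [Real.norm_eq_abs, norm_smul, abs_of_pos e0]
      refine max_le ?_ ?_ <;> nlinarith
    have b3 : ‖ε • fderiv ℝ (fun z : ℝ × E 2 => c.vbar i z.1 z.2) (Geometry.tubeMap ε i x)
        (Geometry.tubeMap ε i v)‖ ≤ 2 * D₂ * ‖v‖ := by
      rw [norm_smul, Real.norm_of_nonneg hε.le]
      have e1 := ContinuousLinearMap.le_opNorm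
        (fderiv ℝ (fun z : ℝ × E 2 => c.vbar i z.1 z.2) (Geometry.tubeMap ε i x))
        (Geometry.tubeMap ε i v)
      have e2 := (hC₂ i _ ht).trans (hsum C₂ i)
      have e3 : ε * (1 + ε⁻¹) ≤ 2 := by
        rw [mul_add, mul_inv_cancel₀ hε.ne']; linarith
      calc _ ≤ ε * (D₂ * ((1 + ε⁻¹) * ‖v‖)) := by
            refine mul_le_mul_of_nonneg_left (e1.trans ?_) hε.le
            gcongr
        _ = (ε * (1 + ε⁻¹)) * (D₂ * ‖v‖) := by ring
        _ ≤ 2 * (D₂ * ‖v‖) := by gcongr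
        _ = _ := by ring
    calc _ ≤ D₁ * ‖v‖ + 2 * D₂ * ‖v‖ := add_le_add b1 b3
      _ = _ := by ring

/-- A common ellipticity constant of all diffusion matrices. -/
theorem exists_ellipticity : ∃ κ > 0, ∀ ε, 0 < ε → ∀ m, ∀ x ∈ G.piece ε m, ∀ v : E 3,
    κ * ‖v‖ ^ 2 ≤ inner ℝ (matVec (c.diff ε m x) v) v := by
  obtain ⟨κ, hκ, _, _, h0⟩ := c.A₀_elliptic
  choose k hk _ _ h1 using c.A_elliptic
  refine ⟨min κ (min (k 0) (min (k 1) (k 2))), by simp [hκ, hk], fun ε hε m x hx v => ?_⟩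
  have hv : ‖v‖ ^ 2 = ∑ m, v m ^ 2 := by
    rw [EuclideanSpace.norm_sq_eq]; simp
  rw [inner_matVec]
  have hv0 := sq_nonneg ‖v‖
  cases m with
  | none =>
    refine le_trans ?_ (h0 (ε⁻¹ • x) ((Geometry.mem_node hε).1 hx) v).1
    rw [← hv]
    exact mul_le_mul_of_nonneg_right (min_le_left _ _) hv0
  | some i =>
    refine le_trans ?_ (h1 i (ε⁻¹ • xbar i x) (Geometry.mapsTo_profile hε i hx) v).1
    rw [← hv]
    refine mul_le_mul_of_nonneg_right ?_ hv0
    fin_cases i <;> simp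

theorem _root_.ThinJunction.Geometry.exists_deriv_h_le (G : Geometry) :
    ∃ C, 0 ≤ C ∧ ∀ i, ∀ s ∈ Ioo 0 (G.ℓ i), |deriv (G.h i) s| ≤ C := by
  have h : ∀ i, ContinuousOn (derivWithin (G.h i) (Icc 0 (G.ℓ i))) (Icc 0 (G.ℓ i)) := fun i =>
    (G.h_smooth i).continuousOn_derivWithin (uniqueDiffOn_Icc (G.ℓ_pos i)) (by norm_num)
  choose C hC using fun i => isCompact_Icc.exists_bound_of_continuousOn (h i)
  refine ⟨∑ i, |C i|, Finset.sum_nonneg fun i _ => abs_nonneg _, fun i s hs => ?_⟩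
  have h1 := hC i s ⟨hs.1.le, hs.2.le⟩
  rw [derivWithin_of_mem_nhds (Icc_mem_nhds hs.1 hs.2)] at h1
  exact h1.trans ((le_abs_self _).trans
    (Finset.single_le_sum (f := fun i => |C i|) (fun i _ => abs_nonneg _) (Finset.mem_univ i)))

theorem _root_.ThinJunction.Geometry.exists_le_h (G : Geometry) :
    ∃ a > 0, ∀ i, ∀ s ∈ Icc 0 (G.ℓ i), a ≤ G.h i s := by
  have h : ∀ i, ∃ s ∈ Icc 0 (G.ℓ i), IsMinOn (G.h i) (Icc 0 (G.ℓ i)) s := fun i =>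
    isCompact_Icc.exists_isMinOn (nonempty_Icc.2 (G.ℓ_pos i).le) (G.continuousOn_h i)
  choose s hs hm using h
  have hpos : ∀ i, 0 < G.h i (s i) := fun i => G.h_pos i _ (hs i)
  refine ⟨min (G.h 0 (s 0)) (min (G.h 1 (s 1)) (G.h 2 (s 2))), by simp [hpos], fun i t ht => ?_⟩
  refine le_trans ?_ (hm i ht)
  fin_cases i <;> simp

theorem _root_.ThinJunction.Geometry.tubeMap_mem_closure_tube (hε : 0 < ε) {i : Fin 3} {x : E 3}
    (hx : x i ∈ Ioo 0 (G.ℓ i)) (h : ‖xbar i x‖ ≤ ε * G.h i (x i)) :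
    Geometry.tubeMap ε i x ∈ closure (G.tube i) := by
  have hh := mul_pos hε (G.h_pos i _ ⟨hx.1.le, hx.2.le⟩)
  have ht : Tendsto (fun a => Geometry.tubeMap ε i (Geometry.squeeze i x a)) (𝓝[<] 1)
      (𝓝 (Geometry.tubeMap ε i x)) := by
    have := ((Geometry.tubeMap ε i).continuous.comp
      (Geometry.continuous_squeeze i x)).tendsto 1
    simp only [Function.comp, Geometry.squeeze_one] at this
    exact this.mono_left nhdsWithin_le_nhds
  refine mem_closure_of_tendsto ht ?_
  filter_upwards [Ioo_mem_nhdsLT (show (0 : ℝ) < 1 by norm_num)] with a ha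
  rw [Geometry.tubeMap_apply, Geometry.squeeze, assemble_self, xbar_assemble]
  refine ⟨hx, ?_⟩
  rw [norm_smul, norm_smul, Real.norm_of_nonneg (inv_nonneg.2 hε.le), inv_mul_lt_iff₀ hε,
    Real.norm_of_nonneg ha.1.le]
  show _ < ε * G.h i (x i)
  nlinarith [ha.1, ha.2, norm_nonneg (xbar i x)]

/-- Bounds at the wall of a cylinder, in terms of the derivative `2 ‖x̄‖²` of the defining function
in the radial direction: all quantities are of order `ε²` there. -/
theorem exists_wall_bound : ∃ C > 0, ∀ ε, 0 < ε → ε < 1 → ∀ i, ∀ x : E 3, x i ∈ Ioo 0 (G.ℓ i) →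
    G.wallFn ε i x = 0 →
    ε * ‖gradient (G.wallFn ε i) x‖ ≤ C * (2 * ‖xbar i x‖ ^ 2) ∧
      |fderiv ℝ (G.wallFn ε i) x (c.velCyl ε i x)| ≤ C * (2 * ‖xbar i x‖ ^ 2) := by
  obtain ⟨a, ha, hah⟩ := G.exists_le_h
  obtain ⟨H₁, hH₁, hH⟩ := G.exists_deriv_h_le
  obtain ⟨Cw, hCw⟩ := c.exists_abs_w_le
  obtain ⟨Cv, hCv⟩ := c.exists_norm_vbar_le
  set D := 1 + H₁ + |Cv| + H₁ * |Cw| with hD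
  have hD0 : 0 < D := by positivity
  refine ⟨D / a, div_pos hD0 ha, fun ε hε hε1 i x hx h0 => ?_⟩
  have hI : x i ∈ Icc 0 (G.ℓ i) := ⟨hx.1.le, hx.2.le⟩
  have hn := (Geometry.wallFn_eq_zero_iff hε i hI).1 h0
  set h := G.h i (x i) with hh
  have hh0 : 0 < h := G.h_pos i _ hI
  have hd := hH i _ hx
  -- the common lower bound of the right-hand sides
  have hR : 2 * ε ^ 2 * h * D ≤ D / a * (2 * ‖xbar i x‖ ^ 2) := by
    rw [hn, div_mul_eq_mul_div, le_div_iff₀ ha]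
    have : 2 * ε ^ 2 * h * D * a ≤ 2 * ε ^ 2 * h * D * h := by
      gcongr; exact hah i _ hI
    linarith
  constructor
  · refine le_trans ?_ hR
    set g := gradient (G.wallFn ε i) x with hg
    have h1 : ‖g‖ ^ 2 ≤ (2 * (ε * h) + 2 * ε ^ 2 * h * H₁) * ‖g‖ := by
      rw [← real_inner_self_eq_norm_sq, ← fderiv_eq_inner_gradient, Geometry.fderiv_wallFn i hx]
      have e1 := real_inner_le_norm (xbar i x) (xbar i g)
      rw [hn] at e1
      have e2 := norm_xbar_le i g
      have e3 : |2 * ε ^ 2 * h * deriv (G.h i) (x i) * g i| ≤ 2 * ε ^ 2 * h * H₁ * ‖g‖ := by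
        rw [abs_mul, abs_mul, abs_of_pos (show 0 < 2 * ε ^ 2 * h by positivity)]
        gcongr
        exact abs_coord_le i g
      have e4 : ε * h * ‖xbar i g‖ ≤ ε * h * ‖g‖ := by gcongr
      have := neg_abs_le (2 * ε ^ 2 * h * deriv (G.h i) (x i) * g i)
      linarith
    have h2 : ‖g‖ ≤ 2 * (ε * h) + 2 * ε ^ 2 * h * H₁ := by
      rcases (norm_nonneg g).eq_or_lt with h0 | h0
      · rw [← h0]; positivity
      · rw [sq] at h1; exact le_of_mul_le_mul_right h1 h0
    calc ε * ‖g‖ ≤ ε * (2 * (ε * h) + 2 * ε ^ 2 * h * H₁) := by gcongr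
      _ = 2 * ε ^ 2 * h * (1 + ε * H₁) := by ring
      _ ≤ 2 * ε ^ 2 * h * D := by
        gcongr
        have : ε * H₁ ≤ 1 * H₁ := by gcongr
        have : 0 ≤ |Cv| + H₁ * |Cw| := by positivity
        linarith
  · refine le_trans ?_ hR
    rw [Geometry.fderiv_wallFn i hx, velCyl, assemble_self, xbar_assemble, inner_smul_right]
    have hm := Geometry.tubeMap_mem_closure_tube hε hx hn.le
    have e1 : |inner ℝ (xbar i x) (c.vbar i (x i) (ε⁻¹ • xbar i x))| ≤ ε * h * |Cv| := by
      refine (abs_real_inner_le_norm _ _).trans ?_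
      rw [hn]
      gcongr
      exact (hCv i _ hm).trans (le_abs_self _)
    have e2 : |c.w i (x i)| ≤ |Cw| := (hCw i _ hI).trans (le_abs_self _)
    calc _ ≤ |2 * (ε * inner ℝ (xbar i x) (c.vbar i (x i) (ε⁻¹ • xbar i x)))| +
          |2 * ε ^ 2 * h * deriv (G.h i) (x i) * c.w i (x i)| := abs_sub _ _
      _ ≤ 2 * (ε * (ε * h * |Cv|)) + 2 * ε ^ 2 * h * H₁ * |Cw| := by
        refine add_le_add ?_ ?_
        · rw [abs_mul, abs_mul, abs_of_pos hε, abs_of_pos (show (0 : ℝ) < 2 by norm_num)]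
          gcongr
        · rw [abs_mul, abs_mul, abs_of_pos (show 0 < 2 * ε ^ 2 * h by positivity)]
          gcongr
      _ = 2 * ε ^ 2 * h * (|Cv| + H₁ * |Cw|) := by ring
      _ ≤ 2 * ε ^ 2 * h * D := by gcongr; linarith

end Coefficients

end ThinJunction
end

noncomputable section

namespace ThinJunction

/-! ### Time averages of vector fields -/

theorem continuousOn_timeIntegral {Y F : Type*} [TopologicalSpace Y] [NormedAddCommGroup F]
    [NormedSpace ℝ F] {f : Y → ℝ → F} {s : Set Y} {a b : ℝ} (hab : a ≤ b)
    (h : ContinuousOn (fun z : Y × ℝ => f z.1 z.2) (s ×ˢ Icc a b)) :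
    ContinuousOn (fun x => ∫ t in a..b, f x t) s := by
  rw [continuousOn_iff_continuous_domRestrict]
  have h1 : Continuous (Function.uncurry fun (x : s) (t : ℝ) => f x (projIcc a b hab t)) := by
    refine h.comp_continuous (f := fun z : s × ℝ => ((z.1 : Y), (projIcc a b hab z.2 : ℝ)))
      (by fun_prop) fun z => ⟨z.1.2, (projIcc a b hab z.2).2⟩
  have h2 := intervalIntegral.continuous_parametric_intervalIntegral_of_continuous'
    (μ := volume) h1 a b
  convert h2 using 2 with x
  refine intervalIntegral.integral_congr fun t ht => ?_
  rw [uIcc_of_le hab] at ht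
  simp [projIcc_of_mem hab ht]

theorem intervalIntegrable_of_continuousOn_prod {Y F : Type*} [TopologicalSpace Y]
    [NormedAddCommGroup F] {f : Y → ℝ → F} {s : Set Y} {a b : ℝ} (hab : a ≤ b)
    (h : ContinuousOn (fun z : Y × ℝ => f z.1 z.2) (s ×ˢ Icc a b)) {x : Y} (hx : x ∈ s) :
    IntervalIntegrable (f x) volume a b := by
  refine ContinuousOn.intervalIntegrable ?_
  rw [uIcc_of_le hab]
  exact h.comp (f := fun t : ℝ => (x, t)) (by fun_prop) fun t ht => ⟨hx, ht⟩

theorem timeIntegral_swap {k : E 3 → ℝ → ℝ} {K : Set (E 3)} (hK : IsCompact K) {a b : ℝ}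
    (hab : a ≤ b) (h : ContinuousOn (fun z : E 3 × ℝ => k z.1 z.2) (K ×ˢ Icc a b))
    (h0 : ∀ x ∉ K, ∀ t, k x t = 0) :
    ∫ x, ∫ t in a..b, k x t = ∫ t in a..b, ∫ x, k x t := by
  rw [eq_comm]
  refine intervalIntegral_integral_swap (f := fun t x => k x t) ?_
  rw [uIoc_of_le hab, ← Measure.restrict_univ (μ := (volume : Measure (E 3))),
    Measure.prod_restrict]
  have h1 : ContinuousOn (Function.uncurry fun (t : ℝ) (x : E 3) => k x t) (Icc a b ×ˢ K) :=
    h.comp (f := fun z : ℝ × E 3 => (z.2, z.1)) (by fun_prop) fun z hz => ⟨hz.2, hz.1⟩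
  have h2 : IntegrableOn (Function.uncurry fun (t : ℝ) (x : E 3) => k x t) (Icc a b ×ˢ K)
      (volume.prod volume) := h1.integrableOn_compact (isCompact_Icc.prod hK)
  refine IntegrableOn.of_forall_sdiff_eq_zero
    (h2.mono_set (prod_mono Ioc_subset_Icc_self subset_rfl))
    (measurableSet_Ioc.prod MeasurableSet.univ) fun z hz => ?_
  exact h0 _ (fun hk => hz.2 ⟨hz.1.1, hk⟩) _

/-- Integration by parts against a compactly supported function. -/
theorem integral_fderiv_apply_eq_neg_divergence {ζ : E 3 → ℝ} {Y : E 3 → E 3} {U : Set (E 3)}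
    (hU : IsOpen U) (hζ : ContDiff ℝ 1 ζ) (hc : HasCompactSupport ζ) (hs : tsupport ζ ⊆ U)
    (hY : ContDiffOn ℝ 1 Y U) :
    ∫ x, fderiv ℝ ζ x (Y x) = ∫ x, -(ζ x * divergence Y x) := by
  have hYc : ∀ j : Fin 3, ∀ x ∈ U, HasFDerivAt (fun y => Y y j)
      ((EuclideanSpace.proj j : E 3 →L[ℝ] ℝ).comp (fderiv ℝ Y x)) x := fun j x hx =>
    (EuclideanSpace.proj j : E 3 →L[ℝ] ℝ).hasFDerivAt.comp x
      (((hY.contDiffAt (hU.mem_nhds hx)).differentiableAt (by norm_num)).hasFDerivAt)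
  have hsm : ∀ j : Fin 3, ContDiff ℝ 1 fun x => ζ x * Y x j := fun j => by
    refine contDiff_of_contDiffAt_tsupport fun x hx => ?_
    have hxU := hs (tsupport_mul_subset_left hx)
    exact hζ.contDiffAt.mul ((EuclideanSpace.proj j : E 3 →L[ℝ] ℝ).contDiff.contDiffAt.comp x
      (hY.contDiffAt (hU.mem_nhds hxU)))
  have hsc : ∀ j : Fin 3, HasCompactSupport fun x => ζ x * Y x j := fun j => hc.mul_right
  -- the divergence of `ζ Y`, with integral zero
  have hz : ∫ x, ∑ j : Fin 3, fderiv ℝ (fun y => ζ y * Y y j) x (EuclideanSpace.single j 1) = 0 := by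
    rw [integral_finsetSum]
    · exact Finset.sum_eq_zero fun j _ => integral_fderiv_apply_eq_zero (hsm j) (hsc j) _
    · exact fun j _ => integrable_of_contDiff (continuous_fderiv_apply_const (hsm j) _)
        (hasCompactSupport_fderiv_apply (hsc j) _)
  have hpt : ∀ x, ∑ j : Fin 3, fderiv ℝ (fun y => ζ y * Y y j) x (EuclideanSpace.single j 1) =
      fderiv ℝ ζ x (Y x) + ζ x * divergence Y x := by
    intro x
    by_cases hx : x ∈ tsupport ζ
    · have hv : Y x = ∑ j : Fin 3, Y x j • EuclideanSpace.single j (1 : ℝ) := by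
        ext k; simp [Finset.sum_apply, Pi.single_apply]
      have e1 : fderiv ℝ ζ x (Y x) =
          ∑ j : Fin 3, Y x j * fderiv ℝ ζ x (EuclideanSpace.single j 1) := by
        conv_lhs => rw [hv]
        simp
      rw [e1, divergence, Finset.mul_sum, ← Finset.sum_add_distrib]
      refine Finset.sum_congr rfl fun j _ => ?_
      have e2 : HasFDerivAt (fun y => ζ y * Y y j) _ x :=
        (hζ.differentiable (by norm_num) x).hasFDerivAt.mul (hYc j x (hs hx))
      rw [e2.fderiv]
      simp
      ring
    · have h0 : ζ =ᶠ[𝓝 x] fun _ => 0 := by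
        filter_upwards [(isClosed_tsupport ζ).isOpen_compl.mem_nhds hx] with y hy
        exact image_eq_zero_of_notMem_tsupport hy
      have h1 : ∀ j : Fin 3, (fun y => ζ y * Y y j) =ᶠ[𝓝 x] fun _ => 0 := fun j => by
        filter_upwards [h0] with y hy
        rw [hy, zero_mul]
      simp only [(h1 _).fderiv_eq]
      simp [h0.fderiv_eq, h0.self_of_nhds]
  simp only [hpt] at hz
  have hf0 : ∀ x ∉ tsupport ζ, fderiv ℝ ζ x (Y x) = 0 := fun x hx => by
    have h0 : ζ =ᶠ[𝓝 x] fun _ => 0 := by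
      filter_upwards [(isClosed_tsupport ζ).isOpen_compl.mem_nhds hx] with z hz
      exact image_eq_zero_of_notMem_tsupport hz
    simp [h0.fderiv_eq]
  have hc1 : Continuous fun x => fderiv ℝ ζ x (Y x) := by
    refine continuous_of_tsupport fun x hx => ?_
    have hx' : x ∈ tsupport ζ :=
      closure_minimal (fun y hy => not_imp_comm.1 (hf0 y) hy) (isClosed_tsupport ζ) hx
    exact (hζ.continuous_fderiv (by norm_num)).continuousAt.clm_apply
      (hY.continuousOn.continuousAt (hU.mem_nhds (hs hx')))
  have hi1 : Integrable fun x => fderiv ℝ ζ x (Y x) :=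
    integrable_of_contDiff hc1 (HasCompactSupport.intro hc hf0)
  have hi2 : Integrable fun x => fderiv ℝ ζ x (Y x) + ζ x * divergence Y x := by
    simp only [← hpt]
    exact integrable_finsetSum _ fun j _ => integrable_of_contDiff
      (continuous_fderiv_apply_const (hsm j) _) (hasCompactSupport_fderiv_apply (hsc j) _)
  have hi3 : Integrable fun x => ζ x * divergence Y x :=
    (hi2.sub hi1).congr (ae_of_all _ fun x => by simp)
  rw [integral_add hi1 hi3] at hz
  rw [integral_neg]
  linarith

theorem WeakDivLE.congr {μ : Measure (E 3)} {X X' : E 3 → E 3} {f f' : E 3 → ℝ} {U : Set (E 3)}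
    (hX : ∀ x ∈ U, X x = X' x) (hf : ∀ x ∈ U, f x = f' x) (h : WeakDivLE μ X f U) :
    WeakDivLE μ X' f' U := by
  intro ζ hζ hc hs h0
  have := h ζ hζ hc hs h0
  have e1 : ∀ x, f' x * ζ x = f x * ζ x := fun x => by
    by_cases hx : x ∈ tsupport ζ
    · rw [hf x (hs hx)]
    · rw [image_eq_zero_of_notMem_tsupport hx, mul_zero, mul_zero]
  have e2 : ∀ x, fderiv ℝ ζ x (X' x) = fderiv ℝ ζ x (X x) := fun x => by
    by_cases hx : x ∈ tsupport ζ
    · rw [hX x (hs hx)]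
    · have h0 : ζ =ᶠ[𝓝 x] fun _ => 0 := by
        filter_upwards [(isClosed_tsupport ζ).isOpen_compl.mem_nhds hx] with z hz
        exact image_eq_zero_of_notMem_tsupport hz
      simp [h0.fderiv_eq]
  simpa only [e1, e2] using this

/-- The weak divergence inequality for the time average of a field that is `C¹` in space, from a
bound of the time average of its divergence. -/
theorem WeakDivLE.of_timeIntegral {U : Set (E 3)} (hU : IsOpen U) {a b : ℝ} (hab : a ≤ b)
    {Y : E 3 → ℝ → E 3} {d : E 3 → ℝ → ℝ} {f : E 3 → ℝ}
    (hYc : ContinuousOn (fun z : E 3 × ℝ => Y z.1 z.2) (U ×ˢ Icc a b))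
    (hY : ∀ t ∈ Icc a b, ContDiffOn ℝ 1 (fun x => Y x t) U)
    (hdc : ContinuousOn (fun z : E 3 × ℝ => d z.1 z.2) (U ×ˢ Icc a b))
    (hd : ∀ t ∈ Icc a b, ∀ x ∈ U, divergence (fun y => Y y t) x = d x t)
    (hf : ContinuousOn f U) (hfd : ∀ x ∈ U, f x ≤ ∫ t in a..b, -d x t) :
    WeakDivLE volume (fun x => ∫ t in a..b, Y x t) f U := by
  intro ζ hζ hc hs h0
  have hsub : tsupport ζ ×ˢ Icc a b ⊆ U ×ˢ Icc a b := prod_mono hs subset_rfl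
  have hz0 : ∀ x ∉ tsupport ζ, fderiv ℝ ζ x = 0 := fun x hx => by
    have h0 : ζ =ᶠ[𝓝 x] fun _ => 0 := by
      filter_upwards [(isClosed_tsupport ζ).isOpen_compl.mem_nhds hx] with z hz
      exact image_eq_zero_of_notMem_tsupport hz
    simp [h0.fderiv_eq]
  have hk1 : ContinuousOn (fun z : E 3 × ℝ => fderiv ℝ ζ z.1 (Y z.1 z.2))
      (tsupport ζ ×ˢ Icc a b) :=
    ((hζ.continuous_fderiv (by norm_num)).comp continuous_fst).continuousOn.clm_apply
      (hYc.mono hsub)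
  have hk2 : ContinuousOn (fun z : E 3 × ℝ => -(ζ z.1 * d z.1 z.2)) (tsupport ζ ×ˢ Icc a b) :=
    ((hζ.continuous.comp continuous_fst).continuousOn.mul (hdc.mono hsub)).neg
  have e1 : ∫ x, fderiv ℝ ζ x (∫ t in a..b, Y x t) = ∫ x, ∫ t in a..b, fderiv ℝ ζ x (Y x t) := by
    refine integral_congr_ae (ae_of_all _ fun x => ?_)
    by_cases hx : x ∈ tsupport ζ
    · exact ((fderiv ℝ ζ x).intervalIntegral_comp_comm
        (intervalIntegrable_of_continuousOn_prod hab hYc (hs hx))).symm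
    · simp [hz0 x hx]
  have e2 : ∫ x, ∫ t in a..b, fderiv ℝ ζ x (Y x t) = ∫ t in a..b, ∫ x, fderiv ℝ ζ x (Y x t) :=
    timeIntegral_swap hc hab hk1 fun x hx t => by simp [hz0 x hx]
  have e3 : ∫ t in a..b, ∫ x, fderiv ℝ ζ x (Y x t) = ∫ t in a..b, ∫ x, -(ζ x * d x t) := by
    refine intervalIntegral.integral_congr fun t ht => ?_
    rw [uIcc_of_le hab] at ht
    refine (integral_fderiv_apply_eq_neg_divergence hU hζ hc hs (hY t ht)).trans ?_
    refine integral_congr_ae (ae_of_all _ fun x => ?_)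
    by_cases hx : x ∈ tsupport ζ
    · simp only [hd t ht x (hs hx)]
    · simp [image_eq_zero_of_notMem_tsupport hx]
  have e4 : ∫ x, ∫ t in a..b, -(ζ x * d x t) = ∫ t in a..b, ∫ x, -(ζ x * d x t) :=
    timeIntegral_swap hc hab hk2 fun x hx t => by simp [image_eq_zero_of_notMem_tsupport hx]
  rw [e1, e2, e3, ← e4]
  have hz1 : ∀ x ∉ tsupport ζ, f x * ζ x = 0 := fun x hx => by
    simp [image_eq_zero_of_notMem_tsupport hx]
  have hz2 : ∀ x ∉ tsupport ζ, ∫ t in a..b, -(ζ x * d x t) = 0 := fun x hx => by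
    simp [image_eq_zero_of_notMem_tsupport hx]
  have i1 : Integrable fun x => f x * ζ x :=
    (integrableOn_iff_integrable_of_support_subset fun x hx => not_imp_comm.1 (hz1 x) hx).1
      (((hf.mono hs).mul hζ.continuous.continuousOn).integrableOn_compact hc)
  have i2 : Integrable fun x => ∫ t in a..b, -(ζ x * d x t) :=
    (integrableOn_iff_integrable_of_support_subset fun x hx => not_imp_comm.1 (hz2 x) hx).1
      ((continuousOn_timeIntegral hab hk2).integrableOn_compact hc)
  refine integral_mono i1 i2 fun x => ?_
  by_cases hx : x ∈ tsupport ζ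
  · have e5 : ∫ t in a..b, -(ζ x * d x t) = ζ x * ∫ t in a..b, -d x t := by
      rw [← intervalIntegral.integral_const_mul]
      simp
    simp only [e5]
    rw [mul_comm]
    exact mul_le_mul_of_nonneg_left (hfd x (hs hx)) (h0 x)
  · simp only [hz1 x hx, hz2 x hx, le_refl]

end ThinJunction
end

noncomputable section

namespace ThinJunction

/-! ### The energy flux and its divergence -/

theorem divergence_add {X Y : E 3 → E 3} {x : E 3} (hX : DifferentiableAt ℝ X x)
    (hY : DifferentiableAt ℝ Y x) :
    divergence (fun y => X y + Y y) x = divergence X x + divergence Y x := by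
  have : fderiv ℝ (fun y => X y + Y y) x = fderiv ℝ X x + fderiv ℝ Y x :=
    (hX.hasFDerivAt.add hY.hasFDerivAt).fderiv
  simp [divergence, this, Finset.sum_add_distrib]

theorem divergence_smul {a : E 3 → ℝ} {X : E 3 → E 3} {x : E 3} (ha : DifferentiableAt ℝ a x)
    (hX : DifferentiableAt ℝ X x) :
    divergence (fun y => a y • X y) x = a x * divergence X x + fderiv ℝ a x (X x) := by
  have h1 : fderiv ℝ (fun y => a y • X y) x = _ := (ha.hasFDerivAt.smul hX.hasFDerivAt).fderiv
  have hv : X x = ∑ j : Fin 3, X x j • EuclideanSpace.single j (1 : ℝ) := by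
    ext k; simp [Finset.sum_apply, Pi.single_apply]
  have e1 : fderiv ℝ a x (X x) =
      ∑ j : Fin 3, X x j * fderiv ℝ a x (EuclideanSpace.single j 1) := by
    conv_lhs => rw [hv]
    simp
  rw [e1, divergence, divergence, h1, Finset.mul_sum, ← Finset.sum_add_distrib]
  refine Finset.sum_congr rfl fun j _ => ?_
  simp
  ring

/-- The radial field `(0, x̄ᵢ)` in the `i`-th cylinder, and zero in the node. -/
def radialField : Option (Fin 3) → E 3 →L[ℝ] E 3
  | none => 0
  | some i => (assembleL i).comp ((0 : E 3 →L[ℝ] ℝ).prod (xbarL i))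

theorem radialField_some (i : Fin 3) (x : E 3) : radialField (some i) x = Geometry.radial i x := rfl

@[simp] theorem radialField_none (x : E 3) : radialField none x = 0 := rfl

/-- The divergence of the radial field. -/
def radialDiv : Option (Fin 3) → ℝ
  | none => 0
  | some _ => 2

theorem radialDiv_le (m : Option (Fin 3)) : radialDiv m ≤ 2 := by cases m <;> simp [radialDiv]

theorem divergence_radialField (m : Option (Fin 3)) (x : E 3) :
    divergence (radialField m) x = radialDiv m := by
  rw [divergence, (radialField m).fderiv]
  cases m with
  | none => simp [radialDiv]
  | some i =>
    simp only [radialField_some, Geometry.radial, radialDiv]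
    rw [Fin.sum_univ_succAbove _ i]
    simp

theorem contDiff_truncK {δ : ℝ} (hδ : 0 < δ) : ContDiff ℝ 1 (truncK δ) :=
  (contDiff_id.mul (contDiff_truncD hδ)).sub (contDiff_trunc hδ)

variable {G : Geometry} (c : Coefficients G) {ε T δ C M : ℝ} {F₀ : E 3 → ℝ → ℝ}
  {F Φ : Fin 3 → E 3 → ℝ → ℝ} {ψ : E 3 → ℝ → ℝ} {g : E 3 → ℝ → E 3}

namespace Geometry

theorem closedCylinder_subset_closure (hε : 0 < ε) (i : Fin 3) (h : ε * G.ℓ₀ < G.ℓ i) :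
    G.closedCylinder ε i ⊆ closure (G.cylinder ε i) := by
  intro x hx
  rcases hx.2.1.lt_or_eq with hl | hl
  · exact mem_closure_cylinder hε hx hl
  obtain ⟨d, hd, hh⟩ := G.h_const_right i
  have ht : Tendsto (fun s => assemble i (x i - s) (xbar i x)) (𝓝[>] 0) (𝓝 x) := by
    have hc : Continuous fun s : ℝ => assemble i (x i - s) (xbar i x) :=
      (continuous_assemble i).comp (f := fun s : ℝ => (x i - s, xbar i x)) (by fun_prop)
    have := hc.tendsto 0
    rw [sub_zero, ← eq_assemble] at this
    exact this.mono_left nhdsWithin_le_nhds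
  refine isClosed_closure.mem_of_tendsto ht ?_
  filter_upwards [Ioo_mem_nhdsGT (show (0 : ℝ) < min d (G.ℓ i - ε * G.ℓ₀) by
    simp [hd, h])] with s hs
  obtain ⟨h1, h2⟩ := lt_min_iff.1 hs.2
  have hmem : G.ℓ i - s ∈ Icc 0 (G.ℓ i) :=
    ⟨by linarith [mul_pos hε G.ℓ₀_pos], by linarith [hs.1]⟩
  refine mem_closure_cylinder hε ?_ ?_
  · refine ⟨?_, ?_, ?_⟩ <;> simp only [assemble_self, xbar_assemble]
    · linarith
    · linarith [hs.1]
    · rw [hl, hh _ hmem (by linarith)]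
      exact hl ▸ hx.2.2
  · rw [assemble_self]; linarith [hs.1]

/-- The closed disks at the ends of the three cylinders. -/
def ends (G : Geometry) (ε : ℝ) : Set (E 3) := ⋃ i, closure (G.crossSection ε i (G.ℓ i))

theorem isClosed_ends : IsClosed (G.ends ε) := isClosed_iUnion_of_finite fun _ => isClosed_closure

end Geometry

namespace Coefficients

variable {c}

theorem Admissible.closure_end_subset (ha : c.Admissible ε) (i : Fin 3) :
    closure (G.crossSection ε i (G.ℓ i)) ⊆ closure (G.cylinder ε i) := by
  intro x hx
  obtain ⟨h1, h2⟩ := Geometry.closure_crossSection_subset i _ hx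
  exact Geometry.closedCylinder_subset_closure ha.pos i (ha.base_lt i)
    ⟨h1 ▸ (ha.base_lt i).le, h1.le, h1 ▸ h2⟩

theorem Admissible.notMem_ends (ha : c.Admissible ε) {m : Option (Fin 3)} {x : E 3}
    (hx : x ∈ G.piece ε m) : x ∉ G.ends ε := by
  intro hxe
  obtain ⟨i, hi⟩ := mem_iUnion.1 hxe
  obtain ⟨h1, -⟩ := Geometry.closure_crossSection_subset i _ hi
  cases m with
  | none =>
    have := Geometry.coord_lt_of_mem_node ha.pos hx i
    linarith [ha.base_lt i]
  | some j =>
    rcases eq_or_ne j i with rfl | hij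
    · exact hx.2.1.ne h1
    · exact disjoint_left.1 (ha.disjoint hij) (subset_closure hx) (ha.closure_end_subset i hi)

theorem Admissible.closure_piece_subset_junction (ha : c.Admissible ε) (m : Option (Fin 3)) :
    closure (G.piece ε m) ⊆ closure (G.junction ε) := by
  rw [Geometry.closure_junction ha.pos]
  exact Geometry.closure_piece_subset m

/-- The pieces of the junction are pairwise disjoint. -/
theorem Admissible.piece_unique (ha : c.Admissible ε) {m n : Option (Fin 3)} {x : E 3}
    (hm : x ∈ G.piece ε m) (hn : x ∈ G.piece ε n) : m = n := by
  cases m with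
  | none =>
    cases n with
    | none => rfl
    | some j => exact absurd hn.1 (Geometry.coord_lt_of_mem_node ha.pos hm j).not_gt
  | some i =>
    cases n with
    | none => exact absurd hm.1 (Geometry.coord_lt_of_mem_node ha.pos hn i).not_gt
    | some j =>
      by_contra hne
      exact disjoint_left.1 (ha.disjoint fun h : i = j => hne (congrArg some h))
        (subset_closure hm) (subset_closure hn)

end Coefficients

/-- The right-hand side of the equation in a piece of the junction. -/
def source (F₀ : E 3 → ℝ → ℝ) (F : Fin 3 → E 3 → ℝ → ℝ) : Option (Fin 3) → E 3 → ℝ → ℝ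
  | none => F₀
  | some i => F i

namespace IsSolutionWithGradient

variable {c}

theorem eq_zero_of_mem_ends (hs : IsSolutionWithGradient c ε T F₀ F Φ ψ g) (ha : c.Admissible ε)
    (hT : 0 < T) {x : E 3} (hx : x ∈ G.ends ε) {t : ℝ} (ht : t ∈ Icc 0 T) : ψ x t = 0 := by
  obtain ⟨i, hi⟩ := mem_iUnion.1 hx
  have h1 : EqOn (fun z : E 3 × ℝ => ψ z.1 z.2) (fun _ => 0)
      (G.crossSection ε i (G.ℓ i) ×ˢ Ioo 0 T) := fun z hz => hs.dirichlet i _ hz.1 _ hz.2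
  have h2 : closure (G.crossSection ε i (G.ℓ i)) ×ˢ Icc 0 T ⊆
      closure (G.junction ε) ×ˢ Icc 0 T :=
    prod_mono ((ha.closure_end_subset i).trans
      (ha.closure_piece_subset_junction (some i))) subset_rfl
  have h3 : closure (G.crossSection ε i (G.ℓ i)) ×ˢ Icc 0 T =
      closure (G.crossSection ε i (G.ℓ i) ×ˢ Ioo 0 T) := by
    rw [closure_prod_eq, closure_Ioo hT.ne]
  exact h1.of_subset_closure (hs.continuous.mono h2) continuousOn_const
    (h3 ▸ subset_closure) h3.subset (x := (x, t)) ⟨hi, ht⟩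

theorem isC21 (hs : IsSolutionWithGradient c ε T F₀ F Φ ψ g) (m : Option (Fin 3)) :
    IsC21 ψ (G.piece ε m) T := by
  cases m with
  | none => exact hs.regular_node
  | some i => exact hs.regular_cyl i

theorem contDiffOn_gradient (hs : IsSolutionWithGradient c ε T F₀ F Φ ψ g) (ha : c.Admissible ε)
    (m : Option (Fin 3)) {t : ℝ} (ht : t ∈ Ioo 0 T) :
    ContDiffOn ℝ 1 (fun x => g x t) (G.piece ε m) := by
  have h1 : ContDiffOn ℝ 1 (fderiv ℝ fun x => ψ x t) (G.piece ε m) :=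
    ((hs.isC21 m).space t ht).fderiv_of_isOpen (Geometry.isOpen_piece ha.pos m) (by norm_num)
  have h2 := (InnerProductSpace.toDual ℝ (E 3)).symm.contDiff.comp_contDiffOn (n := 1) h1
  refine h2.congr fun x hx => ?_
  exact (hs.hasGradient x (Geometry.piece_subset_junction ha.pos m hx) t ht).gradient.symm

theorem contDiffOn_diffusion (hs : IsSolutionWithGradient c ε T F₀ F Φ ψ g)
    (ha : c.Admissible ε) (m : Option (Fin 3)) {t : ℝ} (ht : t ∈ Ioo 0 T) :
    ContDiffOn ℝ 1 (fun x => matVec (c.diff ε m x) (g x t)) (G.piece ε m) := by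
  rw [contDiffOn_euclidean]
  intro a
  simp only [matVec_apply]
  refine ContDiffOn.sum fun b _ => (c.contDiffOn_diff ha.pos m a b).mul ?_
  exact (contDiffOn_euclidean.1 (hs.contDiffOn_gradient ha m ht)) b

/-- The equation in non-divergence form for the transport term, in all pieces. -/
theorem eq_piece (hs : IsSolutionWithGradient c ε T F₀ F Φ ψ g) (ha : c.Admissible ε)
    {m : Option (Fin 3)} {x : E 3} (hx : x ∈ G.piece ε m) {t : ℝ} (ht : t ∈ Ioo 0 T) :
    ε * divergence (fun y => matVec (c.diff ε m y) (g y t)) x = deriv (ψ x) t +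
      inner ℝ (c.vel ε m x) (g x t) + ψ x t * divergence (c.vel ε m) x - source F₀ F m x t := by
  cases m with
  | none =>
    have h1 := hs.eq_node x hx t ht
    have h2 : divergence (c.vel ε none) x = 0 := c.divergence_velNode ha.pos hx
    rw [h2]
    show ε * divergence (fun y => matVec (c.diffNode ε y) (g y t)) x = _ +
      inner ℝ (c.velNode ε x) (g x t) + _ - F₀ x t
    linarith
  | some i =>
    have h1 := hs.eq_cyl i x hx t ht
    have hg := hs.hasGradient x (Geometry.piece_subset_junction ha.pos (some i) hx) t ht
    have hv : DifferentiableAt ℝ (c.velCyl ε i) x := ((c.contDiffOn_vel ha.pos (some i)).contDiffAt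
      ((Geometry.isOpen_piece ha.pos (some i)).mem_nhds hx)).differentiableAt (by norm_num)
    rw [divergence_smul hg.differentiableAt hv, hg.hasFDerivAt.fderiv] at h1
    show ε * divergence (fun y => matVec (c.diffCyl ε i y) (g y t)) x = _ +
      inner ℝ (c.velCyl ε i x) (g x t) + _ * divergence (c.velCyl ε i) x - F i x t
    rw [InnerProductSpace.toDual_apply_apply, real_inner_comm] at h1
    linarith

end IsSolutionWithGradient

/-- The flux in the energy balance of `trunc δ ψ`, with a radial field added, which gives it a
sign at the walls. The factor `M truncD + truncK` of the radial field matches the two terms that the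
boundary condition leaves there: the data, bounded by `M`, times `truncD`, and the normal velocity
times `truncK`. -/
def energyFlux (c : Coefficients G) (ε δ C M : ℝ) (ψ : E 3 → ℝ → ℝ) (g : E 3 → ℝ → E 3)
    (m : Option (Fin 3)) (x : E 3) (t : ℝ) : E 3 :=
  (-(ε * truncD δ (ψ x t))) • matVec (c.diff ε m x) (g x t) + trunc δ (ψ x t) • c.vel ε m x +
    (C * (M * truncD δ (ψ x t) + truncK δ (ψ x t))) • radialField m x

/-- The divergence of the energy flux, computed with the differential equation. -/
def energyFluxDiv (c : Coefficients G) (ε δ C M : ℝ) (S : Option (Fin 3) → E 3 → ℝ → ℝ)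
    (ψ : E 3 → ℝ → ℝ) (g : E 3 → ℝ → E 3) (m : Option (Fin 3)) (x : E 3) (t : ℝ) : ℝ :=
  truncD δ (ψ x t) * S m x t - truncD δ (ψ x t) * deriv (ψ x) t -
    ε * truncDD δ (ψ x t) * inner ℝ (matVec (c.diff ε m x) (g x t)) (g x t) -
    truncK δ (ψ x t) * divergence (c.vel ε m) x +
    C * ((M + ψ x t) * truncDD δ (ψ x t) * inner ℝ (radialField m x) (g x t) +
      (M * truncD δ (ψ x t) + truncK δ (ψ x t)) * radialDiv m)

namespace IsSolutionWithGradient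

variable {c}

theorem contDiffOn_energyFlux (hs : IsSolutionWithGradient c ε T F₀ F Φ ψ g)
    (ha : c.Admissible ε) (hδ : 0 < δ) (m : Option (Fin 3)) {t : ℝ} (ht : t ∈ Ioo 0 T) :
    ContDiffOn ℝ 1 (fun x => energyFlux c ε δ C M ψ g m x t) (G.piece ε m) := by
  have hψ : ContDiffOn ℝ 1 (fun x => ψ x t) (G.piece ε m) :=
    ((hs.isC21 m).space t ht).of_le (by norm_num)
  have hD := (contDiff_truncD hδ).comp_contDiffOn hψ
  have hB := (contDiff_trunc hδ).comp_contDiffOn hψ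
  have hK := (contDiff_truncK hδ).comp_contDiffOn hψ
  exact (((contDiffOn_const.mul hD).neg.smul (hs.contDiffOn_diffusion ha m ht)).add
    (hB.smul (c.contDiffOn_vel ha.pos m))).add
    ((contDiffOn_const.mul ((contDiffOn_const.mul hD).add hK)).smul
      (radialField m).contDiff.contDiffOn)

theorem divergence_energyFlux (hs : IsSolutionWithGradient c ε T F₀ F Φ ψ g)
    (ha : c.Admissible ε) (hδ : 0 < δ) {m : Option (Fin 3)} {x : E 3} (hx : x ∈ G.piece ε m)
    {t : ℝ} (ht : t ∈ Ioo 0 T) :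
    divergence (fun y => energyFlux c ε δ C M ψ g m y t) x =
      energyFluxDiv c ε δ C M (source F₀ F) ψ g m x t := by
  have hg := (hs.hasGradient x (Geometry.piece_subset_junction ha.pos m hx) t ht).hasFDerivAt
  have hn := (Geometry.isOpen_piece ha.pos m).mem_nhds hx
  have hDg : DifferentiableAt ℝ (fun x => matVec (c.diff ε m x) (g x t)) x :=
    ((hs.contDiffOn_diffusion ha m ht).contDiffAt hn).differentiableAt (by norm_num)
  have hV : DifferentiableAt ℝ (c.vel ε m) x :=
    ((c.contDiffOn_vel ha.pos m).contDiffAt hn).differentiableAt (by norm_num)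
  have hD : HasFDerivAt (fun y => truncD δ (ψ y t))
      (truncDD δ (ψ x t) • InnerProductSpace.toDual ℝ (E 3) (g x t)) x :=
    HasDerivAt.comp_hasFDerivAt (h₂ := truncD δ) (f := fun y => ψ y t) x
      (hasDerivAt_truncD hδ (ψ x t)) hg
  have hB : HasFDerivAt (fun y => trunc δ (ψ y t))
      (truncD δ (ψ x t) • InnerProductSpace.toDual ℝ (E 3) (g x t)) x :=
    HasDerivAt.comp_hasFDerivAt (h₂ := trunc δ) (f := fun y => ψ y t) x
      (hasDerivAt_trunc hδ (ψ x t)) hg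
  have hK : HasFDerivAt (fun y => truncK δ (ψ y t))
      ((ψ x t * truncDD δ (ψ x t)) • InnerProductSpace.toDual ℝ (E 3) (g x t)) x :=
    HasDerivAt.comp_hasFDerivAt (h₂ := truncK δ) (f := fun y => ψ y t) x
      (hasDerivAt_truncK hδ (ψ x t)) hg
  have h1 : HasFDerivAt (fun y => -(ε * truncD δ (ψ y t))) _ x := (hD.const_mul ε).neg
  have h3 : HasFDerivAt (fun y => C * (M * truncD δ (ψ y t) + truncK δ (ψ y t))) _ x :=
    ((hD.const_mul M).add hK).const_mul C
  have hW : DifferentiableAt ℝ (radialField m) x := (radialField m).differentiableAt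
  have heq := hs.eq_piece ha hx ht
  have d1 : DifferentiableAt ℝ
      (fun y => (-(ε * truncD δ (ψ y t))) • matVec (c.diff ε m y) (g y t)) x :=
    h1.differentiableAt.smul hDg
  have d2 : DifferentiableAt ℝ (fun y => trunc δ (ψ y t) • c.vel ε m y) x :=
    hB.differentiableAt.smul hV
  have d3 : DifferentiableAt ℝ (fun y => (C * (M * truncD δ (ψ y t) + truncK δ (ψ y t))) •
      radialField m y) x := h3.differentiableAt.smul hW
  have d12 : DifferentiableAt ℝ (fun y => (-(ε * truncD δ (ψ y t))) •
      matVec (c.diff ε m y) (g y t) + trunc δ (ψ y t) • c.vel ε m y) x := d1.add d2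
  simp only [energyFlux]
  rw [divergence_add d12 d3, divergence_add d1 d2,
    divergence_smul h1.differentiableAt hDg, divergence_smul hB.differentiableAt hV,
    divergence_smul h3.differentiableAt hW, h1.fderiv, hB.fderiv, h3.fderiv,
    divergence_radialField]
  simp only [energyFluxDiv, truncK, neg_apply, smul_apply,
    add_apply, InnerProductSpace.toDual_apply_apply, smul_eq_mul]
  rw [real_inner_comm (g x t)] at heq
  rw [real_inner_comm (g x t), real_inner_comm (g x t)]
  linear_combination (-truncD δ (ψ x t)) * heq

end IsSolutionWithGradient

end ThinJunction
end

noncomputable section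

namespace ThinJunction

variable {G : Geometry} {c : Coefficients G} {ε T δ C M : ℝ} {F₀ : E 3 → ℝ → ℝ}
  {F Φ : Fin 3 → E 3 → ℝ → ℝ} {ψ : E 3 → ℝ → ℝ} {g : E 3 → ℝ → E 3}

/-! ### Continuity of the energy flux -/

theorem continuousOn_matVec {Y : Type*} [TopologicalSpace Y] {A : Y → Matrix (Fin 3) (Fin 3) ℝ}
    {v : Y → E 3} {s : Set Y} (hA : ∀ a b, ContinuousOn (fun y => A y a b) s)
    (hv : ContinuousOn v s) : ContinuousOn (fun y => matVec (A y) (v y)) s := by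
  refine (PiLp.continuous_toLp 2 _).comp_continuousOn (continuousOn_pi.2 fun a => ?_)
  have h : ContinuousOn (fun y => ∑ b, A y a b * v y b) s :=
    continuousOn_finsetSum _ fun b _ => (hA a b).mul ((continuous_coord b).comp_continuousOn hv)
  exact h

theorem continuousOn_divergence {X : E 3 → E 3} {U : Set (E 3)} (hU : IsOpen U)
    (h : ContDiffOn ℝ 1 X U) : ContinuousOn (divergence X) U := by
  refine continuousOn_finsetSum _ fun j _ => (continuous_coord j).comp_continuousOn ?_
  exact (h.continuousOn_fderiv_of_isOpen hU le_rfl).clm_apply continuousOn_const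

/-- A function which vanishes where `u ≤ δ` is continuous at the points with `u < δ`, whatever
its behaviour elsewhere. -/
theorem continuousOn_of_vanishing {Y Z : Type*} [TopologicalSpace Y] [TopologicalSpace Z] [Zero Z]
    {f : Y → Z} {u : Y → ℝ} {s A : Set Y} (hA : IsClosed A) (hu : ContinuousOn u s)
    (hf : ContinuousOn f (s \ A)) (h0 : ∀ y, u y ≤ δ → f y = 0) (hlt : ∀ y ∈ s ∩ A, u y < δ) :
    ContinuousOn f s := by
  intro y hy
  by_cases hyA : y ∈ A
  · have hev : ∀ᶠ z in 𝓝[s] y, f z = 0 := by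
      filter_upwards [(hu y hy).eventually_lt continuousWithinAt_const (hlt y ⟨hy, hyA⟩)]
        with z hz using h0 z hz.le
    exact continuousWithinAt_const.congr_of_eventuallyEq hev (h0 y (hlt y ⟨hy, hyA⟩).le)
  · refine (hf y ⟨hy, hyA⟩).mono_of_mem_nhdsWithin ?_
    exact inter_mem self_mem_nhdsWithin (mem_nhdsWithin_of_mem_nhds (hA.isOpen_compl.mem_nhds hyA))

namespace IsSolutionWithGradient

theorem continuousOn_piece (hs : IsSolutionWithGradient c ε T F₀ F Φ ψ g) (ha : c.Admissible ε)
    (m : Option (Fin 3)) :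
    ContinuousOn (fun z : E 3 × ℝ => ψ z.1 z.2) (closure (G.piece ε m) ×ˢ Icc 0 T) :=
  hs.continuous.mono (prod_mono (ha.closure_piece_subset_junction m) subset_rfl)

theorem continuousOn_gradient_piece (hs : IsSolutionWithGradient c ε T F₀ F Φ ψ g)
    (ha : c.Admissible ε) (m : Option (Fin 3)) :
    ContinuousOn (fun z : E 3 × ℝ => g z.1 z.2) (G.piece ε m ×ˢ Ioo 0 T) :=
  hs.gradient_continuous.mono (prod_mono (fun _ hx =>
    ⟨ha.closure_piece_subset_junction m (subset_closure hx), ha.notMem_ends hx⟩) subset_rfl)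

theorem continuousOn_energyFluxDiv (hs : IsSolutionWithGradient c ε T F₀ F Φ ψ g)
    (hd : IsData G ε T F₀ F Φ) (ha : c.Admissible ε) (hδ : 0 < δ) (m : Option (Fin 3)) :
    ContinuousOn (fun z : E 3 × ℝ => energyFluxDiv c ε δ C M (source F₀ F) ψ g m z.1 z.2)
      (G.piece ε m ×ˢ Ioo 0 T) := by
  have hψ : ContinuousOn (fun z : E 3 × ℝ => ψ z.1 z.2) (G.piece ε m ×ˢ Ioo 0 T) :=
    (hs.continuousOn_piece ha m).mono (prod_mono subset_closure Ioo_subset_Icc_self)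
  have hg := hs.continuousOn_gradient_piece ha m
  have hf : MapsTo (Prod.fst : E 3 × ℝ → E 3) (G.piece ε m ×ˢ Ioo 0 T) (G.piece ε m) :=
    fun z hz => hz.1
  have hS : ContinuousOn (fun z : E 3 × ℝ => source F₀ F m z.1 z.2) (G.piece ε m ×ˢ Ioo 0 T) := by
    cases m with
    | none => exact hd.F₀_bc.1
    | some i => exact (hd.F_bc i).1
  have hD := (contDiff_truncD hδ).continuous.comp_continuousOn hψ
  have hDD := (continuous_truncDD hδ).comp_continuousOn hψ
  have hK := (contDiff_truncK hδ).continuous.comp_continuousOn hψ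
  have hdv := (continuousOn_divergence (Geometry.isOpen_piece ha.pos m)
    (c.contDiffOn_vel ha.pos m)).comp continuousOn_fst hf
  have hA : ContinuousOn (fun z : E 3 × ℝ => matVec (c.diff ε m z.1) (g z.1 z.2))
      (G.piece ε m ×ˢ Ioo 0 T) := continuousOn_matVec (fun a b =>
    ((c.continuousOn_diff ha.pos m a b).mono subset_closure).comp continuousOn_fst hf) hg
  have hW := ((radialField m).continuous.comp continuous_fst).continuousOn
    (s := G.piece ε m ×ˢ Ioo (0 : ℝ) T)
  exact ((((hD.mul hS).sub (hD.mul (hs.isC21 m).time_deriv)).sub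
    ((continuousOn_const.mul hDD).mul (hA.inner hg))).sub (hK.mul hdv)).add
    (continuousOn_const.mul ((((continuousOn_const.add hψ).mul hDD).mul (hW.inner hg)).add
      (((continuousOn_const.mul hD).add hK).mul continuousOn_const)))

/-- Continuity up to the boundary of a function of the solution which is continuous away from the
ends of the cylinders and vanishes where `ψ ≤ δ`. -/
theorem continuousOn_of_vanishing {Z : Type*} [TopologicalSpace Z] [Zero Z]
    (hs : IsSolutionWithGradient c ε T F₀ F Φ ψ g) (ha : c.Admissible ε) (hδ : 0 < δ)
    (m : Option (Fin 3)) {a b : ℝ} (h1 : 0 < a) (h2 : b < T) (hT : 0 < T)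
    {f : E 3 → ℝ → Z} (h0 : ∀ x t, ψ x t ≤ δ → f x t = 0)
    (hf : ContinuousOn (fun z : E 3 × ℝ => f z.1 z.2)
      ((closure (G.piece ε m) \ G.ends ε) ×ˢ Icc a b)) :
    ContinuousOn (fun z : E 3 × ℝ => f z.1 z.2) (closure (G.piece ε m) ×ˢ Icc a b) := by
  have hI : Icc a b ⊆ Icc 0 T := Icc_subset_Icc h1.le h2.le
  refine ThinJunction.continuousOn_of_vanishing (A := G.ends ε ×ˢ univ) (δ := δ)
    (Geometry.isClosed_ends.prod isClosed_univ)
    ((hs.continuousOn_piece ha m).mono (prod_mono subset_rfl hI)) (hf.mono ?_)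
    (fun z hz => h0 _ _ hz) ?_
  · rintro z ⟨⟨hz1, hz2⟩, hz3⟩
    exact ⟨⟨hz1, fun h => hz3 ⟨h, trivial⟩⟩, hz2⟩
  · rintro z ⟨⟨hz1, hz2⟩, hz3⟩
    rw [hs.eq_zero_of_mem_ends ha hT hz3.1 (hI hz2)]
    exact hδ

theorem continuousOn_gradient_closure (hs : IsSolutionWithGradient c ε T F₀ F Φ ψ g)
    (ha : c.Admissible ε) (m : Option (Fin 3)) {a b : ℝ} (h1 : 0 < a) (h2 : b < T) :
    ContinuousOn (fun z : E 3 × ℝ => g z.1 z.2)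
      ((closure (G.piece ε m) \ G.ends ε) ×ˢ Icc a b) :=
  hs.gradient_continuous.mono (prod_mono (fun _ hx =>
    ⟨ha.closure_piece_subset_junction m hx.1, hx.2⟩) (Icc_subset_Ioo h1 h2))

theorem continuousOn_energyFlux (hs : IsSolutionWithGradient c ε T F₀ F Φ ψ g)
    (ha : c.Admissible ε) (hδ : 0 < δ) (m : Option (Fin 3)) {a b : ℝ} (h1 : 0 < a) (h2 : b < T)
    (hT : 0 < T) : ContinuousOn (fun z : E 3 × ℝ => energyFlux c ε δ C M ψ g m z.1 z.2)
      (closure (G.piece ε m) ×ˢ Icc a b) := by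
  refine hs.continuousOn_of_vanishing ha hδ m h1 h2 hT (fun x t h => ?_) ?_
  · simp [energyFlux, truncD_of_le hδ h, trunc_of_le h, truncK_of_le hδ h]
  set s := (closure (G.piece ε m) \ G.ends ε) ×ˢ Icc a b
  have hψ : ContinuousOn (fun z : E 3 × ℝ => ψ z.1 z.2) s :=
    (hs.continuousOn_piece ha m).mono (prod_mono sdiff_subset (Icc_subset_Icc h1.le h2.le))
  have hg : ContinuousOn _ s := hs.continuousOn_gradient_closure ha m h1 h2
  have hf : MapsTo (Prod.fst : E 3 × ℝ → E 3) s (closure (G.piece ε m)) := fun z hz => hz.1.1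
  have hD := (contDiff_truncD hδ).continuous.comp_continuousOn hψ
  have hB := (contDiff_trunc hδ).continuous.comp_continuousOn hψ
  have hK := (contDiff_truncK hδ).continuous.comp_continuousOn hψ
  have hV := (c.continuousOn_vel ha.pos m).comp continuousOn_fst hf
  have hA : ContinuousOn (fun z : E 3 × ℝ => matVec (c.diff ε m z.1) (g z.1 z.2)) s :=
    continuousOn_matVec (fun a b =>
      (c.continuousOn_diff ha.pos m a b).comp continuousOn_fst hf) hg
  have hW := ((radialField m).continuous.comp continuous_fst).continuousOn (s := s)
  exact (((continuousOn_const.mul hD).neg.smul hA).add (hB.smul hV)).add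
    ((continuousOn_const.mul ((continuousOn_const.mul hD).add hK)).smul hW)

theorem continuousOn_dissipation (hs : IsSolutionWithGradient c ε T F₀ F Φ ψ g)
    (ha : c.Admissible ε) (hδ : 0 < δ) (m : Option (Fin 3)) {a b : ℝ} (h1 : 0 < a) (h2 : b < T)
    (hT : 0 < T) : ContinuousOn (fun z : E 3 × ℝ => truncDD δ (ψ z.1 z.2) * ‖g z.1 z.2‖ ^ 2)
      (closure (G.piece ε m) ×ˢ Icc a b) := by
  refine hs.continuousOn_of_vanishing ha hδ m h1 h2 hT
    (f := fun x t => truncDD δ (ψ x t) * ‖g x t‖ ^ 2) (fun x t h => ?_) ?_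
  · simp [truncDD_of_le hδ h]
  have hψ := (hs.continuousOn_piece ha m).mono (prod_mono (sdiff_subset (t := G.ends ε))
    (Icc_subset_Icc h1.le h2.le))
  exact ((continuous_truncDD hδ).comp_continuousOn hψ).mul
    ((hs.continuousOn_gradient_closure ha m h1 h2).norm.pow 2)

end IsSolutionWithGradient

/-! ### The pointwise energy inequality -/

/-- The growth rate in the energy inequality. -/
def growthRate (C Cv H κ : ℝ) : ℝ := 5 / 2 + 4 * Cv + 16 * (C ^ 2 * H ^ 2 / κ) + 13 * C

/-- The constant in front of the data in the energy inequality. -/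
def dataConst (C Cv H κ : ℝ) : ℝ := 1 + 2 * Cv + 4 * (C ^ 2 * H ^ 2 / κ) + 4 * C

/-- The algebra behind the energy inequality. The terms containing the gradient, of norm `n`, are
absorbed by Young's inequality, and all others are bounded by `trunc δ s` and the data. -/
theorem energy_algebra {Cv H κ s f dv q w n dW : ℝ} (hδ : 0 < δ) (hε : 0 < ε) (hε1 : ε < 1)
    (hC : 0 ≤ C) (hκ : 0 < κ) (hM : 0 ≤ M) (hCv : 0 ≤ Cv) (hf : |f| ≤ M)
    (hdv : |dv| ≤ Cv) (hq : κ * n ^ 2 ≤ q) (hw : |w| ≤ ε * H * n)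
    (hdW : dW ≤ 2) :
    truncD δ s * f - ε * truncDD δ s * q - truncK δ s * dv +
        C * ((M + s) * truncDD δ s * w + (M * truncD δ s + truncK δ s) * dW) -
        growthRate C Cv H κ * trunc δ s ≤
      -(ε * κ / 2 * (truncDD δ s * n ^ 2)) + dataConst C Cv H κ * (M ^ 2 + δ ^ 2) := by
  have b0 := trunc_nonneg hδ s
  have d0 := truncD_nonneg hδ s
  have dd0 := truncDD_nonneg hδ s
  have dd1 := truncDD_le_one hδ s
  have k0 := truncK_nonneg hδ s
  have i1 := truncD_sq_le hδ s
  have i2 := truncK_le hδ s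
  have i3 := truncDD_mul_sq_le hδ s
  generalize trunc δ s = B at *
  generalize truncD δ s = D at *
  generalize truncDD δ s = P at *
  generalize truncK δ s = K at *
  obtain ⟨hf1, hf2⟩ := abs_le.1 hf
  obtain ⟨hdv1, hdv2⟩ := abs_le.1 hdv
  have e1 : D * f ≤ 5 / 2 * B + M ^ 2 / 2 := by
    linarith [mul_le_mul_of_nonneg_left hf2 d0, sq_nonneg (D - M)]
  have e2 : ε * κ * (P * n ^ 2) ≤ ε * P * q := by
    linarith [mul_le_mul_of_nonneg_left hq (mul_nonneg hε.le dd0)]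
  have e3 : -(K * dv) ≤ Cv * (4 * B + 2 * δ ^ 2) := by
    linarith [mul_le_mul_of_nonneg_left hdv1 k0, mul_le_mul_of_nonneg_left i2 hCv]
  have e4 : C * ((M + s) * P * w) ≤ ε * κ / 2 * (P * n ^ 2) +
      C ^ 2 * H ^ 2 / κ * (M ^ 2 + (16 * B + 4 * δ ^ 2)) := by
    have y1 : C * ((M + s) * P * w) ≤ C * (|M + s| * P * (ε * H * n)) := by
      refine mul_le_mul_of_nonneg_left ?_ hC
      calc (M + s) * P * w ≤ |(M + s) * P * w| := le_abs_self _
        _ = |M + s| * P * |w| := by rw [abs_mul, abs_mul, abs_of_nonneg dd0]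
        _ ≤ _ := by gcongr
    have y2 : C * (|M + s| * P * (ε * H * n)) ≤
        ε * P * (κ / 2 * n ^ 2 + C ^ 2 * H ^ 2 / κ * ((M + s) ^ 2 / 2)) := by
      have : C * H * |M + s| * n ≤ κ / 2 * n ^ 2 + C ^ 2 * H ^ 2 / κ * ((M + s) ^ 2 / 2) := by
        have y3 : κ / 2 * n ^ 2 + C ^ 2 * H ^ 2 / κ * ((M + s) ^ 2 / 2) - C * H * |M + s| * n =
            (κ * n - C * H * |M + s|) ^ 2 / (2 * κ) := by
          rw [← sq_abs (M + s)]
          field_simp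
          ring
        have := div_nonneg (sq_nonneg (κ * n - C * H * |M + s|)) (by positivity : 0 ≤ 2 * κ)
        linarith
      linarith [mul_le_mul_of_nonneg_left this (mul_nonneg hε.le dd0)]
    have y4 : ε * P * (C ^ 2 * H ^ 2 / κ * ((M + s) ^ 2 / 2)) ≤
        C ^ 2 * H ^ 2 / κ * (M ^ 2 + (16 * B + 4 * δ ^ 2)) := by
      have z0 : 0 ≤ C ^ 2 * H ^ 2 / κ := by positivity
      have z1 : P * ((M + s) ^ 2 / 2) ≤ M ^ 2 + (16 * B + 4 * δ ^ 2) := by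
        linarith [mul_nonneg dd0 (sq_nonneg (M - s)), mul_le_mul_of_nonneg_right dd1 (sq_nonneg M)]
      have z2 : 0 ≤ P * ((M + s) ^ 2 / 2) := by positivity
      calc ε * P * (C ^ 2 * H ^ 2 / κ * ((M + s) ^ 2 / 2)) =
            C ^ 2 * H ^ 2 / κ * (ε * (P * ((M + s) ^ 2 / 2))) := by ring
        _ ≤ C ^ 2 * H ^ 2 / κ * (1 * (M ^ 2 + (16 * B + 4 * δ ^ 2))) := by gcongr
        _ = _ := by ring
    linarith
  have e5 : C * ((M * D + K) * dW) ≤ C * (M ^ 2 + 13 * B + 4 * δ ^ 2) := by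
    refine mul_le_mul_of_nonneg_left ?_ hC
    have : (M * D + K) * dW ≤ (M * D + K) * 2 := by gcongr
    linarith [sq_nonneg (D - M)]
  have z0 : 0 ≤ C ^ 2 * H ^ 2 / κ := by positivity
  simp only [growthRate, dataConst]
  generalize C ^ 2 * H ^ 2 / κ = A at *
  linarith [mul_nonneg z0 (sq_nonneg M), mul_nonneg hC (sq_nonneg M), mul_nonneg hCv (sq_nonneg M),
    sq_nonneg M, sq_nonneg δ]

end ThinJunction
end

noncomputable section

namespace ThinJunction

variable {G : Geometry} {c : Coefficients G} {ε T δ C M Cv H κ a b : ℝ} {F₀ : E 3 → ℝ → ℝ}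
  {F Φ : Fin 3 → E 3 → ℝ → ℝ} {ψ : E 3 → ℝ → ℝ} {g : E 3 → ℝ → E 3}

/-! ### The weak energy inequality in the pieces of the junction -/

/-- The standing assumptions of the energy estimate on the time interval `[a, b]`: a solution with
data bounded by `M`, the bounds of the coefficients by constants that do not depend on `ε`, and
`ψ ≤ δ` at the time `a`, so that `trunc δ ψ` vanishes there. -/
structure EnergySetting (c : Coefficients G) (ε T : ℝ) (F₀ : E 3 → ℝ → ℝ)
    (F Φ : Fin 3 → E 3 → ℝ → ℝ) (ψ : E 3 → ℝ → ℝ) (g : E 3 → ℝ → E 3)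
    (δ C M Cv H κ a b : ℝ) : Prop where
  sol : IsSolutionWithGradient c ε T F₀ F Φ ψ g
  data : IsData G ε T F₀ F Φ
  adm : c.Admissible ε
  δ_pos : 0 < δ
  C_nonneg : 0 ≤ C
  M_nonneg : 0 ≤ M
  Cv_nonneg : 0 ≤ Cv
  κ_pos : 0 < κ
  a_pos : 0 < a
  a_le_b : a ≤ b
  b_lt : b < T
  source_le : ∀ m, ∀ x ∈ G.piece ε m, ∀ t ∈ Ioo 0 T, |source F₀ F m x t| ≤ M
  wall_le : ∀ i, ∀ x ∈ G.lateral ε i, ∀ t ∈ Ioo 0 T, |Φ i x t| ≤ M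
  divergence_le : ∀ m, ∀ x ∈ G.piece ε m, |divergence (c.vel ε m) x| ≤ Cv
  radial_le : ∀ m, ∀ x ∈ G.piece ε m, ‖radialField m x‖ ≤ ε * H
  elliptic : ∀ m, ∀ x ∈ G.piece ε m, ∀ v : E 3, κ * ‖v‖ ^ 2 ≤ inner ℝ (matVec (c.diff ε m x) v) v
  wall_bound : ∀ i, ∀ x : E 3, x i ∈ Ioo 0 (G.ℓ i) → G.wallFn ε i x = 0 →
    ε * ‖gradient (G.wallFn ε i) x‖ ≤ C * (2 * ‖xbar i x‖ ^ 2) ∧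
      |fderiv ℝ (G.wallFn ε i) x (c.velCyl ε i x)| ≤ C * (2 * ‖xbar i x‖ ^ 2)
  initial_le : ∀ x ∈ closure (G.junction ε), ψ x a ≤ δ

/-- The time average of the energy flux with an exponentially decaying weight. -/
def timeFlux (c : Coefficients G) (ε δ C M Λ a b : ℝ) (ψ : E 3 → ℝ → ℝ) (g : E 3 → ℝ → E 3)
    (m : Option (Fin 3)) (x : E 3) : E 3 :=
  ∫ t in a..b, Real.exp (-(Λ * t)) • energyFlux c ε δ C M ψ g m x t

/-- The time average of the dissipation minus the contribution `D` of the data. -/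
def timeDissipation (ε δ κ D Λ a b : ℝ) (ψ : E 3 → ℝ → ℝ) (g : E 3 → ℝ → E 3) (x : E 3) : ℝ :=
  ∫ t in a..b, (Real.exp (-(Λ * t)) * (ε * κ / 2 * (truncDD δ (ψ x t) * ‖g x t‖ ^ 2)) - D)

/-- The time average of the energy flux in the whole junction. -/
def junctionFlux (c : Coefficients G) (ε δ C M Λ a b : ℝ) (ψ : E 3 → ℝ → ℝ) (g : E 3 → ℝ → E 3)
    (x : E 3) : E 3 :=
  ∑ m, (G.piece ε m).indicator (timeFlux c ε δ C M Λ a b ψ g m) x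

/-- The time average of the dissipation in the whole junction. -/
def junctionDissipation (G : Geometry) (ε δ κ D Λ a b : ℝ) (ψ : E 3 → ℝ → ℝ)
    (g : E 3 → ℝ → E 3) (x : E 3) : ℝ :=
  (⋃ m, G.piece ε m).indicator (timeDissipation ε δ κ D Λ a b ψ g) x

namespace EnergySetting

theorem T_pos (he : EnergySetting c ε T F₀ F Φ ψ g δ C M Cv H κ a b) : 0 < T :=
  (he.a_pos.trans_le he.a_le_b).trans he.b_lt

theorem Icc_subset (he : EnergySetting c ε T F₀ F Φ ψ g δ C M Cv H κ a b) : Icc a b ⊆ Ioo 0 T :=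
  Icc_subset_Ioo he.a_pos he.b_lt

theorem continuousOn_flux (he : EnergySetting c ε T F₀ F Φ ψ g δ C M Cv H κ a b) (Λ : ℝ)
    (m : Option (Fin 3)) :
    ContinuousOn (fun z : E 3 × ℝ => Real.exp (-(Λ * z.2)) • energyFlux c ε δ C M ψ g m z.1 z.2)
      (closure (G.piece ε m) ×ˢ Icc a b) :=
  ContinuousOn.smul
    (by fun_prop : Continuous fun z : E 3 × ℝ => Real.exp (-(Λ * z.2))).continuousOn
    (he.sol.continuousOn_energyFlux he.adm he.δ_pos m he.a_pos he.b_lt he.T_pos)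

theorem continuousOn_dissipation (he : EnergySetting c ε T F₀ F Φ ψ g δ C M Cv H κ a b) (Λ D : ℝ)
    (m : Option (Fin 3)) :
    ContinuousOn (fun z : E 3 × ℝ => Real.exp (-(Λ * z.2)) *
      (ε * κ / 2 * (truncDD δ (ψ z.1 z.2) * ‖g z.1 z.2‖ ^ 2)) - D)
      (closure (G.piece ε m) ×ˢ Icc a b) :=
  (ContinuousOn.mul (by fun_prop) (continuousOn_const.mul
    (he.sol.continuousOn_dissipation he.adm he.δ_pos m he.a_pos he.b_lt he.T_pos))).sub
    continuousOn_const

theorem continuousOn_timeFlux (he : EnergySetting c ε T F₀ F Φ ψ g δ C M Cv H κ a b) (Λ : ℝ)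
    (m : Option (Fin 3)) :
    ContinuousOn (timeFlux c ε δ C M Λ a b ψ g m) (closure (G.piece ε m)) :=
  continuousOn_timeIntegral he.a_le_b (he.continuousOn_flux Λ m)

theorem continuousOn_timeDissipation (he : EnergySetting c ε T F₀ F Φ ψ g δ C M Cv H κ a b)
    (Λ D : ℝ) (m : Option (Fin 3)) :
    ContinuousOn (timeDissipation ε δ κ D Λ a b ψ g) (closure (G.piece ε m)) :=
  continuousOn_timeIntegral (f := fun x t => Real.exp (-(Λ * t)) *
    (ε * κ / 2 * (truncDD δ (ψ x t) * ‖g x t‖ ^ 2)) - D) he.a_le_b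
    (he.continuousOn_dissipation Λ D m)

theorem measurableSet_piece (he : EnergySetting c ε T F₀ F Φ ψ g δ C M Cv H κ a b)
    (m : Option (Fin 3)) : MeasurableSet (G.piece ε m) :=
  (Geometry.isOpen_piece he.adm.pos m).measurableSet

theorem isCompact_closure_piece (he : EnergySetting c ε T F₀ F Φ ψ g δ C M Cv H κ a b)
    (m : Option (Fin 3)) : IsCompact (closure (G.piece ε m)) :=
  (Geometry.isBounded_piece he.adm.pos m).isCompact_closure

theorem integrable_junctionFlux (he : EnergySetting c ε T F₀ F Φ ψ g δ C M Cv H κ a b) (Λ : ℝ) :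
    Integrable (junctionFlux c ε δ C M Λ a b ψ g) := by
  refine integrable_finsetSum _ fun m _ => ?_
  rw [integrable_indicator_iff (he.measurableSet_piece m)]
  exact ((he.continuousOn_timeFlux Λ m).integrableOn_compact
    (he.isCompact_closure_piece m)).mono_set subset_closure

theorem integrable_junctionDissipation (he : EnergySetting c ε T F₀ F Φ ψ g δ C M Cv H κ a b)
    (Λ D : ℝ) : Integrable (junctionDissipation G ε δ κ D Λ a b ψ g) := by
  show Integrable ((⋃ m, G.piece ε m).indicator (timeDissipation ε δ κ D Λ a b ψ g)) volume
  rw [integrable_indicator_iff (MeasurableSet.iUnion he.measurableSet_piece),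
    integrableOn_finite_iUnion]
  exact fun m => ((he.continuousOn_timeDissipation Λ D m).integrableOn_compact
    (he.isCompact_closure_piece m)).mono_set subset_closure

theorem junctionFlux_eq (he : EnergySetting c ε T F₀ F Φ ψ g δ C M Cv H κ a b) (Λ : ℝ)
    {m : Option (Fin 3)} {x : E 3} (hx : x ∈ G.piece ε m) :
    junctionFlux c ε δ C M Λ a b ψ g x = timeFlux c ε δ C M Λ a b ψ g m x := by
  rw [junctionFlux, Finset.sum_eq_single m, indicator_of_mem hx]
  · exact fun n _ hn => indicator_of_notMem (fun h => hn (he.adm.piece_unique h hx)) _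
  · simp

theorem junctionFlux_eq_zero (Λ : ℝ) {x : E 3} (hx : ∀ m, x ∉ G.piece ε m) :
    junctionFlux c ε δ C M Λ a b ψ g x = 0 :=
  Finset.sum_eq_zero fun m _ => indicator_of_notMem (hx m) _

theorem junctionDissipation_eq_zero {D : ℝ} (Λ : ℝ) {x : E 3} (hx : ∀ m, x ∉ G.piece ε m) :
    junctionDissipation G ε δ κ D Λ a b ψ g x = 0 :=
  indicator_of_notMem (by simpa using hx) _

/-- The energy inequality, pointwise in space and time. -/
theorem energy_le (he : EnergySetting c ε T F₀ F Φ ψ g δ C M Cv H κ a b) {m : Option (Fin 3)}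
    {x : E 3} (hx : x ∈ G.piece ε m) {t : ℝ} (ht : t ∈ Ioo 0 T) :
    Real.exp (-(growthRate C Cv H κ * t)) * (truncD δ (ψ x t) * deriv (ψ x) t) +
        -(growthRate C Cv H κ) * Real.exp (-(growthRate C Cv H κ * t)) * trunc δ (ψ x t) ≤
      -(Real.exp (-(growthRate C Cv H κ * t)) *
          energyFluxDiv c ε δ C M (source F₀ F) ψ g m x t) -
        (Real.exp (-(growthRate C Cv H κ * t)) * (ε * κ / 2 * (truncDD δ (ψ x t) * ‖g x t‖ ^ 2)) -
          dataConst C Cv H κ * (M ^ 2 + δ ^ 2)) := by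
  have hw : |inner ℝ (radialField m x) (g x t)| ≤ ε * H * ‖g x t‖ :=
    (abs_real_inner_le_norm _ _).trans
      (mul_le_mul_of_nonneg_right (he.radial_le m x hx) (norm_nonneg _))
  have h1 := energy_algebra (s := ψ x t) (dW := radialDiv m) he.δ_pos he.adm.pos he.adm.lt_one
    he.C_nonneg he.κ_pos he.M_nonneg he.Cv_nonneg (he.source_le m x hx t ht)
    (he.divergence_le m x hx) (he.elliptic m x hx (g x t)) hw (radialDiv_le m)
  have hC := he.C_nonneg
  have hCv := he.Cv_nonneg
  have hκ := he.κ_pos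
  have hb : 0 ≤ dataConst C Cv H κ * (M ^ 2 + δ ^ 2) := by
    unfold dataConst; positivity
  have hΛ : 0 ≤ growthRate C Cv H κ := by unfold growthRate; positivity
  have hexp : Real.exp (-(growthRate C Cv H κ * t)) ≤ 1 :=
    Real.exp_le_one_iff.2 (neg_nonpos.2 (mul_nonneg hΛ ht.1.le))
  have h2 := mul_le_mul_of_nonneg_left h1 (Real.exp_pos (-(growthRate C Cv H κ * t))).le
  have h3 := mul_le_mul_of_nonneg_right hexp hb
  simp only [energyFluxDiv]
  linarith

/-- The weak energy inequality in the node and in the open cylinders. -/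
theorem weakDivLE_piece (he : EnergySetting c ε T F₀ F Φ ψ g δ C M Cv H κ a b)
    (m : Option (Fin 3)) :
    WeakDivLE volume (junctionFlux c ε δ C M (growthRate C Cv H κ) a b ψ g)
      (junctionDissipation G ε δ κ (dataConst C Cv H κ * (M ^ 2 + δ ^ 2)) (growthRate C Cv H κ)
        a b ψ g) (G.piece ε m) := by
  set Λ := growthRate C Cv H κ
  set D := dataConst C Cv H κ * (M ^ 2 + δ ^ 2)
  have hsub : G.piece ε m ×ˢ Icc a b ⊆ closure (G.piece ε m) ×ˢ Icc a b :=
    prod_mono subset_closure subset_rfl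
  have hdc : ContinuousOn (fun z : E 3 × ℝ => Real.exp (-(Λ * z.2)) *
      energyFluxDiv c ε δ C M (source F₀ F) ψ g m z.1 z.2) (G.piece ε m ×ˢ Icc a b) :=
    ContinuousOn.mul (by fun_prop)
      ((he.sol.continuousOn_energyFluxDiv he.data he.adm he.δ_pos m).mono
        (prod_mono subset_rfl he.Icc_subset))
  have hdis := (he.continuousOn_dissipation Λ D m).mono hsub
  refine (WeakDivLE.of_timeIntegral (f := timeDissipation ε δ κ D Λ a b ψ g)
    (Y := fun x t => Real.exp (-(Λ * t)) • energyFlux c ε δ C M ψ g m x t)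
    (d := fun x t => Real.exp (-(Λ * t)) * energyFluxDiv c ε δ C M (source F₀ F) ψ g m x t)
    (Geometry.isOpen_piece he.adm.pos m) he.a_le_b
    ((he.continuousOn_flux Λ m).mono hsub) (fun t ht => ?_) hdc (fun t ht x hx => ?_)
    ((he.continuousOn_timeDissipation Λ D m).mono subset_closure) fun x hx => ?_).congr
    (fun x hx => (he.junctionFlux_eq Λ hx).symm)
    (fun x hx => (indicator_of_mem (mem_iUnion_of_mem m hx) _).symm)
  · exact (contDiffOn_const (c := Real.exp (-(Λ * t)))).smul
      (he.sol.contDiffOn_energyFlux he.adm he.δ_pos m (he.Icc_subset ht))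
  · have hY := ((he.sol.contDiffOn_energyFlux (C := C) (M := M) he.adm he.δ_pos m
      (he.Icc_subset ht)).contDiffAt
      ((Geometry.isOpen_piece he.adm.pos m).mem_nhds hx)).differentiableAt (by norm_num)
    rw [divergence_smul (differentiableAt_const _) hY,
      he.sol.divergence_energyFlux he.adm he.δ_pos hx (he.Icc_subset ht)]
    simp
  -- integration in time at a fixed point of the piece
  have hd : ∀ t ∈ Icc a b, HasDerivAt (fun t => Real.exp (-(Λ * t)) * trunc δ (ψ x t))
      (Real.exp (-(Λ * t)) * (truncD δ (ψ x t) * deriv (ψ x) t) +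
        -Λ * Real.exp (-(Λ * t)) * trunc δ (ψ x t)) t := by
    intro t ht
    have h1 : HasDerivAt (ψ x) (deriv (ψ x) t) t :=
      (((he.sol.isC21 m).time x hx).differentiableAt
        (isOpen_Ioo.mem_nhds (he.Icc_subset ht))).hasDerivAt
    have h2 : HasDerivAt (fun t => trunc δ (ψ x t)) (truncD δ (ψ x t) * deriv (ψ x) t) t :=
      (hasDerivAt_trunc he.δ_pos (ψ x t)).comp t h1
    have h3 : HasDerivAt (fun t => Real.exp (-(Λ * t))) (Real.exp (-(Λ * t)) * -(Λ * 1)) t :=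
      (((hasDerivAt_id t).const_mul Λ).neg).exp
    exact (h3.mul h2).congr_deriv (by ring)
  have i1 : IntervalIntegrable (fun t => Real.exp (-(Λ * t)) *
      energyFluxDiv c ε δ C M (source F₀ F) ψ g m x t) volume a b :=
    intervalIntegrable_of_continuousOn_prod (f := fun x t => Real.exp (-(Λ * t)) *
      energyFluxDiv c ε δ C M (source F₀ F) ψ g m x t) he.a_le_b hdc hx
  have i2 : IntervalIntegrable (fun t => Real.exp (-(Λ * t)) *
      (ε * κ / 2 * (truncDD δ (ψ x t) * ‖g x t‖ ^ 2)) - D) volume a b :=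
    intervalIntegrable_of_continuousOn_prod (f := fun x t => Real.exp (-(Λ * t)) *
      (ε * κ / 2 * (truncDD δ (ψ x t) * ‖g x t‖ ^ 2)) - D) he.a_le_b hdis hx
  have key := intervalIntegral.sub_le_integral_of_hasDeriv_right_of_le he.a_le_b
    (fun t ht => (hd t ht).continuousAt.continuousWithinAt)
    (fun t ht => (hd t ⟨ht.1.le, ht.2.le⟩).hasDerivWithinAt)
    ((intervalIntegrable_iff_integrableOn_Icc_of_le he.a_le_b).1 (i1.neg.sub i2))
    (fun t ht => he.energy_le hx (he.Icc_subset ⟨ht.1.le, ht.2.le⟩))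
  rw [trunc_of_le (he.initial_le x (he.adm.closure_piece_subset_junction m (subset_closure hx))),
    mul_zero, sub_zero] at key
  have h0 := mul_nonneg (Real.exp_pos (-(Λ * b))).le (trunc_nonneg he.δ_pos (ψ x b))
  have key2 := h0.trans key
  have hsplit := intervalIntegral.integral_sub i1.neg i2
  simp only [Pi.neg_apply] at hsplit
  exact sub_nonneg.1 (key2.trans_eq hsplit)

end EnergySetting

end ThinJunction
end

noncomputable section

namespace ThinJunction

variable {G : Geometry} {c : Coefficients G} {ε T δ C M Cv H κ a b : ℝ} {F₀ : E 3 → ℝ → ℝ}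
  {F Φ : Fin 3 → E 3 → ℝ → ℝ} {ψ : E 3 → ℝ → ℝ} {g : E 3 → ℝ → E 3}

/-! ### A neighbourhood of the wall of a cylinder and of the adjacent collar -/

/-- The open slab containing a collar of width `d` of the node and the `i`-th cylinder, without the
other cylinders. -/
def wallRegion (G : Geometry) (ε d : ℝ) (i : Fin 3) : Set (E 3) :=
  {x | ε * (G.ℓ₀ - d) < x i ∧ x i < G.ℓ i ∧ ∀ j, j ≠ i → x ∉ closure (G.cylinder ε j)}

/-- `d` is a width of the collars of the node, valid for all three of them. -/
structure IsCollarWidth (G : Geometry) (d : ℝ) : Prop where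
  pos : 0 < d
  lt : d < G.ℓ₀
  mem_iff : ∀ i, ∀ ξ : E 3, G.ℓ₀ - d < ξ i → (ξ ∈ G.Ξ ↔ ξ i < G.ℓ₀ ∧ ‖xbar i ξ‖ < G.h i 0)

theorem isOpen_wallRegion (G : Geometry) (ε d : ℝ) (i : Fin 3) : IsOpen (wallRegion G ε d i) := by
  have : wallRegion G ε d i = {x | ε * (G.ℓ₀ - d) < x i} ∩ ({x | x i < G.ℓ i} ∩
      ⋂ j, ⋂ (_ : j ≠ i), (closure (G.cylinder ε j))ᶜ) := by
    ext x; simp [wallRegion]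
  rw [this]
  exact (isOpen_Ioi.preimage (continuous_coord i)).inter
    ((isOpen_Iio.preimage (continuous_coord i)).inter (isOpen_iInter_of_finite fun j =>
      isOpen_iInter_of_finite fun _ => isClosed_closure.isOpen_compl))

namespace IsCollarWidth

variable {d : ℝ}

theorem coord_mem (hd : IsCollarWidth G d) (ha : c.Admissible ε) {i : Fin 3} {x : E 3}
    (hx : x ∈ wallRegion G ε d i) : x i ∈ Ioo 0 (G.ℓ i) :=
  ⟨(mul_pos ha.pos (sub_pos.2 hd.lt)).trans hx.1, hx.2.1⟩

theorem base_gt (hd : IsCollarWidth G d) (ha : c.Admissible ε) : ε * (G.ℓ₀ - d) < ε * G.ℓ₀ :=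
  mul_lt_mul_of_pos_left (by linarith [hd.pos]) ha.pos

theorem mem_wallRegion (hd : IsCollarWidth G d) (ha : c.Admissible ε) {i : Fin 3} {x : E 3}
    (h1 : ε * (G.ℓ₀ - d) < x i) (h2 : x i < G.ℓ i) (h0 : G.wallFn ε i x ≤ 0) :
    x ∈ wallRegion G ε d i := by
  have hI : 0 < x i := (mul_pos ha.pos (sub_pos.2 hd.lt)).trans h1
  have h3 : ‖xbar i x‖ ≤ ε * G.h i (x i) := by
    rw [Geometry.wallFn, sub_nonpos] at h0
    exact (sq_le_sq₀ (norm_nonneg _) (mul_pos ha.pos (G.h_pos i _ ⟨hI.le, h2.le⟩)).le).1 h0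
  refine ⟨h1, h2, fun j hj hxj => ?_⟩
  rcases le_or_gt (ε * G.ℓ₀) (x i) with h | h
  · exact disjoint_left.1 (ha.disjoint hj) hxj
      ((ha.mem_closure_cylinder_iff h2).2 ⟨h, h2.le, h3⟩)
  · -- in the collar the transversal coordinates are smaller than `ε ℓ₀`
    have h4 := (Geometry.closure_cylinder_subset ha.pos j hxj).1
    have h5 := (le_abs_self (x j)).trans (abs_coord_le_xbar hj x)
    rw [ha.h_const i _ ⟨hI.le, h.le⟩] at h3
    have h6 := mul_lt_mul_of_pos_left (G.h0_lt i) ha.pos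
    linarith

theorem piece_cases (hd : IsCollarWidth G d) (ha : c.Admissible ε) {i : Fin 3} {x : E 3}
    (hx : x ∈ wallRegion G ε d i) {m : Option (Fin 3)} (hm : x ∈ G.piece ε m) :
    G.wallFn ε i x < 0 ∧ ((m = none ∧ x i < ε * G.ℓ₀) ∨ (m = some i ∧ ε * G.ℓ₀ < x i)) := by
  cases m with
  | none =>
    have := (ha.mem_node_iff_wallFn hd.lt (hd.mem_iff i) hx.1).1 hm
    exact ⟨this.2, Or.inl ⟨rfl, this.1⟩⟩
  | some j =>
    have hji : j = i := by
      by_contra hji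
      exact hx.2.2 j hji (subset_closure hm)
    subst hji
    exact ⟨(Geometry.mem_cylinder_iff ha.pos hm.1 hx.2.1).1 hm, Or.inr ⟨rfl, hm.1⟩⟩

theorem closure_piece_cases (ha : c.Admissible ε) {i : Fin 3} {x : E 3}
    (hx : x ∈ wallRegion G ε d i) {m : Option (Fin 3)} (hm : x ∈ closure (G.piece ε m)) :
    (m = none ∧ x i ≤ ε * G.ℓ₀) ∨ (m = some i ∧ ε * G.ℓ₀ ≤ x i) := by
  cases m with
  | none => exact Or.inl ⟨rfl, Geometry.coord_le_of_mem_closure_node ha.pos hm i⟩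
  | some j =>
    have hji : j = i := by
      by_contra hji
      exact hx.2.2 j hji hm
    subst hji
    exact Or.inr ⟨rfl, (Geometry.closure_cylinder_subset ha.pos j hm).1⟩

theorem norm_xbar_le (hd : IsCollarWidth G d) (ha : c.Admissible ε) {i : Fin 3} {x : E 3}
    (hx : x ∈ wallRegion G ε d i) (h0 : G.wallFn ε i x ≤ 0) : ‖xbar i x‖ ≤ ε * G.h i (x i) := by
  have hI := hd.coord_mem ha hx
  rw [Geometry.wallFn, sub_nonpos] at h0
  exact (sq_le_sq₀ (norm_nonneg _) (mul_pos ha.pos (G.h_pos i _ ⟨hI.1.le, hI.2.le⟩)).le).1 h0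

theorem mem_closure_node (hd : IsCollarWidth G d) (ha : c.Admissible ε) {i : Fin 3} {x : E 3}
    (hx : x ∈ wallRegion G ε d i) (h0 : G.wallFn ε i x ≤ 0) (h1 : x i ≤ ε * G.ℓ₀) :
    x ∈ closure (G.piece ε none) := by
  have h3 := hd.norm_xbar_le ha hx h0
  rw [ha.h_const i _ ⟨(hd.coord_mem ha hx).1.le, h1⟩] at h3
  exact Geometry.mem_closure_node_of_collar ha.pos (hd.mem_iff i) hx.1 h1 h3

theorem mem_closure_cylinder (hd : IsCollarWidth G d) (ha : c.Admissible ε) {i : Fin 3} {x : E 3}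
    (hx : x ∈ wallRegion G ε d i) (h0 : G.wallFn ε i x ≤ 0) (h1 : ε * G.ℓ₀ ≤ x i) :
    x ∈ closure (G.piece ε (some i)) :=
  (ha.mem_closure_cylinder_iff hx.2.1).2 ⟨h1, hx.2.1.le, hd.norm_xbar_le ha hx h0⟩

end IsCollarWidth

/-! ### The weak energy inequality across the common disks -/

namespace EnergySetting

/-- The normal component of the energy flux does not jump at the common disks. -/
theorem energyFlux_disk (ha : c.Admissible ε) {i : Fin 3} {x : E 3} (hx : x ∈ G.disk ε i) (t : ℝ) :
    energyFlux c ε δ C M ψ g none x t i = energyFlux c ε δ C M ψ g (some i) x t i := by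
  have hξ := (Geometry.inv_smul_mem_nodeDisk ha.pos).2 hx
  have h1 : c.diff ε none x = c.diff ε (some i) x := by
    show c.A₀ (ε⁻¹ • x) = c.A i (ε⁻¹ • xbar i x)
    rw [c.A_match i _ hξ, xbar_smul]
  have h2 : c.vel ε none x i = c.vel ε (some i) x i := by
    show c.V₀ (ε⁻¹ • x) i = c.velCyl ε i x i
    rw [c.V₀_disk i _ hξ, Coefficients.velCyl, assemble_self, hx.1,
      ha.w_const i _ ⟨ha.base_pos.le, le_rfl⟩]
  simp [energyFlux, h1, h2, radialField_some, Geometry.radial]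

theorem timeFlux_disk (he : EnergySetting c ε T F₀ F Φ ψ g δ C M Cv H κ a b) (Λ : ℝ) {i : Fin 3}
    {x : E 3} (hx : x ∈ G.disk ε i) (h1 : x ∈ closure (G.piece ε none))
    (h2 : x ∈ closure (G.piece ε (some i))) :
    timeFlux c ε δ C M Λ a b ψ g none x i = timeFlux c ε δ C M Λ a b ψ g (some i) x i := by
  have hint : ∀ m, x ∈ closure (G.piece ε m) → timeFlux c ε δ C M Λ a b ψ g m x i =
      ∫ t in a..b, (Real.exp (-(Λ * t)) • energyFlux c ε δ C M ψ g m x t) i := fun m hm =>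
    ((EuclideanSpace.proj i : E 3 →L[ℝ] ℝ).intervalIntegral_comp_comm
      (intervalIntegrable_of_continuousOn_prod (f := fun x t =>
        Real.exp (-(Λ * t)) • energyFlux c ε δ C M ψ g m x t) he.a_le_b
        (he.continuousOn_flux Λ m) hm)).symm
  rw [hint _ h1, hint _ h2]
  refine intervalIntegral.integral_congr fun t _ => ?_
  simp [energyFlux_disk he.adm hx t]

/-- Inside the walls, a collar of the node and the adjacent cylinder form one open set, in which the
weak energy inequality holds across the common disk. -/
theorem weakDivLE_wallRegion (he : EnergySetting c ε T F₀ F Φ ψ g δ C M Cv H κ a b) {d : ℝ}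
    (hd : IsCollarWidth G d) (i : Fin 3) :
    WeakDivLE volume (junctionFlux c ε δ C M (growthRate C Cv H κ) a b ψ g)
      (junctionDissipation G ε δ κ (dataConst C Cv H κ * (M ^ 2 + δ ^ 2)) (growthRate C Cv H κ)
        a b ψ g) (wallRegion G ε d i ∩ {x | G.wallFn ε i x < 0}) := by
  set Λ := growthRate C Cv H κ
  have ha := he.adm
  set U := wallRegion G ε d i ∩ {x | G.wallFn ε i x < 0}
  have hUo : IsOpen U := by
    refine isOpen_iff_mem_nhds.2 fun x hx => ?_
    exact inter_mem ((isOpen_wallRegion G ε d i).mem_nhds hx.1)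
      ((Geometry.contDiffAt_wallFn i (hd.coord_mem ha hx.1)).continuousAt.eventually_lt_const hx.2)
  have hlo : ∀ x ∈ U, x i < ε * G.ℓ₀ → x ∈ G.piece ε none := fun x hx h =>
    (ha.mem_node_iff_wallFn hd.lt (hd.mem_iff i) hx.1.1).2 ⟨h, hx.2⟩
  have hhi : ∀ x ∈ U, ε * G.ℓ₀ < x i → x ∈ G.piece ε (some i) := fun x hx h =>
    (Geometry.mem_cylinder_iff ha.pos h hx.1.2.1).2 hx.2
  have hbase : ∀ x ∈ U, x i = ε * G.ℓ₀ → ∀ m, x ∉ G.piece ε m := fun x hx h m hm => by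
    rcases (hd.piece_cases ha hx.1 hm).2 with h' | h' <;> linarith [h'.2]
  have hle : ∀ x ∈ U, x i ≤ ε * G.ℓ₀ → x ∈ closure (G.piece ε none) := fun x hx h =>
    hd.mem_closure_node ha hx.1 (le_of_lt hx.2) h
  have hge : ∀ x ∈ U, ε * G.ℓ₀ ≤ x i → x ∈ closure (G.piece ε (some i)) := fun x hx h =>
    hd.mem_closure_cylinder ha hx.1 (le_of_lt hx.2) h
  refine WeakDivLE.of_interface (L := (EuclideanSpace.proj i : E 3 →L[ℝ] ℝ))
    (N := EuclideanSpace.single i 1) (c := ε * G.ℓ₀)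
    (Z := fun x => if x i ≤ ε * G.ℓ₀ then timeFlux c ε δ C M Λ a b ψ g none x i
      else timeFlux c ε δ C M Λ a b ψ g (some i) x i) (by simp)
    (he.integrable_junctionFlux Λ) (he.integrable_junctionDissipation Λ _) hUo ?_ ?_ ?_ ?_ ?_ ?_
  · refine ContinuousOn.if (fun x hx => ?_) ?_ ?_
    · have hxi : x i = ε * G.ℓ₀ :=
        frontier_le_subset_eq (continuous_coord i) continuous_const hx.2
      have h3 := hd.norm_xbar_le ha hx.1.1 (le_of_lt hx.1.2)
      rw [hxi, ha.h_base] at h3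
      exact he.timeFlux_disk Λ ⟨hxi, h3⟩ (hle x hx.1 hxi.le) (hge x hx.1 hxi.ge)
    · refine (continuous_coord i).comp_continuousOn
        ((he.continuousOn_timeFlux Λ none).mono fun x hx => hle x hx.1 ?_)
      exact (isClosed_le (continuous_coord i) continuous_const).closure_subset hx.2
    · refine (continuous_coord i).comp_continuousOn
        ((he.continuousOn_timeFlux Λ (some i)).mono fun x hx => hge x hx.1 ?_)
      have h2 := hx.2
      simp only [not_le] at h2
      exact closure_lt_subset_le continuous_const (continuous_coord i) h2
  · intro x hx hne
    have hne : x i ≠ ε * G.ℓ₀ := hne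
    show junctionFlux c ε δ C M Λ a b ψ g x i = _
    rcases lt_or_gt_of_ne hne with h | h
    · rw [if_pos h.le, he.junctionFlux_eq Λ (hlo x hx h)]
    · rw [if_neg h.not_ge, he.junctionFlux_eq Λ (hhi x hx h)]
  · exact fun x hx h => junctionFlux_eq_zero Λ (hbase x hx h)
  · exact fun x hx h => junctionDissipation_eq_zero Λ (hbase x hx h)
  · exact (he.weakDivLE_piece none).mono fun x hx => hlo x hx.1 hx.2
  · exact (he.weakDivLE_piece (some i)).mono fun x hx => hhi x hx.1 hx.2

/-! ### The sign of the energy flux at the boundary -/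

/-- At the surface of the node the energy flux is tangential. -/
theorem energyFlux_node (he : EnergySetting c ε T F₀ F Φ ψ g δ C M Cv H κ a b) {x : E 3}
    (hx : x ∈ frontier (G.node ε)) (hdisk : ∀ i, x ∉ G.disk ε i) {ρ : E 3 → ℝ}
    (hρ : IsDefiningFunction 1 (G.node ε) x ρ) {t : ℝ} (ht : t ∈ Icc a b) :
    fderiv ℝ ρ x (energyFlux c ε δ C M ψ g none x t) = 0 := by
  have ha := he.adm
  have hε := ha.pos
  have h1 := he.sol.flux_node x (ha.mem_nodeSurface hx hdisk) t (he.Icc_subset ht) _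
    ⟨ρ, ha.isDefiningFunction_nodeSurface le_rfl hx hdisk hρ, rfl⟩
  have hn : ‖gradient ρ x‖⁻¹ ≠ 0 := inv_ne_zero (norm_ne_zero_iff.2 hρ.grad_ne)
  rw [inner_smul_right, mul_eq_zero_iff_left hn] at h1
  have hsx : ε • ε⁻¹ • x = x := smul_inv_smul₀ hε.ne' x
  obtain ⟨h2, h3⟩ := IsDefiningFunction.comp_smul (a := ε) hε.ne' (x := ε⁻¹ • x) (k := 1)
    (Ω := G.node ε) (ρ := ρ) (by rwa [hsx]) le_rfl
  have h4 : {y : E 3 | ε • y ∈ G.node ε} = G.Ξ := by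
    ext y
    rw [mem_ofPred_eq, Geometry.mem_node hε, inv_smul_smul₀ hε.ne']
  rw [h4] at h2
  have h5 := c.V₀_wall (ε⁻¹ • x) ⟨(Geometry.mem_frontier_node hε).1 hx, by
    rw [mem_iUnion]; rintro ⟨i, hi⟩
    exact hdisk i ((Geometry.inv_smul_mem_nodeDisk hε).1 hi)⟩ _ ⟨_, h2, rfl⟩
  rw [h3, hsx, inner_smul_right, inner_smul_right, mul_eq_zero_iff_left,
    mul_eq_zero_iff_left hε.ne'] at h5
  · have h5' : inner ℝ (c.vel ε none x) (gradient ρ x) = 0 := h5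
    have h1' : inner ℝ (matVec (c.diff ε none x) (g x t)) (gradient ρ x) = 0 := h1
    rw [real_inner_comm, ← fderiv_eq_inner_gradient] at h1' h5'
    simp [energyFlux, h1', h5']
  · exact inv_ne_zero (norm_ne_zero_iff.2 (smul_ne_zero hε.ne' hρ.grad_ne))

/-- At the lateral surface of a cylinder the radial field outweighs the boundary data and the
normal component of the velocity. -/
theorem energyFlux_lateral (he : EnergySetting c ε T F₀ F Φ ψ g δ C M Cv H κ a b) {i : Fin 3}
    {x : E 3} (h1 : ε * G.ℓ₀ < x i) (h2 : x i < G.ℓ i) (h0 : G.wallFn ε i x = 0) {t : ℝ}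
    (ht : t ∈ Icc a b) :
    0 ≤ fderiv ℝ (G.wallFn ε i) x (energyFlux c ε δ C M ψ g (some i) x t) := by
  have ha := he.adm
  have hI : x i ∈ Ioo 0 (G.ℓ i) := ⟨ha.base_pos.trans h1, h2⟩
  have hlat := ha.mem_lateral h1 h2 h0
  have hdef := ha.isDefiningFunction_lateral h1 h2 h0
  have e1 := he.sol.flux_cyl i x hlat t (he.Icc_subset ht) _ ⟨_, hdef, rfl⟩
  have hn : 0 < ‖gradient (G.wallFn ε i) x‖ := norm_pos_iff.2 hdef.grad_ne
  obtain ⟨b1, b2⟩ := he.wall_bound i x hI h0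
  have hΦ := abs_le.1 (he.wall_le i x hlat t (he.Icc_subset ht))
  rw [inner_smul_right, inv_mul_eq_iff_eq_mul₀ hn.ne', real_inner_comm,
    ← fderiv_eq_inner_gradient] at e1
  have e2 := Geometry.fderiv_wallFn_radial (ε := ε) i (y := x) hI
  rw [real_inner_self_eq_norm_sq] at e2
  simp only [map_add, map_neg, map_smul, smul_eq_mul] at e1
  set L := fderiv ℝ (G.wallFn ε i) x
  have e3 : L (energyFlux c ε δ C M ψ g (some i) x t) =
      -(ε * truncD δ (ψ x t)) * L (matVec (c.diffCyl ε i x) (g x t)) +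
        trunc δ (ψ x t) * L (c.velCyl ε i x) +
        C * (M * truncD δ (ψ x t) + truncK δ (ψ x t)) * (2 * ‖xbar i x‖ ^ 2) := by
    rw [energyFlux, map_add, map_add, map_smul, map_smul, map_smul, radialField_some, e2]
    simp [Coefficients.diff, Coefficients.vel]
  have d0 := truncD_nonneg he.δ_pos (ψ x t)
  have k0 := truncK_nonneg he.δ_pos (ψ x t)
  have hM := he.M_nonneg
  have e4 : trunc δ (ψ x t) = ψ x t * truncD δ (ψ x t) - truncK δ (ψ x t) := by
    rw [truncK]; ring
  set R := 2 * ‖xbar i x‖ ^ 2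
  -- the data term
  have f1 : -(truncD δ (ψ x t) * (M * (C * R))) ≤
      truncD δ (ψ x t) * (Φ i x t * (ε * ‖gradient (G.wallFn ε i) x‖)) := by
    have : -(M * (C * R)) ≤ Φ i x t * (ε * ‖gradient (G.wallFn ε i) x‖) := by
      have q1 := mul_le_mul_of_nonneg_right hΦ.1 (mul_pos ha.pos hn).le
      have q2 := mul_le_mul_of_nonneg_left b1 hM
      linarith
    linarith [mul_le_mul_of_nonneg_left this d0]
  have f2 : truncK δ (ψ x t) * L (c.velCyl ε i x) ≤ truncK δ (ψ x t) * (C * R) :=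
    mul_le_mul_of_nonneg_left ((le_abs_self _).trans b2) k0
  have e5 : L (energyFlux c ε δ C M ψ g (some i) x t) =
      truncD δ (ψ x t) * (Φ i x t * (ε * ‖gradient (G.wallFn ε i) x‖)) -
        truncK δ (ψ x t) * L (c.velCyl ε i x) +
        C * (M * truncD δ (ψ x t) + truncK δ (ψ x t)) * R := by
    rw [e3, e4]
    linear_combination truncD δ (ψ x t) * e1
  rw [e5]
  linarith

theorem continuousWithinAt_normal (he : EnergySetting c ε T F₀ F Φ ψ g δ C M Cv H κ a b)
    {m : Option (Fin 3)} {x : E 3} (hx : x ∈ closure (G.piece ε m)) {ρ : E 3 → ℝ}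
    (hρ : ContDiffAt ℝ 1 ρ x) {t : ℝ} (ht : t ∈ Icc a b) :
    ContinuousWithinAt (fun y => fderiv ℝ ρ y (energyFlux c ε δ C M ψ g m y t))
      (closure (G.piece ε m)) x := by
  have h1 := he.sol.continuousOn_energyFlux (C := C) (M := M) he.adm he.δ_pos m he.a_pos he.b_lt
    he.T_pos
  have h2 : ContinuousOn (fun y => energyFlux c ε δ C M ψ g m y t) (closure (G.piece ε m)) :=
    h1.comp (f := fun y : E 3 => (y, t)) (by fun_prop) fun y hy => ⟨hy, ht⟩
  exact (hρ.continuousAt_fderiv (by norm_num)).continuousWithinAt.clm_apply (h2 x hx)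

/-- The energy flux points out of the junction at the walls of the cylinders and of the collars; at
the rims of the common disks this follows by continuity along the wall. -/
theorem energyFlux_wall (he : EnergySetting c ε T F₀ F Φ ψ g δ C M Cv H κ a b) {d : ℝ}
    (hd : IsCollarWidth G d) {i : Fin 3} {x : E 3} (hx : x ∈ wallRegion G ε d i)
    (h0 : G.wallFn ε i x = 0) {m : Option (Fin 3)} (hm : x ∈ closure (G.piece ε m)) {t : ℝ}
    (ht : t ∈ Icc a b) : 0 ≤ fderiv ℝ (G.wallFn ε i) x (energyFlux c ε δ C M ψ g m x t) := by
  have ha := he.adm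
  have hnode : ∀ y ∈ wallRegion G ε d i, G.wallFn ε i y = 0 → y i < ε * G.ℓ₀ →
      0 ≤ fderiv ℝ (G.wallFn ε i) y (energyFlux c ε δ C M ψ g none y t) := by
    intro y hy hy0 hyi
    have hI := hd.coord_mem ha hy
    refine (he.energyFlux_node ?_ (fun j hj => ?_) ⟨Geometry.contDiffAt_wallFn i hI, hy0,
      Geometry.gradient_wallFn_ne_zero ha.pos i hI hy0, ?_⟩ ht).ge
    · rw [(Geometry.isOpen_node ha.pos).frontier_eq]
      refine ⟨hd.mem_closure_node ha hy hy0.le hyi.le, fun hn => ?_⟩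
      linarith [((ha.mem_node_iff_wallFn hd.lt (hd.mem_iff i) hy.1).1 hn).2]
    · rcases eq_or_ne j i with rfl | hji
      · exact hyi.ne hj.1
      · have h3 := hd.norm_xbar_le ha hy hy0.le
        rw [ha.h_const i _ ⟨hI.1.le, hyi.le⟩] at h3
        have h5 := (le_abs_self (y j)).trans (abs_coord_le_xbar hji y)
        have h6 := mul_lt_mul_of_pos_left (G.h0_lt i) ha.pos
        linarith [hj.1]
    · filter_upwards [(isOpen_wallRegion G ε d i).mem_nhds hy,
        (continuous_coord i).continuousAt.eventually_lt_const hyi] with z hz hzi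
      rw [ha.mem_node_iff_wallFn hd.lt (hd.mem_iff i) hz.1]
      exact and_iff_right hzi
  have hI := hd.coord_mem ha hx
  -- the points of the wall on either side of the rim
  have hslide : ∀ᶠ s in 𝓝 (0 : ℝ), G.slide i x s ∈ wallRegion G ε d i ∧
      G.wallFn ε i (G.slide i x s) = 0 ∧ (G.slide i x s) i = x i + s := by
    filter_upwards [(Geometry.tendsto_slide hI).eventually
      ((isOpen_wallRegion G ε d i).mem_nhds hx)] with s hs
    have hsi : (G.slide i x s) i = x i + s := assemble_self _ _ _
    have hIs := hd.coord_mem ha hs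
    refine ⟨hs, ?_, hsi⟩
    rw [Geometry.wallFn_eq_zero_iff ha.pos i ⟨hIs.1.le, hIs.2.le⟩, hsi]
    rw [hsi] at hIs
    rw [Geometry.norm_xbar_slide ⟨hI.1.le, hI.2.le⟩ ⟨hIs.1.le, hIs.2.le⟩,
      (Geometry.wallFn_eq_zero_iff ha.pos i ⟨hI.1.le, hI.2.le⟩).1 h0]
    have := (G.h_pos i _ ⟨hI.1.le, hI.2.le⟩).ne'
    field_simp
  have hlim : ∀ l : Filter ℝ, l.NeBot → l ≤ 𝓝 0 →
      (∀ᶠ s in l, G.slide i x s ∈ closure (G.piece ε m) ∧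
        0 ≤ fderiv ℝ (G.wallFn ε i) (G.slide i x s)
          (energyFlux c ε δ C M ψ g m (G.slide i x s) t)) →
      0 ≤ fderiv ℝ (G.wallFn ε i) x (energyFlux c ε δ C M ψ g m x t) := by
    intro l hl hl0 hev
    have h1 := he.continuousWithinAt_normal hm (Geometry.contDiffAt_wallFn (ε := ε) i hI) ht
    have h2 : Tendsto (G.slide i x) l (𝓝[closure (G.piece ε m)] x) :=
      tendsto_nhdsWithin_iff.2 ⟨(Geometry.tendsto_slide hI).mono_left hl0,
        hev.mono fun s hs => hs.1⟩
    exact ge_of_tendsto (h1.tendsto.comp h2) (hev.mono fun s hs => hs.2)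
  rcases IsCollarWidth.closure_piece_cases ha hx hm with ⟨rfl, hxi⟩ | ⟨rfl, hxi⟩
  · refine hlim (𝓝[<] 0) inferInstance nhdsWithin_le_nhds ?_
    filter_upwards [nhdsWithin_le_nhds hslide, self_mem_nhdsWithin] with s hs hs0
    have hlt : (G.slide i x s) i < ε * G.ℓ₀ := by
      rw [hs.2.2]; linarith [show s < 0 from hs0]
    exact ⟨hd.mem_closure_node ha hs.1 hs.2.1.le hlt.le, hnode _ hs.1 hs.2.1 hlt⟩
  · refine hlim (𝓝[>] 0) inferInstance nhdsWithin_le_nhds ?_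
    filter_upwards [nhdsWithin_le_nhds hslide, self_mem_nhdsWithin] with s hs hs0
    have hlt : ε * G.ℓ₀ < (G.slide i x s) i := by
      rw [hs.2.2]; linarith [show 0 < s from hs0]
    exact ⟨hd.mem_closure_cylinder ha hs.1 hs.2.1.le hlt.le,
      he.energyFlux_lateral hlt hs.1.2.1 hs.2.1 ht⟩

end EnergySetting

end ThinJunction
end

noncomputable section

namespace ThinJunction

variable {G : Geometry} {c : Coefficients G} {ε T δ C M Cv H κ a b : ℝ} {F₀ : E 3 → ℝ → ℝ}
  {F Φ : Fin 3 → E 3 → ℝ → ℝ} {ψ : E 3 → ℝ → ℝ} {g : E 3 → ℝ → E 3}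

/-! ### The weak energy inequality up to the boundary -/

theorem mem_ends_of_coord_eq (ha : c.Admissible ε) {i : Fin 3} {x : E 3} (hx : x i = G.ℓ i)
    (hxc : x ∈ closure (G.cylinder ε i)) : x ∈ G.ends ε := by
  have h3 := (Geometry.closure_cylinder_subset ha.pos i hxc).2.2
  rw [hx] at h3
  have hh := mul_pos ha.pos (G.h_pos i (G.ℓ i) ⟨(G.ℓ_pos i).le, le_rfl⟩)
  refine mem_iUnion_of_mem i (mem_closure_of_tendsto (b := 𝓝[<] (1 : ℝ))
    (f := Geometry.squeeze i x) ?_ ?_)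
  · have := ((Geometry.continuous_squeeze i x).tendsto 1).mono_left
      (nhdsWithin_le_nhds (s := Iio 1))
    rwa [Geometry.squeeze_one] at this
  · filter_upwards [Ioo_mem_nhdsLT (show (0 : ℝ) < 1 by norm_num)] with r hr
    refine ⟨by rw [Geometry.squeeze, assemble_self]; exact hx, ?_⟩
    rw [Geometry.squeeze, xbar_assemble, norm_smul, Real.norm_of_nonneg hr.1.le]
    nlinarith [hr.1, hr.2, norm_nonneg (xbar i x)]

namespace EnergySetting

theorem fderiv_timeFlux_nonneg (he : EnergySetting c ε T F₀ F Φ ψ g δ C M Cv H κ a b) (Λ : ℝ)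
    {m : Option (Fin 3)} {x : E 3} (hx : x ∈ closure (G.piece ε m)) {ρ : E 3 → ℝ}
    (h : ∀ t ∈ Icc a b, 0 ≤ fderiv ℝ ρ x (energyFlux c ε δ C M ψ g m x t)) :
    0 ≤ fderiv ℝ ρ x (timeFlux c ε δ C M Λ a b ψ g m x) := by
  rw [timeFlux, ← (fderiv ℝ ρ x).intervalIntegral_comp_comm
    (intervalIntegrable_of_continuousOn_prod (f := fun x t =>
      Real.exp (-(Λ * t)) • energyFlux c ε δ C M ψ g m x t) he.a_le_b
      (he.continuousOn_flux Λ m) hx)]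
  refine intervalIntegral.integral_nonneg he.a_le_b fun t ht => ?_
  rw [map_smul]
  exact mul_nonneg (Real.exp_pos _).le (h t ht)

/-- The weak energy inequality near a boundary point at which the energy flux has a sign. -/
theorem exists_weakDivLE_of_boundary (he : EnergySetting c ε T F₀ F Φ ψ g δ C M Cv H κ a b)
    {f : E 3 → ℝ} (Λ : ℝ) (hfi : Integrable f) (hf0 : ∀ x, (∀ m, x ∉ G.piece ε m) → f x = 0)
    {Ω V : Set (E 3)} {y : E 3} {ρ : E 3 → ℝ} (hρ : IsDefiningFunction 1 Ω y ρ) (hV : V ∈ 𝓝 y)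
    (hneg : ∀ x ∈ V, ∀ m, x ∈ G.piece ε m → ρ x < 0)
    (hsign : ∀ x ∈ V, ρ x = 0 → ∀ m, x ∈ closure (G.piece ε m) → ∀ t ∈ Icc a b,
      0 ≤ fderiv ℝ ρ x (energyFlux c ε δ C M ψ g m x t))
    (hweak : WeakDivLE volume (junctionFlux c ε δ C M Λ a b ψ g) f (V ∩ {x | ρ x < 0})) :
    ∃ U, IsOpen U ∧ Bornology.IsBounded U ∧ y ∈ U ∧
      WeakDivLE volume (junctionFlux c ε δ C M Λ a b ψ g) f U := by
  have hW : V ∩ Metric.ball y 1 ∩ {x | ContDiffAt ℝ 1 ρ x ∧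
      ‖gradient ρ y‖ ^ 2 / 2 ≤ fderiv ℝ ρ x (gradient ρ y)} ∈ 𝓝 y :=
    inter_mem (inter_mem hV (Metric.ball_mem_nhds y one_pos))
      ((hρ.eventually_contDiffAt le_rfl).and (hρ.eventually_fderiv_ge le_rfl))
  obtain ⟨U, hUW, hUo, hyU⟩ := mem_nhds_iff.1 hW
  have hpos : 0 < ‖gradient ρ y‖ ^ 2 / 2 := by
    have := norm_pos_iff.2 hρ.grad_ne
    positivity
  have hout : ∀ x ∈ U, -ρ x ≤ 0 → ∀ m, x ∉ G.piece ε m := fun x hx h m hm => by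
    have := hneg x (hUW hx).1.1 m hm
    linarith
  have hfd : ∀ x v, fderiv ℝ (fun x => -ρ x) x v = -fderiv ℝ ρ x v := fun x v => by
    rw [fderiv_fun_neg]; rfl
  refine ⟨U, hUo, Metric.isBounded_ball.subset fun x hx => (hUW hx).1.2, hyU,
    WeakDivLE.of_boundary (r := fun x => -ρ x) (N := -gradient ρ y) (he.integrable_junctionFlux Λ)
      hfi hpos (fun x hx => (hUW hx).2.1.neg) (fun x hx => ?_)
      (fun x hx h => junctionFlux_eq_zero Λ (hout x hx h)) (fun x hx h => hf0 x (hout x hx h))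
      (fun z hz hz0 e hepos => ?_) (hweak.mono fun x hx => ⟨(hUW hx.1).1.1, ?_⟩)⟩
  · rw [hfd, map_neg, neg_neg]
    exact (hUW hx).2.2
  · have hz0 : ρ z = 0 := neg_eq_zero.1 hz0
    have hev : ∀ m, ∀ᶠ x in 𝓝 z, x ∈ G.piece ε m →
        -e ≤ fderiv ℝ ρ x (timeFlux c ε δ C M Λ a b ψ g m x) := fun m => by
      by_cases hzm : z ∈ closure (G.piece ε m)
      · have h1 := he.fderiv_timeFlux_nonneg Λ hzm (hsign z (hUW hz).1.1 hz0 m hzm)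
        have h2 : ContinuousWithinAt (fun x => fderiv ℝ ρ x (timeFlux c ε δ C M Λ a b ψ g m x))
            (closure (G.piece ε m)) z :=
          ((hUW hz).2.1.continuousAt_fderiv (by norm_num)).continuousWithinAt.clm_apply
            (he.continuousOn_timeFlux Λ m z hzm)
        have h3 := h2.eventually_const_lt (show -e < _ by linarith)
        filter_upwards [eventually_nhdsWithin_iff.1 h3] with x hx hxm
        exact (hx (subset_closure hxm)).le
      · filter_upwards [isClosed_closure.isOpen_compl.mem_nhds hzm] with x hx hxm
        exact absurd (subset_closure hxm) hx
    filter_upwards [eventually_all.2 hev] with x hx _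
    rw [hfd]
    by_cases hxm : ∃ m, x ∈ G.piece ε m
    · obtain ⟨m, hxm⟩ := hxm
      rw [he.junctionFlux_eq Λ hxm]
      linarith [hx m hxm]
    · rw [junctionFlux_eq_zero Λ (not_exists.1 hxm), map_zero, neg_zero]
      exact hepos.le
  · have h : 0 < -ρ x := hx.2
    exact neg_pos.1 h

theorem exists_weakDivLE_wall (he : EnergySetting c ε T F₀ F Φ ψ g δ C M Cv H κ a b) {d : ℝ}
    (hd : IsCollarWidth G d) {i : Fin 3} {y : E 3} (hy : y ∈ wallRegion G ε d i)
    (h0 : G.wallFn ε i y = 0) :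
    ∃ U, IsOpen U ∧ Bornology.IsBounded U ∧ y ∈ U ∧
      WeakDivLE volume (junctionFlux c ε δ C M (growthRate C Cv H κ) a b ψ g)
        (junctionDissipation G ε δ κ (dataConst C Cv H κ * (M ^ 2 + δ ^ 2))
          (growthRate C Cv H κ) a b ψ g) U := by
  have hI := hd.coord_mem he.adm hy
  exact he.exists_weakDivLE_of_boundary (growthRate C Cv H κ)
    (he.integrable_junctionDissipation _ _) (fun x hx => junctionDissipation_eq_zero _ hx)
    (Ω := {x | G.wallFn ε i x < 0}) (ρ := G.wallFn ε i)
    ⟨Geometry.contDiffAt_wallFn i hI, h0, Geometry.gradient_wallFn_ne_zero he.adm.pos i hI h0,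
      Eventually.of_forall fun _ => Iff.rfl⟩
    ((isOpen_wallRegion G ε d i).mem_nhds hy)
    (fun x hx m hm => (hd.piece_cases he.adm hx hm).1)
    (fun x hx hx0 m hm t ht => he.energyFlux_wall hd hx hx0 hm ht) (he.weakDivLE_wallRegion hd i)

theorem exists_weakDivLE_nodeSurface (he : EnergySetting c ε T F₀ F Φ ψ g δ C M Cv H κ a b)
    {y : E 3} (hy : y ∈ frontier (G.node ε)) (hdisk : ∀ i, y ∉ G.disk ε i) :
    ∃ U, IsOpen U ∧ Bornology.IsBounded U ∧ y ∈ U ∧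
      WeakDivLE volume (junctionFlux c ε δ C M (growthRate C Cv H κ) a b ψ g)
        (junctionDissipation G ε δ κ (dataConst C Cv H κ * (M ^ 2 + δ ^ 2))
          (growthRate C Cv H κ) a b ψ g) U := by
  have ha := he.adm
  obtain ⟨ρ₀, hρ₀⟩ := G.smooth_boundary (ε⁻¹ • y) ⟨(Geometry.mem_frontier_node ha.pos).1 hy, by
    rw [mem_iUnion]; rintro ⟨i, hi⟩
    exact hdisk i ((Geometry.inv_smul_mem_nodeDisk ha.pos).1 hi)⟩
  have hρ := Geometry.isDefiningFunction_node ha.pos (by norm_num) hρ₀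
  set ρ : E 3 → ℝ := fun x => ρ₀ (ε⁻¹ • x)
  have hρ1 : IsDefiningFunction 1 (G.node ε) y ρ :=
    ⟨hρ.smooth.of_le (by norm_num), hρ.zero, hρ.grad_ne, hρ.local_eq⟩
  have hcyl : ∀ j, ∀ᶠ x in 𝓝 y, x ∉ closure (G.cylinder ε j) := fun j =>
    isClosed_closure.isOpen_compl.mem_nhds
      fun hyj => hdisk j (ha.mem_disk (frontier_subset_closure hy) hyj)
  have hpos : 0 < ‖gradient ρ y‖ ^ 2 / 2 := by
    have := norm_pos_iff.2 hρ.grad_ne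
    positivity
  refine he.exists_weakDivLE_of_boundary (growthRate C Cv H κ)
    (he.integrable_junctionDissipation _ _) (fun x hx => junctionDissipation_eq_zero _ hx) hρ1
    (V := {x | (∀ j, x ∉ closure (G.cylinder ε j)) ∧ (∀ᶠ z in 𝓝 x, (z ∈ G.node ε ↔ ρ z < 0)) ∧
      ContDiffAt ℝ 1 ρ x ∧ ‖gradient ρ y‖ ^ 2 / 2 ≤ fderiv ℝ ρ x (gradient ρ y)})
    ((eventually_all.2 hcyl).and (hρ1.local_eq.eventually_nhds.and
      ((hρ1.eventually_contDiffAt le_rfl).and (hρ1.eventually_fderiv_ge le_rfl)))) ?_ ?_ ?_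
  · rintro x ⟨h1, h2, -⟩ m hm
    cases m with
    | none => exact h2.self_of_nhds.1 hm
    | some j => exact absurd (subset_closure hm) (h1 j)
  · rintro x ⟨h1, h2, h3, h4⟩ hx0 m hm t ht
    cases m with
    | some j => exact absurd hm (h1 j)
    | none =>
      refine (he.energyFlux_node ?_ (fun j hj => h1 j ?_) ⟨h3, hx0, fun hg => ?_, h2⟩ ht).ge
      · rw [(Geometry.isOpen_node ha.pos).frontier_eq]
        refine ⟨hm, fun hn => ?_⟩
        linarith [h2.self_of_nhds.1 hn]
      · refine (ha.mem_closure_cylinder_iff (hj.1.trans_lt (ha.base_lt j))).2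
          ⟨hj.1.ge, hj.1.trans_le (ha.base_lt j).le, ?_⟩
        rw [hj.1, ha.h_base]
        exact hj.2
      · rw [fderiv_eq_inner_gradient, hg, inner_zero_left] at h4
        linarith
  · exact (he.weakDivLE_piece none).mono fun x hx => hx.1.2.1.self_of_nhds.2 hx.2

/-! ### The global energy estimate -/

theorem timeFlux_eq_zero (he : EnergySetting c ε T F₀ F Φ ψ g δ C M Cv H κ a b) (Λ : ℝ)
    {m : Option (Fin 3)} {x : E 3} (hx : ∀ t ∈ Icc a b, ψ x t ≤ δ) :
    timeFlux c ε δ C M Λ a b ψ g m x = 0 := by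
  rw [timeFlux, intervalIntegral.integral_congr (g := fun _ => 0), intervalIntegral.integral_zero]
  intro t ht
  rw [uIcc_of_le he.a_le_b] at ht
  simp [energyFlux, truncD_of_le he.δ_pos (hx t ht), trunc_of_le (hx t ht),
    truncK_of_le he.δ_pos (hx t ht)]

theorem timeDissipation_nonpos (he : EnergySetting c ε T F₀ F Φ ψ g δ C M Cv H κ a b) (Λ : ℝ)
    {D : ℝ} (hD : 0 ≤ D) {x : E 3} (hx : ∀ t ∈ Icc a b, ψ x t ≤ δ) :
    timeDissipation ε δ κ D Λ a b ψ g x ≤ 0 := by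
  rw [timeDissipation, intervalIntegral.integral_congr (g := fun _ => -D)]
  · rw [intervalIntegral.integral_const, smul_eq_mul]
    nlinarith [he.a_le_b]
  · intro t ht
    rw [uIcc_of_le he.a_le_b] at ht
    simp [truncDD_of_le he.δ_pos (hx t ht)]

theorem dataConst_nonneg (he : EnergySetting c ε T F₀ F Φ ψ g δ C M Cv H κ a b) :
    0 ≤ dataConst C Cv H κ := by
  have := he.C_nonneg
  have := he.Cv_nonneg
  have := he.κ_pos
  unfold dataConst; positivity

theorem growthRate_nonneg (he : EnergySetting c ε T F₀ F Φ ψ g δ C M Cv H κ a b) :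
    0 ≤ growthRate C Cv H κ := by
  have := he.C_nonneg
  have := he.Cv_nonneg
  have := he.κ_pos
  unfold growthRate; positivity

/-- The weak energy inequality tested with the constant `1`. The set where `ψ ≥ δ` at some time is
compact and does not meet the ends of the cylinders, so that all its points are either interior or
lie on a part of the boundary where the energy flux has a sign. -/
theorem integral_junctionDissipation_nonpos
    (he : EnergySetting c ε T F₀ F Φ ψ g δ C M Cv H κ a b) :
    ∫ x, junctionDissipation G ε δ κ (dataConst C Cv H κ * (M ^ 2 + δ ^ 2)) (growthRate C Cv H κ)
      a b ψ g x ≤ 0 := by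
  have ha := he.adm
  have hD : 0 ≤ dataConst C Cv H κ * (M ^ 2 + δ ^ 2) :=
    mul_nonneg he.dataConst_nonneg (by positivity)
  obtain ⟨d, hd0, hd1, hd2⟩ := G.exists_collar
  have hd : IsCollarWidth G d := ⟨hd0, hd1, hd2⟩
  have hsub : Icc a b ⊆ Icc 0 T := Icc_subset_Icc he.a_pos.le he.b_lt.le
  have hψ : ContinuousOn (fun z : E 3 × ℝ => ψ z.1 z.2) (G.pieces ε ×ˢ Icc a b) := by
    have := he.sol.continuous
    rw [Geometry.closure_junction ha.pos] at this
    exact this.mono (prod_mono subset_rfl hsub)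
  have hcomp : IsCompact (G.pieces ε ×ˢ Icc a b) :=
    (Geometry.isCompact_pieces ha.pos).prod isCompact_Icc
  have hK : IsCompact (Prod.fst ''
      (G.pieces ε ×ˢ Icc a b ∩ (fun z : E 3 × ℝ => ψ z.1 z.2) ⁻¹' Ici δ)) :=
    (hcomp.of_isClosed_subset (hψ.preimage_isClosed_of_isClosed hcomp.isClosed isClosed_Ici)
      inter_subset_left).image continuous_fst
  set K := Prod.fst '' (G.pieces ε ×ˢ Icc a b ∩ (fun z : E 3 × ℝ => ψ z.1 z.2) ⁻¹' Ici δ)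
  have hKc : ∀ x ∉ K, ∀ m, x ∈ G.piece ε m → ∀ t ∈ Icc a b, ψ x t ≤ δ := by
    intro x hx m hm t ht
    by_contra hlt
    exact hx ⟨(x, t), ⟨⟨Geometry.closure_piece_subset m (subset_closure hm), ht⟩,
      (not_le.1 hlt).le⟩, rfl⟩
  refine integral_nonpos_of_weakDivLE hK (he.integrable_junctionFlux (growthRate C Cv H κ))
    (he.integrable_junctionDissipation _ _) (fun x hx => ?_) (fun x hx => ?_) fun x hx => ?_
  · by_cases hxm : ∃ m, x ∈ G.piece ε m
    · obtain ⟨m, hm⟩ := hxm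
      rw [he.junctionFlux_eq _ hm, he.timeFlux_eq_zero _ (hKc x hx m hm)]
    · exact junctionFlux_eq_zero _ (not_exists.1 hxm)
  · by_cases hxm : ∃ m, x ∈ G.piece ε m
    · obtain ⟨m, hm⟩ := hxm
      rw [junctionDissipation, indicator_of_mem (mem_iUnion_of_mem m hm)]
      exact he.timeDissipation_nonpos _ hD (hKc x hx m hm)
    · exact (junctionDissipation_eq_zero _ (not_exists.1 hxm)).le
  · obtain ⟨z, ⟨⟨hz1, hz2⟩, hz3⟩, rfl⟩ := hx
    have hend : ∀ i, ¬ (z.1 i = G.ℓ i ∧ z.1 ∈ closure (G.cylinder ε i)) := fun i hi => by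
      have h0 := he.sol.eq_zero_of_mem_ends ha he.T_pos (mem_ends_of_coord_eq ha hi.1 hi.2)
        (hsub hz2)
      have hz3 : δ ≤ ψ z.1 z.2 := hz3
      linarith [he.δ_pos]
    rcases ha.pieces_cases hz1 hend with h | ⟨h1, h2⟩ | ⟨i, h1, h2, h3⟩
    · exact ⟨_, Geometry.isOpen_piece ha.pos none, Geometry.isBounded_piece ha.pos none, h,
        he.weakDivLE_piece none⟩
    · exact he.exists_weakDivLE_nodeSurface h1 h2
    · have hR : z.1 ∈ wallRegion G ε d i :=
        hd.mem_wallRegion ha ((hd.base_gt ha).trans_le h1) h2 h3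
      rcases h3.lt_or_eq with h4 | h4
      · have hmem : wallRegion G ε d i ∩ {x | G.wallFn ε i x < 0} ∩ Metric.ball z.1 1 ∈ 𝓝 z.1 :=
          inter_mem (inter_mem ((isOpen_wallRegion G ε d i).mem_nhds hR)
            ((Geometry.contDiffAt_wallFn i (hd.coord_mem ha hR)).continuousAt.eventually_lt_const
              h4)) (Metric.ball_mem_nhds _ one_pos)
        obtain ⟨U, hU, hUo, hzU⟩ := mem_nhds_iff.1 hmem
        exact ⟨U, hUo, Metric.isBounded_ball.subset (hU.trans inter_subset_right), hzU,
          (he.weakDivLE_wallRegion hd i).mono (hU.trans inter_subset_left)⟩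
      · exact he.exists_weakDivLE_wall hd hR h4

end EnergySetting

end ThinJunction
end

noncomputable section

namespace ThinJunction

variable {G : Geometry} {c : Coefficients G} {ε T δ C M Cv H κ a b : ℝ} {F₀ : E 3 → ℝ → ℝ}
  {F Φ : Fin 3 → E 3 → ℝ → ℝ} {ψ : E 3 → ℝ → ℝ} {g : E 3 → ℝ → E 3}

namespace EnergySetting

theorem integrableOn_dissipation (he : EnergySetting c ε T F₀ F Φ ψ g δ C M Cv H κ a b) :
    IntegrableOn (fun z : E 3 × ℝ => truncDD δ (ψ z.1 z.2) * ‖g z.1 z.2‖ ^ 2)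
      ((⋃ m, G.piece ε m) ×ˢ Ioc a b) := by
  rw [iUnion_prod_const, integrableOn_finite_iUnion]
  intro m
  exact ((he.sol.continuousOn_dissipation he.adm he.δ_pos m he.a_pos he.b_lt
    he.T_pos).integrableOn_compact ((he.isCompact_closure_piece m).prod isCompact_Icc)).mono_set
    (prod_mono subset_closure Ioc_subset_Icc_self)

/-- The energy estimate: the truncated dissipation is bounded by the data, uniformly in `ε`, because
the volume of the junction compensates the small diffusion. -/
theorem integral_dissipation_le (he : EnergySetting c ε T F₀ F Φ ψ g δ C M Cv H κ a b) {Cvol : ℝ}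
    (hC0 : 0 ≤ Cvol) (hvol : volume (⋃ m, G.piece ε m) ≤ ENNReal.ofReal (Cvol * ε)) :
    ∫ z in (⋃ m, G.piece ε m) ×ˢ Ioc a b, truncDD δ (ψ z.1 z.2) * ‖g z.1 z.2‖ ^ 2 ≤
      2 * T * Cvol * Real.exp (growthRate C Cv H κ * T) * dataConst C Cv H κ / κ *
        (M ^ 2 + δ ^ 2) := by
  have hε := he.adm.pos
  have hκ := he.κ_pos
  have key := he.integral_junctionDissipation_nonpos
  have hΛ := he.growthRate_nonneg
  set Λ := growthRate C Cv H κ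
  set P := ⋃ m, G.piece ε m
  set D := dataConst C Cv H κ * (M ^ 2 + δ ^ 2) with hD
  have hD0 : 0 ≤ D := mul_nonneg he.dataConst_nonneg (by positivity)
  set e := Real.exp (-(Λ * T)) * (ε * κ / 2) with hedef
  have hepos : 0 < e := by positivity
  have hPm : MeasurableSet P := MeasurableSet.iUnion he.measurableSet_piece
  have hPfin : volume P ≠ ⊤ := ne_top_of_le_ne_top ENNReal.ofReal_ne_top hvol
  have hq : ∀ m, ContinuousOn (fun z : E 3 × ℝ => truncDD δ (ψ z.1 z.2) * ‖g z.1 z.2‖ ^ 2)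
      (closure (G.piece ε m) ×ˢ Icc a b) := fun m =>
    he.sol.continuousOn_dissipation he.adm he.δ_pos m he.a_pos he.b_lt he.T_pos
  have hqi : IntegrableOn (fun x => ∫ t in a..b, truncDD δ (ψ x t) * ‖g x t‖ ^ 2) P := by
    rw [integrableOn_finite_iUnion]
    exact fun m => ((continuousOn_timeIntegral (f := fun x t => truncDD δ (ψ x t) * ‖g x t‖ ^ 2)
      he.a_le_b (hq m)).integrableOn_compact (he.isCompact_closure_piece m)).mono_set subset_closure
  have hdi := he.integrable_junctionDissipation Λ D
  rw [show junctionDissipation G ε δ κ D Λ a b ψ g =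
    P.indicator (timeDissipation ε δ κ D Λ a b ψ g) from rfl] at key hdi
  rw [integral_indicator hPm] at key
  rw [integrable_indicator_iff hPm] at hdi
  have hpt : ∀ x ∈ P, e * (∫ t in a..b, truncDD δ (ψ x t) * ‖g x t‖ ^ 2) - D * (b - a) ≤
      timeDissipation ε δ κ D Λ a b ψ g x := by
    intro x hx
    obtain ⟨m, hm⟩ := mem_iUnion.1 hx
    have i1 : IntervalIntegrable (fun t => truncDD δ (ψ x t) * ‖g x t‖ ^ 2) volume a b :=
      intervalIntegrable_of_continuousOn_prod (f := fun x t => truncDD δ (ψ x t) * ‖g x t‖ ^ 2)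
        he.a_le_b (hq m) (subset_closure hm)
    have i2 : IntervalIntegrable (fun t => Real.exp (-(Λ * t)) *
        (ε * κ / 2 * (truncDD δ (ψ x t) * ‖g x t‖ ^ 2)) - D) volume a b :=
      intervalIntegrable_of_continuousOn_prod (f := fun x t => Real.exp (-(Λ * t)) *
        (ε * κ / 2 * (truncDD δ (ψ x t) * ‖g x t‖ ^ 2)) - D) he.a_le_b
        (he.continuousOn_dissipation Λ D m) (subset_closure hm)
    have e1 : e * (∫ t in a..b, truncDD δ (ψ x t) * ‖g x t‖ ^ 2) - D * (b - a) =
        ∫ t in a..b, (e * (truncDD δ (ψ x t) * ‖g x t‖ ^ 2) - D) := by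
      rw [intervalIntegral.integral_sub (i1.const_mul e) intervalIntegrable_const,
        intervalIntegral.integral_const_mul, intervalIntegral.integral_const, smul_eq_mul]
      ring
    rw [e1]
    refine intervalIntegral.integral_mono_on he.a_le_b ((i1.const_mul e).sub
      intervalIntegrable_const) i2 fun t ht => ?_
    have hdd := truncDD_nonneg he.δ_pos (ψ x t)
    have hexp : Real.exp (-(Λ * T)) ≤ Real.exp (-(Λ * t)) :=
      Real.exp_le_exp.2 (neg_le_neg (mul_le_mul_of_nonneg_left (he.Icc_subset ht).2.le hΛ))
    have : e * (truncDD δ (ψ x t) * ‖g x t‖ ^ 2) ≤ Real.exp (-(Λ * t)) *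
        (ε * κ / 2 * (truncDD δ (ψ x t) * ‖g x t‖ ^ 2)) := by
      rw [hedef, mul_assoc]
      exact mul_le_mul_of_nonneg_right hexp (by positivity)
    linarith
  have hint : e * (∫ x in P, ∫ t in a..b, truncDD δ (ψ x t) * ‖g x t‖ ^ 2) -
      volume.real P * (D * (b - a)) ≤ 0 := by
    refine le_trans (le_of_eq ?_) ((setIntegral_mono_on ((hqi.const_mul e).sub
      (integrableOn_const hPfin)) hdi hPm hpt).trans key)
    simp only [Pi.sub_apply]
    rw [integral_sub (hqi.const_mul e) (integrableOn_const hPfin), integral_const_mul,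
      setIntegral_const, smul_eq_mul]
  have hfub : ∫ z in P ×ˢ Ioc a b, truncDD δ (ψ z.1 z.2) * ‖g z.1 z.2‖ ^ 2 =
      ∫ x in P, ∫ t in a..b, truncDD δ (ψ x t) * ‖g x t‖ ^ 2 := by
    rw [Measure.volume_eq_prod, setIntegral_prod _ he.integrableOn_dissipation]
    simp only [intervalIntegral.integral_of_le he.a_le_b]
    rfl
  have hvr : volume.real P ≤ Cvol * ε :=
    ENNReal.toReal_le_of_le_ofReal (by positivity) hvol
  have hT := he.T_pos
  have h1 : volume.real P * (D * (b - a)) ≤ Cvol * ε * (D * T) := by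
    have : b - a ≤ T := by linarith [he.a_pos, he.b_lt]
    have : 0 ≤ b - a := sub_nonneg.2 he.a_le_b
    gcongr
  rw [hfub]
  have h2 : e * (2 * T * Cvol * Real.exp (Λ * T) * dataConst C Cv H κ / κ * (M ^ 2 + δ ^ 2)) =
      Cvol * ε * (D * T) := by
    rw [hedef, hD, Real.exp_neg]
    field_simp
  exact le_of_mul_le_mul_left (by rw [h2]; linarith) hepos

end EnergySetting

/-! ### Passage to the limit in the truncation -/

namespace IsSolutionWithGradient

theorem initial_closure (hs : IsSolutionWithGradient c ε T F₀ F Φ ψ g) (hT : 0 < T) {x : E 3}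
    (hx : x ∈ closure (G.junction ε)) : ψ x 0 = 0 := by
  have h1 : ContinuousOn (fun x => ψ x 0) (closure (G.junction ε)) :=
    hs.continuous.comp (f := fun x : E 3 => (x, (0 : ℝ))) (by fun_prop)
      fun y hy => ⟨hy, le_rfl, hT.le⟩
  have h2 : EqOn (fun x => ψ x 0) (fun _ => 0) (G.junction ε) := hs.initial
  exact h2.of_subset_closure h1 continuousOn_const subset_closure subset_rfl hx

/-- For a short time the solution does not exceed the truncation level. -/
theorem exists_initial_le (hs : IsSolutionWithGradient c ε T F₀ F Φ ψ g) (ha : c.Admissible ε)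
    (hT : 0 < T) (hδ : 0 < δ) : ∃ η > 0, ∀ t ∈ Icc 0 T, t < η →
      ∀ x ∈ closure (G.junction ε), ψ x t ≤ δ := by
  have hcomp : IsCompact (closure (G.junction ε) ×ˢ Icc 0 T) := by
    rw [Geometry.closure_junction ha.pos]
    exact (Geometry.isCompact_pieces ha.pos).prod isCompact_Icc
  obtain ⟨η, hη, h⟩ := Metric.uniformContinuousOn_iff.1
    (hcomp.uniformContinuousOn_of_continuous hs.continuous) δ hδ
  refine ⟨η, hη, fun t ht htη x hx => ?_⟩
  have h1 := h (x, t) ⟨hx, ht⟩ (x, 0) ⟨hx, le_rfl, hT.le⟩ (by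
    simpa [Prod.dist_eq, abs_of_nonneg ht.1] using ⟨hη, htη⟩)
  simp only [hs.initial_closure hT hx, Real.dist_eq, sub_zero] at h1
  exact ((le_abs_self _).trans h1.le)

end IsSolutionWithGradient

/-- The estimate of the gradient on the set where the solution is positive, obtained from the
estimate of the truncated dissipation with `δ = 1 / (n + 1)` by Fatou's lemma. -/
theorem exists_lintegral_pos_le (c : Coefficients G) (hT : 0 < T) : ∃ K, 0 < K ∧ ∀ ε : ℝ,
    c.Admissible ε → ∀ (F₀ : E 3 → ℝ → ℝ) (F Φ : Fin 3 → E 3 → ℝ → ℝ) (ψ : E 3 → ℝ → ℝ)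
      (g : E 3 → ℝ → E 3) (M : ℝ), 0 ≤ M → IsData G ε T F₀ F Φ →
      IsSolutionWithGradient c ε T F₀ F Φ ψ g →
      (∀ m, ∀ x ∈ G.piece ε m, ∀ t ∈ Ioo 0 T, |source F₀ F m x t| ≤ M) →
      (∀ i, ∀ x ∈ G.lateral ε i, ∀ t ∈ Ioo 0 T, |Φ i x t| ≤ M) →
      ∫⁻ z in (⋃ m, G.piece ε m) ×ˢ Ioo 0 T,
        {z : E 3 × ℝ | 0 < ψ z.1 z.2}.indicator (fun z => ENNReal.ofReal (‖g z.1 z.2‖ ^ 2)) z ≤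
        ENNReal.ofReal (K * M ^ 2) := by
  obtain ⟨H, hH0, hH⟩ := G.exists_h_le
  obtain ⟨Cvol, hCvol0, hCvol⟩ := G.exists_volume_le
  obtain ⟨Cv, hCv0, hCv⟩ := c.exists_divergence_vel_le
  obtain ⟨κ, hκ0, hκ⟩ := c.exists_ellipticity
  obtain ⟨C, hC0, hC⟩ := c.exists_wall_bound
  set K := 2 * T * Cvol * Real.exp (growthRate C Cv H κ * T) * dataConst C Cv H κ / κ with hK
  have hdc : 0 < dataConst C Cv H κ := by unfold dataConst; positivity
  refine ⟨K, by positivity, fun ε ha F₀ F Φ ψ g M hM hd hs hF hΦ => ?_⟩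
  have hε := ha.pos
  set P := ⋃ m, G.piece ε m
  have hPm : MeasurableSet P :=
    MeasurableSet.iUnion fun m => (Geometry.isOpen_piece hε m).measurableSet
  have hvol : volume P ≤ ENNReal.ofReal (Cvol * ε) := by
    refine (measure_mono (iUnion_subset fun m => ?_)).trans (hCvol ε hε ha.lt_one)
    cases m with
    | none => exact subset_union_left
    | some i => exact subset_union_of_subset_right (subset_iUnion (G.cylinder ε) i) _
  have hrad : ∀ m, ∀ x ∈ G.piece ε m, ‖radialField m x‖ ≤ ε * H := fun m x hx => by
    cases m with
    | none => rw [radialField_none, norm_zero]; positivity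
    | some i =>
      rw [radialField_some]
      refine (norm_assemble_le i _ _).trans ?_
      rw [abs_zero, zero_add]
      exact hx.2.2.le.trans (mul_le_mul_of_nonneg_left
        (hH i _ ⟨(ha.base_pos.trans hx.1).le, hx.2.1.le⟩) hε.le)
  -- for every truncation level there is a time interval close to `(0, T)`
  have hex : ∀ n : ℕ, ∃ a b : ℝ, a < T / (n + 3) ∧ T - T / (n + 3) ≤ b ∧
      EnergySetting c ε T F₀ F Φ ψ g (1 / (n + 1)) C M Cv H κ a b := by
    intro n
    have hn : (0 : ℝ) < n + 3 := by positivity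
    obtain ⟨η, hη, hini⟩ := hs.exists_initial_le ha hT (δ := 1 / ((n : ℝ) + 1)) (by positivity)
    have hq : 0 < T / (n + 3) := by positivity
    have hq3 : T / (n + 3) ≤ T / 3 := by
      apply div_le_div_of_nonneg_left hT.le (by norm_num)
      linarith [(Nat.cast_nonneg n : (0 : ℝ) ≤ n)]
    have hm : 0 < min (η / 2) (T / (n + 3) / 2) := by positivity
    have hm1 := min_le_left (η / 2) (T / ((n : ℝ) + 3) / 2)
    have hm2 := min_le_right (η / 2) (T / ((n : ℝ) + 3) / 2)
    refine ⟨min (η / 2) (T / (n + 3) / 2), T - T / (n + 3), by linarith, le_rfl, ?_⟩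
    exact ⟨hs, hd, ha, by positivity, hC0.le, hM, hCv0, hκ0, hm, by linarith, by linarith,
      hF, hΦ, hCv ε hε ha.lt_one, hrad, hκ ε hε, hC ε hε ha.lt_one,
      hini _ ⟨hm.le, by linarith⟩ (by linarith)⟩
  choose a b haT hbT he using hex
  set μ := (volume : Measure (E 3 × ℝ)).restrict (P ×ˢ Ioo 0 T)
  set u : ℕ → E 3 × ℝ → ENNReal := fun n => ((univ : Set (E 3)) ×ˢ Ioc (a n) (b n)).indicator
    fun z => ENNReal.ofReal (truncDD (1 / ((n : ℝ) + 1)) (ψ z.1 z.2) * ‖g z.1 z.2‖ ^ 2) with hu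
  have hsetm : MeasurableSet (P ×ˢ Ioo 0 T) := hPm.prod measurableSet_Ioo
  have hcψ : ContinuousOn (fun z : E 3 × ℝ => ψ z.1 z.2) (P ×ˢ Ioo 0 T) := by
    refine hs.continuous.mono (prod_mono (iUnion_subset fun m => ?_) Ioo_subset_Icc_self)
    exact subset_closure.trans (ha.closure_piece_subset_junction m)
  have hcg : ContinuousOn (fun z : E 3 × ℝ => g z.1 z.2) (P ×ˢ Ioo 0 T) := by
    refine hs.gradient_continuous.mono (prod_mono (fun x hx => ?_) subset_rfl)
    obtain ⟨m, hm⟩ := mem_iUnion.1 hx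
    exact ⟨ha.closure_piece_subset_junction m (subset_closure hm), ha.notMem_ends hm⟩
  have humeas : ∀ n, AEMeasurable (u n) μ := fun n => by
    refine AEMeasurable.indicator ?_ (MeasurableSet.univ.prod measurableSet_Ioc)
    refine ENNReal.measurable_ofReal.comp_aemeasurable (ContinuousOn.aemeasurable ?_ hsetm)
    exact ((continuous_truncDD (he n).δ_pos).comp_continuousOn hcψ).mul (hcg.norm.pow 2)
  have hule : ∀ n, ∫⁻ z, u n z ∂μ ≤
      ENNReal.ofReal (K * (M ^ 2 + (1 / ((n : ℝ) + 1)) ^ 2)) := fun n => by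
    have hset : (univ : Set (E 3)) ×ˢ Ioc (a n) (b n) ∩ P ×ˢ Ioo 0 T = P ×ˢ Ioc (a n) (b n) := by
      rw [prod_inter_prod, univ_inter, inter_eq_left.2]
      exact Ioc_subset_Icc_self.trans (he n).Icc_subset
    rw [hu, lintegral_indicator (MeasurableSet.univ.prod measurableSet_Ioc),
      Measure.restrict_restrict (MeasurableSet.univ.prod measurableSet_Ioc), hset,
      ← ofReal_integral_eq_lintegral_ofReal (he n).integrableOn_dissipation
        (ae_of_all _ fun z => mul_nonneg (truncDD_nonneg (he n).δ_pos _) (by positivity))]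
    exact ENNReal.ofReal_le_ofReal ((he n).integral_dissipation_le hCvol0.le hvol)
  have hδ : Tendsto (fun n : ℕ => 1 / ((n : ℝ) + 1)) atTop (𝓝 0) :=
    tendsto_one_div_add_atTop_nhds_zero_nat
  have hT0 : Tendsto (fun n : ℕ => T / ((n : ℝ) + 3)) atTop (𝓝 0) :=
    tendsto_const_nhds.div_atTop
      (tendsto_atTop_add_const_right _ _ tendsto_natCast_atTop_atTop)
  have hlim : ∀ z ∈ P ×ˢ Ioo 0 T,
      {z : E 3 × ℝ | 0 < ψ z.1 z.2}.indicator (fun z => ENNReal.ofReal (‖g z.1 z.2‖ ^ 2)) z ≤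
        liminf (fun n => u n z) atTop := by
    intro z hz
    by_cases hpos : z ∈ {z : E 3 × ℝ | 0 < ψ z.1 z.2}
    · rw [indicator_of_mem hpos]
      have h1 : Tendsto (fun n : ℕ => truncDD (1 / ((n : ℝ) + 1)) (ψ z.1 z.2)) atTop (𝓝 1) :=
        (tendsto_truncDD hpos).comp (tendsto_nhdsWithin_iff.2
          ⟨hδ, Eventually.of_forall fun n => (he n).δ_pos⟩)
      have h2 : Tendsto (fun n : ℕ => ENNReal.ofReal
          (truncDD (1 / ((n : ℝ) + 1)) (ψ z.1 z.2) * ‖g z.1 z.2‖ ^ 2)) atTop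
          (𝓝 (ENNReal.ofReal (‖g z.1 z.2‖ ^ 2))) := by
        have := ENNReal.tendsto_ofReal (h1.mul_const (‖g z.1 z.2‖ ^ 2))
        rwa [one_mul] at this
      have h3 : Tendsto (fun n => u n z) atTop (𝓝 (ENNReal.ofReal (‖g z.1 z.2‖ ^ 2))) := by
        refine h2.congr' ?_
        filter_upwards [hT0.eventually_lt_const hz.2.1,
          hT0.eventually_lt_const (sub_pos.2 hz.2.2)] with n hn1 hn2
        have hzm : z ∈ (univ : Set (E 3)) ×ˢ Ioc (a n) (b n) :=
          ⟨trivial, (haT n).trans hn1, by linarith [hbT n]⟩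
        have hun : u n z = ENNReal.ofReal
          (truncDD (1 / ((n : ℝ) + 1)) (ψ z.1 z.2) * ‖g z.1 z.2‖ ^ 2) := indicator_of_mem hzm _
        exact hun.symm
      exact h3.liminf_eq.ge
    · rw [indicator_of_notMem hpos]
      exact zero_le
  calc _ ≤ ∫⁻ z in P ×ˢ Ioo 0 T, liminf (fun n => u n z) atTop :=
        setLIntegral_mono' hsetm hlim
    _ ≤ liminf (fun n => ∫⁻ z, u n z ∂μ) atTop := lintegral_liminf_le' humeas
    _ ≤ liminf (fun n : ℕ => ENNReal.ofReal (K * (M ^ 2 + (1 / ((n : ℝ) + 1)) ^ 2))) atTop :=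
        liminf_le_liminf (Eventually.of_forall hule)
    _ = ENNReal.ofReal (K * M ^ 2) := by
        refine Tendsto.liminf_eq (ENNReal.tendsto_ofReal ?_)
        have := ((hδ.pow 2).const_add (M ^ 2)).const_mul K
        simpa using this

end ThinJunction
end

noncomputable section

namespace ThinJunction

variable {G : Geometry} {c : Coefficients G} {ε T : ℝ} {F₀ : E 3 → ℝ → ℝ}
  {F Φ : Fin 3 → E 3 → ℝ → ℝ} {ψ : E 3 → ℝ → ℝ} {g : E 3 → ℝ → E 3}

/-! ### The zero set of the solution -/

/-- The derivative of a function vanishes almost everywhere on the zero set of the function: there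
the function is approximated with constant zero by the zero map, in the sense of
`ApproximatesLinearOn`, an estimate that carries over to the derivative almost everywhere. -/
theorem ae_fderiv_eq_zero_of_eq_zero {u : E 3 → ℝ} {s : Set (E 3)} (hs : MeasurableSet s)
    (hu : ∀ x ∈ s, DifferentiableAt ℝ u x) (h0 : ∀ x ∈ s, u x = 0) :
    ∀ᵐ x ∂volume.restrict s, fderiv ℝ u x = 0 := by
  -- the result on `ApproximatesLinearOn` is about maps of the space into itself
  set e : E 3 := EuclideanSpace.single 0 1
  have happ : ApproximatesLinearOn (fun x => u x • e) (0 : E 3 →L[ℝ] E 3) s 0 := by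
    intro x hx y hy
    simp [h0 x hx, h0 y hy]
  have := happ.norm_fderiv_sub_le volume hs (fun x => (fderiv ℝ u x).smulRight e) fun x hx =>
    ((hu x hx).hasFDerivAt.smul_const e).hasFDerivWithinAt
  filter_upwards [this] with x hx
  have h1 : fderiv ℝ u x = 0 ∨ e = 0 := by simpa using hx
  exact h1.resolve_right (by simp [e])

theorem volume_coord_eq (i : Fin 3) (r : ℝ) : volume {x : E 3 | x i = r} = 0 := by
  have hm : MeasurableSet {x : E 3 | x i = r} :=
    (isClosed_singleton.preimage (continuous_coord i)).measurableSet
  have hd : ∀ x : E 3, HasFDerivAt (fun x : E 3 => x i - r)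
      (EuclideanSpace.proj i : E 3 →L[ℝ] ℝ) x := fun x =>
    (EuclideanSpace.proj i : E 3 →L[ℝ] ℝ).hasFDerivAt.sub_const r
  have h := ae_fderiv_eq_zero_of_eq_zero (u := fun x : E 3 => x i - r) hm
    (fun x _ => (hd x).differentiableAt) (fun x hx => sub_eq_zero.2 hx)
  have hne : ∀ x : E 3, fderiv ℝ (fun x : E 3 => x i - r) x ≠ 0 := fun x h0 => by
    rw [(hd x).fderiv] at h0
    have := congrArg (fun L : E 3 →L[ℝ] ℝ => L (EuclideanSpace.single i 1)) h0
    simp at this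
  rw [ae_iff] at h
  simpa [hne] using h

namespace IsSolutionWithGradient

/-- The gradient vanishes almost everywhere on the zero set of the solution. -/
theorem ae_gradient_eq_zero (hs : IsSolutionWithGradient c ε T F₀ F Φ ψ g) (ha : c.Admissible ε) :
    ∀ᵐ z ∂(volume : Measure (E 3 × ℝ)).restrict ((⋃ m, G.piece ε m) ×ˢ Ioo 0 T),
      ψ z.1 z.2 = 0 → g z.1 z.2 = 0 := by
  set P := ⋃ m, G.piece ε m
  have hPo : IsOpen P := isOpen_iUnion fun m => Geometry.isOpen_piece ha.pos m
  have hPJ : P ⊆ G.junction ε := iUnion_subset fun m => Geometry.piece_subset_junction ha.pos m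
  have hSo : IsOpen (P ×ˢ Ioo (0 : ℝ) T) := hPo.prod isOpen_Ioo
  have hcψ : ContinuousOn (fun z : E 3 × ℝ => ψ z.1 z.2) (P ×ˢ Ioo 0 T) :=
    hs.continuous.mono (prod_mono (hPJ.trans subset_closure) Ioo_subset_Icc_self)
  have hcg : ContinuousOn (fun z : E 3 × ℝ => g z.1 z.2) (P ×ˢ Ioo 0 T) := by
    refine hs.gradient_continuous.mono (prod_mono (fun x hx => ?_) subset_rfl)
    obtain ⟨m, hm⟩ := mem_iUnion.1 hx
    exact ⟨ha.closure_piece_subset_junction m (subset_closure hm), ha.notMem_ends hm⟩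
  have ho1 := hcg.isOpen_inter_preimage hSo (isOpen_compl_singleton (x := (0 : E 3)))
  have ho2 := hcψ.isOpen_inter_preimage hSo (isOpen_compl_singleton (x := (0 : ℝ)))
  set O₁ := P ×ˢ Ioo 0 T ∩ (fun z : E 3 × ℝ => g z.1 z.2) ⁻¹' {0}ᶜ
  set O₂ := P ×ˢ Ioo 0 T ∩ (fun z : E 3 × ℝ => ψ z.1 z.2) ⁻¹' {0}ᶜ
  -- the points with `ψ = 0` and `g ≠ 0` form a null set in every time slice
  have hN : volume (O₁ \ O₂) = 0 := by
    rw [Measure.volume_eq_prod, Measure.prod_apply_symm (ho1.measurableSet.diff ho2.measurableSet)]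
    refine lintegral_eq_zero_of_ae_eq_zero (ae_of_all _ fun t => ?_)
    by_cases ht : t ∈ Ioo 0 T
    · have hct : ContinuousOn (fun x => ψ x t) P :=
        hcψ.comp (f := fun x : E 3 => (x, t)) (by fun_prop) fun x hx => ⟨hx, ht⟩
      have hsm : MeasurableSet (P \ (P ∩ (fun x => ψ x t) ⁻¹' {0}ᶜ)) :=
        hPo.measurableSet.diff
          (hct.isOpen_inter_preimage hPo isOpen_compl_singleton).measurableSet
      set s := P \ (P ∩ (fun x => ψ x t) ⁻¹' {0}ᶜ)
      have hgr : ∀ x ∈ s, HasGradientAt (fun y => ψ y t) (g x t) x := fun x hx =>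
        hs.hasGradient x (hPJ hx.1) t ht
      have h0 : ∀ x ∈ s, ψ x t = 0 := fun x hx => by
        by_contra hne
        exact hx.2 ⟨hx.1, hne⟩
      have h1 := ae_fderiv_eq_zero_of_eq_zero hsm (fun x hx => (hgr x hx).differentiableAt) h0
      rw [ae_restrict_iff' hsm, ae_iff] at h1
      refine measure_mono_null (fun x hx => ?_) h1
      obtain ⟨⟨hx1, hx2⟩, hx3⟩ := hx
      have hxs : x ∈ s := ⟨hx1.1, fun h => hx3 ⟨hx1, h.2⟩⟩
      refine fun himp => hx2 ?_
      have h2 := himp hxs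
      rw [(hgr x hxs).hasFDerivAt.fderiv] at h2
      simpa using h2
    · refine measure_mono_null (fun x hx => ?_) measure_empty
      exact ht hx.1.1.2
  rw [ae_restrict_iff' hSo.measurableSet, ae_iff]
  refine measure_mono_null (fun z hz => ?_) hN
  simp only [mem_ofPred_eq, Classical.not_imp] at hz
  exact ⟨⟨hz.1, hz.2.2⟩, fun h => h.2 hz.2.1⟩

end IsSolutionWithGradient

/-! ### Change of sign -/

theorem matVec_neg (A : Matrix (Fin 3) (Fin 3) ℝ) (v : E 3) : matVec A (-v) = -matVec A v := by
  ext m; simp [matVec_apply]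

theorem divergence_neg (X : E 3 → E 3) (x : E 3) :
    divergence (fun y => -X y) x = -divergence X x := by
  simp [divergence, fderiv_fun_neg]

theorem IsBoundedContinuous.neg {f : E 3 → ℝ → ℝ} {S : Set (E 3)} (h : IsBoundedContinuous f S T) :
    IsBoundedContinuous (fun x t => -f x t) S T := by
  obtain ⟨h1, M, h2⟩ := h
  exact ⟨h1.neg, M, fun x hx t ht => by rw [abs_neg]; exact h2 x hx t ht⟩

theorem IsData.neg (h : IsData G ε T F₀ F Φ) :
    IsData G ε T (fun x t => -F₀ x t) (fun i x t => -F i x t) (fun i x t => -Φ i x t) where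
  F₀_bc := h.F₀_bc.neg
  F_bc i := (h.F_bc i).neg
  Φ_bc i := (h.Φ_bc i).neg
  Φ_support i := by
    obtain ⟨a, b, ha, hb, h0⟩ := h.Φ_support i
    exact ⟨a, b, ha, hb, fun x hx t ht hxi => by rw [h0 x hx t ht hxi, neg_zero]⟩

theorem IsC21.neg {P : Set (E 3)} (h : IsC21 ψ P T) : IsC21 (fun x t => -ψ x t) P T where
  space t ht := (h.space t ht).neg
  hessian := by
    have h1 : ∀ t : ℝ, (gradient fun x => -ψ x t) = fun x => -(gradient (fun x => ψ x t) x) :=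
      fun t => by
        ext1 x
        rw [gradient, gradient, fderiv_fun_neg, map_neg]
    simp only [h1, fderiv_fun_neg]
    exact h.hessian.neg
  time x hx := (h.time x hx).neg
  time_deriv := by
    have h1 : ∀ x t, deriv (fun t => -ψ x t) t = -deriv (ψ x) t := fun x t => deriv.fun_neg
    simp only [h1]
    exact h.time_deriv.neg

theorem IsSolutionWithGradient.neg (hs : IsSolutionWithGradient c ε T F₀ F Φ ψ g) :
    IsSolutionWithGradient c ε T (fun x t => -F₀ x t) (fun i x t => -F i x t)
      (fun i x t => -Φ i x t) (fun x t => -ψ x t) (fun x t => -g x t) where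
  continuous := hs.continuous.neg
  hasGradient x hx t ht := by
    rw [hasGradientAt_iff_hasFDerivAt, map_neg]
    exact (hs.hasGradient x hx t ht).hasFDerivAt.neg
  gradient_continuous := hs.gradient_continuous.neg
  regular_node := hs.regular_node.neg
  regular_cyl i := (hs.regular_cyl i).neg
  eq_cyl i x hx t ht := by
    rw [← hs.eq_cyl i x hx t ht, deriv.fun_neg]
    simp only [matVec_neg, neg_smul, divergence_neg]
    ring
  flux_cyl i x hx t ht ν hν := by
    have := hs.flux_cyl i x hx t ht ν hν
    rw [mul_neg, ← this, matVec_neg, ← inner_neg_left]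
    congr 1
    simp only [smul_neg, neg_smul]
    abel
  eq_node x hx t ht := by
    rw [← hs.eq_node x hx t ht, deriv.fun_neg]
    simp only [matVec_neg, divergence_neg, inner_neg_right]
    ring
  flux_node x hx t ht ν hν := by
    rw [matVec_neg, inner_neg_left, hs.flux_node x hx t ht ν hν, neg_zero]
  dirichlet i x hx t ht := by rw [hs.dirichlet i x hx t ht, neg_zero]
  initial x hx := by rw [hs.initial x hx, neg_zero]

/-! ### The estimate of the gradient -/

theorem supAbs_nonneg (f : E 3 → ℝ → ℝ) (S : Set (E 3)) (T : ℝ) : 0 ≤ supAbs f S T :=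
  Real.sSup_nonneg (by rintro _ ⟨z, -, rfl⟩; exact abs_nonneg _)

theorem IsBoundedContinuous.abs_le_supAbs {f : E 3 → ℝ → ℝ} {S : Set (E 3)}
    (h : IsBoundedContinuous f S T) {x : E 3} (hx : x ∈ S) {t : ℝ} (ht : t ∈ Ioo 0 T) :
    |f x t| ≤ supAbs f S T := by
  obtain ⟨-, M, hM⟩ := h
  exact le_csSup ⟨M, by rintro _ ⟨z, hz, rfl⟩; exact hM z.1 hz.1 z.2 hz.2⟩ ⟨(x, t), ⟨hx, ht⟩, rfl⟩

end ThinJunction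
end

open ThinJunction in
theorem mainTheorem3 (G : Geometry) (c : Coefficients G) (T : ℝ) (hT : 0 < T) :
    (∀ᶠ ε in 𝓝[>] (0 : ℝ), c.Admissible ε) ∧
    ∃ C₂ : ℝ, 0 < C₂ ∧ ∀ ε : ℝ, c.Admissible ε →
      ∀ (F₀ : E 3 → ℝ → ℝ) (F Φ : Fin 3 → E 3 → ℝ → ℝ) (ψ : E 3 → ℝ → ℝ),
        IsData G ε T F₀ F Φ → IsClassicalSolution c ε T F₀ F Φ ψ →
        eLpNorm (fun z : E 3 × ℝ => gradient (fun x => ψ x z.2) z.1) 2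
            (volume.restrict (G.junction ε ×ˢ Ioo 0 T)) ≤
          ENNReal.ofReal (C₂ * (supAbs F₀ (G.node ε) T
            + ∑ i, supAbs (F i) (G.cylinder ε i) T
            + ∑ i, supAbs (Φ i) (G.lateral ε i) T)) := by
  refine ⟨c.eventually_admissible, ?_⟩
  obtain ⟨K, hK0, hK⟩ := exists_lintegral_pos_le c hT
  refine ⟨Real.sqrt (2 * K), by positivity, fun ε ha F₀ F Φ ψ hd ⟨g, hs⟩ => ?_⟩
  set M := supAbs F₀ (G.node ε) T + ∑ i, supAbs (F i) (G.cylinder ε i) T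
    + ∑ i, supAbs (Φ i) (G.lateral ε i) T with hM
  have hM1 : 0 ≤ supAbs F₀ (G.node ε) T := supAbs_nonneg _ _ _
  have hM2 : 0 ≤ ∑ i, supAbs (F i) (G.cylinder ε i) T :=
    Finset.sum_nonneg fun i _ => supAbs_nonneg _ _ _
  have hM3 : 0 ≤ ∑ i, supAbs (Φ i) (G.lateral ε i) T :=
    Finset.sum_nonneg fun i _ => supAbs_nonneg _ _ _
  have hM0 : 0 ≤ M := by positivity
  have hF : ∀ m, ∀ x ∈ G.piece ε m, ∀ t ∈ Ioo 0 T, |source F₀ F m x t| ≤ M := by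
    intro m x hx t ht
    cases m with
    | none => exact (hd.F₀_bc.abs_le_supAbs hx ht).trans (by linarith)
    | some i =>
      have h1 := (hd.F_bc i).abs_le_supAbs hx ht
      have h2 := Finset.single_le_sum (f := fun i => supAbs (F i) (G.cylinder ε i) T)
        (fun i _ => supAbs_nonneg _ _ _) (Finset.mem_univ i)
      exact h1.trans (h2.trans (by linarith))
  have hΦ : ∀ i, ∀ x ∈ G.lateral ε i, ∀ t ∈ Ioo 0 T, |Φ i x t| ≤ M := by
    intro i x hx t ht
    have h1 := (hd.Φ_bc i).abs_le_supAbs hx ht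
    have h2 := Finset.single_le_sum (f := fun i => supAbs (Φ i) (G.lateral ε i) T)
      (fun i _ => supAbs_nonneg _ _ _) (Finset.mem_univ i)
    exact h1.trans (h2.trans (by linarith))
  have hpos := hK ε ha F₀ F Φ ψ g M hM0 hd hs hF hΦ
  -- on the set where the solution is negative the estimate is that of `-ψ`
  have hneg := hK ε ha _ _ _ _ _ M hM0 hd.neg hs.neg
    (fun m x hx t ht => by
      have : source (fun x t => -F₀ x t) (fun i x t => -F i x t) m x t = -source F₀ F m x t := by
        cases m <;> rfl
      rw [this, abs_neg]
      exact hF m x hx t ht)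
    (fun i x hx t ht => by rw [abs_neg]; exact hΦ i x hx t ht)
  set P := ⋃ m, G.piece ε m
  have hPJ : P ⊆ G.junction ε := iUnion_subset fun m => Geometry.piece_subset_junction ha.pos m
  have hPo : IsOpen P := isOpen_iUnion fun m => Geometry.isOpen_piece ha.pos m
  -- the pieces fill the junction up to a null set
  have hae : (G.junction ε ×ˢ Ioo 0 T : Set (E 3 × ℝ)) =ᵐ[volume] P ×ˢ Ioo 0 T := by
    rw [ae_eq_set]
    constructor
    · refine measure_mono_null (t := ⋃ i : Fin 3, {x : E 3 | x i = ε * G.ℓ₀} ×ˢ (univ : Set ℝ)) ?_ ?_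
      · rintro z ⟨hz1, hz2⟩
        rcases ha.junction_subset hz1.1 with h | ⟨i, hi⟩
        · refine absurd ⟨?_, hz1.2⟩ hz2
          rcases h with h | h
          · exact mem_iUnion_of_mem none h
          · obtain ⟨i, hi⟩ := mem_iUnion.1 h
            exact mem_iUnion_of_mem (some i) hi
        · exact mem_iUnion_of_mem i ⟨hi, trivial⟩
      · refine measure_iUnion_null fun i => ?_
        rw [Measure.volume_eq_prod, Measure.prod_prod, volume_coord_eq, zero_mul]
    · rw [sdiff_eq_empty.2 (prod_mono hPJ subset_rfl), measure_empty]
  have hcψ : ContinuousOn (fun z : E 3 × ℝ => ψ z.1 z.2) (P ×ˢ Ioo 0 T) :=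
    hs.continuous.mono (prod_mono (hPJ.trans subset_closure) Ioo_subset_Icc_self)
  have hcg : ContinuousOn (fun z : E 3 × ℝ => g z.1 z.2) (P ×ˢ Ioo 0 T) := by
    refine hs.gradient_continuous.mono (prod_mono (fun x hx => ?_) subset_rfl)
    obtain ⟨m, hm⟩ := mem_iUnion.1 hx
    exact ⟨ha.closure_piece_subset_junction m (subset_closure hm), ha.notMem_ends hm⟩
  have hSm : MeasurableSet (P ×ˢ Ioo (0 : ℝ) T) := hPo.measurableSet.prod measurableSet_Ioo
  have hψm : AEMeasurable (fun z : E 3 × ℝ => ψ z.1 z.2) (volume.restrict (P ×ˢ Ioo 0 T)) :=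
    hcψ.aemeasurable hSm
  have hgm : AEMeasurable (fun z : E 3 × ℝ => ENNReal.ofReal (‖g z.1 z.2‖ ^ 2))
      (volume.restrict (P ×ˢ Ioo 0 T)) :=
    ENNReal.measurable_ofReal.comp_aemeasurable ((hcg.norm.pow 2).aemeasurable hSm)
  have hposm : AEMeasurable (fun z : E 3 × ℝ => {z : E 3 × ℝ | 0 < ψ z.1 z.2}.indicator
      (fun z => ENNReal.ofReal (‖g z.1 z.2‖ ^ 2)) z) (volume.restrict (P ×ˢ Ioo 0 T)) :=
    hgm.indicator₀ (nullMeasurableSet_lt aemeasurable_const hψm)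
  have hint : ∫⁻ z in P ×ˢ Ioo 0 T, ‖gradient (fun x => ψ x z.2) z.1‖ₑ ^ (2 : ℝ) ≤
      ENNReal.ofReal ((Real.sqrt (2 * K) * M) ^ 2) := by
    calc ∫⁻ z in P ×ˢ Ioo 0 T, ‖gradient (fun x => ψ x z.2) z.1‖ₑ ^ (2 : ℝ)
        ≤ ∫⁻ z in P ×ˢ Ioo 0 T, ({z : E 3 × ℝ | 0 < ψ z.1 z.2}.indicator
            (fun z => ENNReal.ofReal (‖g z.1 z.2‖ ^ 2)) z +
          {z : E 3 × ℝ | 0 < -ψ z.1 z.2}.indicator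
            (fun z => ENNReal.ofReal (‖-g z.1 z.2‖ ^ 2)) z) := by
          refine lintegral_mono_ae ?_
          filter_upwards [hs.ae_gradient_eq_zero ha, ae_restrict_mem hSm] with z hz0 hz
          rw [(hs.hasGradient z.1 (hPJ hz.1) z.2 hz.2).gradient]
          have he : ‖g z.1 z.2‖ₑ ^ (2 : ℝ) = ENNReal.ofReal (‖g z.1 z.2‖ ^ 2) := by
            rw [ENNReal.ofReal_pow (norm_nonneg _), ofReal_norm, ENNReal.rpow_ofNat]
          rw [he]
          rcases lt_trichotomy (ψ z.1 z.2) 0 with h | h | h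
          · refine le_add_left ?_
            rw [indicator_of_mem (show z ∈ {z : E 3 × ℝ | 0 < -ψ z.1 z.2} from neg_pos.2 h),
              norm_neg]
          · simp [hz0 h]
          · refine le_add_right ?_
            rw [indicator_of_mem (show z ∈ {z : E 3 × ℝ | 0 < ψ z.1 z.2} from h)]
      _ = _ := lintegral_add_left' hposm _
      _ ≤ ENNReal.ofReal (K * M ^ 2) + ENNReal.ofReal (K * M ^ 2) := add_le_add hpos hneg
      _ = _ := by
          rw [← ENNReal.ofReal_add (by positivity) (by positivity), mul_pow,
            Real.sq_sqrt (by positivity)]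
          congr 1; ring
  rw [Measure.restrict_congr_set hae, eLpNorm_eq_lintegral_rpow_enorm_toReal (by norm_num)
    (by norm_num)]
  have h2 : (2 : ENNReal).toReal = 2 := by norm_num
  rw [h2]
  have hR : 0 ≤ Real.sqrt (2 * K) * M := by positivity
  calc _ ≤ (ENNReal.ofReal ((Real.sqrt (2 * K) * M) ^ 2)) ^ (1 / (2 : ℝ)) :=
        ENNReal.rpow_le_rpow hint (by norm_num)
    _ = ENNReal.ofReal (Real.sqrt (2 * K) * M) := by
        rw [ENNReal.ofReal_rpow_of_nonneg (by positivity) (by norm_num), ← Real.sqrt_eq_rpow,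
          Real.sqrt_sq hR]
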